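/- **Setting.** Let $(Y,X,Z)\sim P$ with $Y$ real, $X\in\mathbb R^d$ and $Z$ in a measurable space. Let $\psi(y,x;\theta)\in\mathbb R^q$ be an estimating function, measurable in $(y,x)$ for each $\theta\in\Theta\subseteq\mathbb R^q$. One observes $n$ labeled points $(y_i,x_i,z_i)$, i.i.d. from $P$, and, independently of them, $N$ unlabeled points $(x_i,z_i)$, i.i.d. from the $(X,Z)$-marginal of $P$. As $n\to\infty$ and $N\to\infty$, $n/(n+N)\to\pi\in(0,1)$ (in particular, $n/(n+N)=\pi$ is allowed). Write $r=1$ for labeled and $r=0$ for unlabeled points; expectations of functions of an observed point are taken under the law with $R\sim\mathrm{Bernoulli}(\pi)$, $R$ independent of $(Y,X,Z)$. Put $A=\mathbb E[\partial\psi(Y,X;\theta)/\partial\theta]_{\theta=\theta_0}$ and $$\phi(\theta)=\frac r\pi A^{-1}\big[\psi(y,x;\theta)-\mathbb E\{\psi(Y,x;\theta)\mid x,z\}\big]+A^{-1}\,\mathbb E\{\psi(Y,x;\theta)\mid x,z\},$$ where the conditional expectations for all $\theta$ are computed from one regular conditional distribution of $Y$ given $(X,Z)$. **Assumptions.** 1.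 $\Theta$ is compact and contains $\theta_0$, the unique solution in $\Theta$ of $\mathbb E\{\psi(Y,X;\theta)\}=0$. 2. $\sup_{\theta\in\Theta}\mathbb E\|\psi(Y,X;\theta)\|^2<\infty$. 3. Almost surely $\theta\mapsto\psi(Y,X;\theta)$ is continuous on $\Theta$. There is an open neighbourhood $B\subseteq\Theta$ of $\theta_0$ on which it is almost surely continuously differentiable, with $\mathbb E\sup_{\theta\in B}\|\partial\psi(Y,X;\theta)/\partial\theta\|<\infty$; and $A$ is nonsingular. 4. $\mathbb E\sup_{\theta\in\Theta}\|\phi(\theta)\|<\infty$. 5. With probability tending to one (for instance, always), the equation $\frac1{n+N}\sum_{i=1}^{n+N}\phi_i(\theta)=0$, where $\phi_i(\theta)$ denotes $\phi(\theta)$ evaluated at the $i$-th observed point, has exactly one solution in $\Theta$, and the (measurable) estimator $\widehat\theta_{\rm EIF}$ equals it. **Conclusion.** As $n\to\infty$ and $N\to\infty$, $$\sqrt n\,(\widehat\theta_{\rm EIF}-\theta_0)\ \xrightarrow{d}\ \mathcal N\big(0,\ \pi\,\mathbb E\{\phi(\theta_0)\phi(\theta_0)^{\rm T}\}\big).$$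 Moreover $\widehat\theta_{\rm EIF}$ attains the semiparametric efficiency bound: $V=\mathbb E\{\phi(\theta_0)\phi(\theta_0)^{\rm T}\}$ is the efficiency bound per observed point for $\theta$, in the model where the law of $(Y,X,Z)$ is unrestricted and $\pi$ is known, and $\sqrt{n+N}\,(\widehat\theta_{\rm EIF}-\theta_0)\xrightarrow{d}\mathcal N(0,V)$. Here the efficiency bound is the covariance matrix of the efficient influence function, that is, of the function $D$ of an observed point, with components in the mean-square closed linear span of the scores, such that $\frac{d}{dt}\theta(P_t)|_{t=0}=\mathbb E[D\,g]$ for every regular one-dimensional submodel $P_t$ with $P_0=P$ and observed-data score $g$. A submodel is regular if its observed-data laws are differentiable in quadratic mean at $t=0$ and, for all $t$ near $0$, $\sup_{\theta\in\Theta}\mathbb E_{P_t}\|\psi(Y,X;\theta)\|^2$ is bounded by a common constant and $\theta(P_t)$ is the unique solution in $\Theta$ of $\mathbb E_{P_t}\psi(Y,X;\theta)=0$. -/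

import Mathlib

open MeasureTheory ProbabilityTheory Filter Topology

namespace PostPred

noncomputable section

/-- `ℝᵏ` with the Euclidean norm. -/
abbrev Vec (k : ℕ) : Type := EuclideanSpace ℝ (Fin k)

/-- A full data point `(y, x, z)`. -/
abbrev Full (d : ℕ) (Z : Type*) : Type _ := ℝ × Vec d × Z

/-- An observed data point: labeled, `inl (y, x, z)` (that is, `r = 1`), or
unlabeled, `inr (x, z)` (that is, `r = 0`). -/
abbrev Obs (d : ℕ) (Z : Type*) : Type _ := Full d Z ⊕ (Vec d × Z)

variable {d q : ℕ} {Z : Type*} [MeasurableSpace Z]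

/-- The law of one observed data point when the full data have law `P` and the label indicator is
Bernoulli with known success probability `p`, independent of the full data. -/
def obsLaw (p : ℝ) (P : Measure (Full d Z)) : Measure (Obs d Z) :=
  ENNReal.ofReal p • P.map Sum.inl
    + ENNReal.ofReal (1 - p) • P.map (fun w => (Sum.inr w.2 : Obs d Z))

/-- The population estimating function `θ ↦ E{ψ(Y, X; θ)}`. -/
def popMean (ψ : ℝ → Vec d → Vec q → Vec q) (P : Measure (Full d Z)) (θ : Vec q) : Vec q :=
  ∫ w, ψ w.1 w.2.1 θ ∂P

/-- `θ₀` is the unique solution in `Θ` of `E{ψ(Y, X; θ)} = 0`. -/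
def IsUniqueSolution (ψ : ℝ → Vec d → Vec q → Vec q) (P : Measure (Full d Z)) (Θ : Set (Vec q))
    (θ₀ : Vec q) : Prop :=
  θ₀ ∈ Θ ∧ ∀ θ ∈ Θ, (popMean ψ P θ = 0 ↔ θ = θ₀)

/-- The matrix `A = E{∂ψ(Y, X; θ)/∂θ}`, evaluated at `θ = θ₀`. -/
def jacobian (ψ : ℝ → Vec d → Vec q → Vec q) (P : Measure (Full d Z)) (θ₀ : Vec q) :
    Matrix (Fin q) (Fin q) ℝ :=
  Matrix.of fun i j =>
    ∫ w, (fderiv ℝ (fun θ => ψ w.1 w.2.1 θ) θ₀ (EuclideanSpace.single j 1)) i ∂P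

/-- The conditional mean `E{ψ(Y, x; θ) ∣ X = x, Z = z}`, computed for all `θ` simultaneously from
the regular conditional distribution of `Y` given `(X, Z)`. -/
def condMean (ψ : ℝ → Vec d → Vec q → Vec q) (P : Measure (Full d Z)) [IsFiniteMeasure P]
    (θ : Vec q) (v : Vec d × Z) : Vec q :=
  ∫ y, ψ y v.1 θ ∂(condDistrib (fun w : Full d Z => w.1) (fun w : Full d Z => w.2) P v)

/-- The function
`φ = (r/π) A⁻¹ [ψ(y, x; θ) - E{ψ(Y, x; θ) ∣ x, z}] + A⁻¹ E{ψ(Y, x; θ) ∣ x, z}`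
of the observed data point and of `θ`, with `p` in the role of `π`. -/
def eif (ψ : ℝ → Vec d → Vec q → Vec q) (P : Measure (Full d Z)) [IsFiniteMeasure P] (p : ℝ)
    (θ₀ θ : Vec q) : Obs d Z → Vec q
  | Sum.inl (y, v) =>
      (1 / p) • Matrix.toEuclideanCLM (𝕜 := ℝ) (jacobian ψ P θ₀)⁻¹
          (ψ y v.1 θ - condMean ψ P θ v)
        + Matrix.toEuclideanCLM (𝕜 := ℝ) (jacobian ψ P θ₀)⁻¹ (condMean ψ P θ v)
  | Sum.inr v => Matrix.toEuclideanCLM (𝕜 := ℝ) (jacobian ψ P θ₀)⁻¹ (condMean ψ P θ v)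

/-- The matrix `E{D Dᵀ}` for a function `D` of one data point with law `Q`. -/
def secondMoment {O : Type*} [MeasurableSpace O] (Q : Measure O) (D : O → Vec q) :
    Matrix (Fin q) (Fin q) ℝ :=
  Matrix.of fun i j => ∫ o, D o i * D o j ∂Q

/-- The empirical equation function
`θ ↦ (n + N)⁻¹ ∑ᵢ φ(oᵢ, θ)`, over `n` labeled points and `N` unlabeled ones. -/
def empiricalEIF (ψ : ℝ → Vec d → Vec q → Vec q) (P : Measure (Full d Z)) [IsFiniteMeasure P]
    (p : ℝ) (θ₀ : Vec q) (n N : ℕ) (lab : ℕ → Full d Z) (unl : ℕ → Vec d × Z) (θ : Vec q) :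
    Vec q :=
  (1 / ((n : ℝ) + N)) •
    (∑ i ∈ Finset.range n, eif ψ P p θ₀ θ (Sum.inl (lab i))
      + ∑ i ∈ Finset.range N, eif ψ P p θ₀ θ (Sum.inr (unl i)))

/-- `Q t` is differentiable in quadratic mean at `t = 0` with score `g`. -/
def IsQMD {O : Type*} [MeasurableSpace O] (Q : ℝ → Measure O) (g : O → ℝ) : Prop :=
  ∃ (ν : Measure O) (f : ℝ → O → ℝ), SigmaFinite ν ∧
    (∀ t, Measurable (f t)) ∧ (∀ t o, 0 ≤ f t o) ∧
    (∀ t, Q t = ν.withDensity (fun o => ENNReal.ofReal (f t o))) ∧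
    MemLp g 2 (Q 0) ∧
    Tendsto
      (fun t => eLpNorm
        (fun o => (√(f t o) - √(f 0 o)) / t - 1 / 2 * g o * √(f 0 o)) 2 ν)
      (𝓝[≠] 0) (𝓝 0)

/-- A regular one-dimensional parametric submodel through `P` of the model in which the law of
`(Y, X, Z)` is unrestricted and the labeling probability `p` is known: laws `Pt t` of the full
data with `Pt 0 = P`, whose observed-data laws are differentiable in quadratic mean at `0`, with
observed-data score `g`; the second moments of `ψ` stay bounded near `t = 0`, and
the parameter `θ(Pt t)` is well defined near `t = 0`, with value `ϑ t`. -/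
structure IsRegularSubmodel (ψ : ℝ → Vec d → Vec q → Vec q) (P : Measure (Full d Z)) (p : ℝ)
    (Θ : Set (Vec q)) (Pt : ℝ → Measure (Full d Z)) (g : Obs d Z → ℝ) (ϑ : ℝ → Vec q) :
    Prop where
  isProb : ∀ t, IsProbabilityMeasure (Pt t)
  base : Pt 0 = P
  qmd : IsQMD (fun t => obsLaw p (Pt t)) g
  moment : ∃ C : NNReal, ∀ᶠ t in 𝓝 (0 : ℝ), ∀ θ ∈ Θ, ∫⁻ w, ‖ψ w.1 w.2.1 θ‖ₑ ^ 2 ∂(Pt t) ≤ C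
  param : ∀ᶠ t in 𝓝 (0 : ℝ), IsUniqueSolution ψ (Pt t) Θ (ϑ t)

/-- The tangent space at `P`: the mean-square closure of the linear span of the scores of all
regular parametric submodels. -/
def tangentSpace (ψ : ℝ → Vec d → Vec q → Vec q) (P : Measure (Full d Z)) (p : ℝ)
    (Θ : Set (Vec q)) : Submodule ℝ (Lp ℝ 2 (obsLaw p P)) :=
  (Submodule.span ℝ {G : Lp ℝ 2 (obsLaw p P) |
    ∃ Pt g ϑ, IsRegularSubmodel ψ P p Θ Pt g ϑ ∧ G =ᵐ[obsLaw p P] g}).topologicalClosure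

/-- `D` is the efficient influence function (canonical gradient) of the parameter `θ` at `P`:
along every regular parametric submodel the parameter is differentiable with derivative
`E{D g}`, where `g` is the score, and the components of `D` lie in the tangent space. -/
structure IsEfficientInfluenceFunction (ψ : ℝ → Vec d → Vec q → Vec q) (P : Measure (Full d Z))
    (p : ℝ) (Θ : Set (Vec q)) (D : Obs d Z → Vec q) : Prop where
  memLp : MemLp D 2 (obsLaw p P)
  gradient : ∀ Pt g ϑ, IsRegularSubmodel ψ P p Θ Pt g ϑ →
    HasDerivAt ϑ (∫ o, g o • D o ∂(obsLaw p P)) 0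
  tangent : ∀ i, ∃ G ∈ tangentSpace ψ P p Θ, G =ᵐ[obsLaw p P] fun o => D o i

/-- `V` is the semiparametric efficiency bound (per observed data point) for the parameter `θ`
at `P`: the covariance matrix of the efficient influence function. -/
def IsEfficiencyBound (ψ : ℝ → Vec d → Vec q → Vec q) (P : Measure (Full d Z))
    (p : ℝ) (Θ : Set (Vec q)) (V : Matrix (Fin q) (Fin q) ℝ) : Prop :=
  ∃ D, IsEfficientInfluenceFunction ψ P p Θ D ∧ V = secondMoment (obsLaw p P) D

end

end PostPred

open PostPred

set_option linter.unusedSectionVars false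

/-! Multiplying φ(θ) by A gives the augmented inverse-probability-weighted version of ψ(θ), called
`obsLift`. The augmentation term averages out given the covariates, so `obsLift` has mean E ψ(θ)
over labeled points and, separately, over unlabeled points.

Asymptotic normality. The data are two independent i.i.d. samples of deterministic sizes, not an
i.i.d. sample from the Bernoulli mixture. Since the label fraction tends to π, pooled means still
converge to mixture means. Since both stratum means of φ(θ₀) vanish, the pooled central limit
theorem has the mixture second moment as its covariance. Compactness, continuity and an integrable
envelope give Wald consistency (`TwoSample.consistency`). A dominated continuous derivative gives a
stochastic linearization whose mean derivative, after multiplication by A⁻¹, is the identity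
(`TwoSample.linear_expansion`). Hence the estimator minus θ₀ is minus the pooled mean of φ(θ₀), up
to a negligible error (`asymptotic_linearity`). Both regularity properties are phrased through small
integrable bounds on increments of ψ. Conditional averaging preserves such bounds, so they pass to φ
without differentiating a conditional mean.

Gradient. `obsLift f` is 1/π times f on labeled points plus a multiple of a `contrast`, a function
comparing the covariates of the two strata. Contrasts of bounded functions have mean zero along
every submodel, so scores are orthogonal to them, and truncation extends this to L². Thus E[gφ] sees
only the labeled term. That term is the derivative of the mean of ψ along the path
(`IsQMD.tendsto_integral_sub`, the analytic core). Combined with the equation E ψ(θ(P_t)) = 0 under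
P_t and the inverse function theorem, it gives θ(P_t) the derivative −E[gφ(θ₀)] at 0
(`RegularEquation.hasDerivAt`).

Tangent space. A bounded centered direction a defines densities 1 + ta. The implicit function
theorem near θ₀ and compactness away from it give a unique root for small t, so this is a regular
submodel, with observed score `obsScore P a`. Each component of −φ(θ₀) is the `obsScore` of its own
labeled part. Density of bounded directions in L², together with the fact that `obsScore` is an L²
contraction, puts it in the tangent space (`RegularEquation.mem_tangentSpace`). So −φ(θ₀) is the
efficient influence function, and its second moment is that of φ(θ₀). -/

namespace PostPred

/-! ### Mixtures of two laws on a sum type -/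

section Mixture

variable {S T E : Type*} [MeasurableSpace S] [MeasurableSpace T]
  [NormedAddCommGroup E] {p : ℝ} {P : Measure S} {Q : Measure T}

lemma measurableEmbedding_sumInl : MeasurableEmbedding (Sum.inl : S → S ⊕ T) :=
  ⟨Sum.inl_injective, measurable_inl, fun _ hs => measurableSet_inl_image.2 hs⟩

lemma measurableEmbedding_sumInr : MeasurableEmbedding (Sum.inr : T → S ⊕ T) :=
  ⟨Sum.inr_injective, measurable_inr, fun _ hs => measurableSet_inr_image.2 hs⟩

/-- The law on `S ⊕ T` that draws from `P` with probability `p` and from `Q` otherwise. -/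
noncomputable def mixLaw (p : ℝ) (P : Measure S) (Q : Measure T) : Measure (S ⊕ T) :=
  ENNReal.ofReal p • P.map Sum.inl + ENNReal.ofReal (1 - p) • Q.map Sum.inr

lemma ofReal_ne_zero_of_mem_Ioo (hp : p ∈ Set.Ioo (0 : ℝ) 1) :
    ENNReal.ofReal p ≠ 0 ∧ ENNReal.ofReal (1 - p) ≠ 0 := by
  have h1 := hp.1
  have h2 := hp.2
  constructor <;> simp <;> linarith

lemma ae_mixLaw_iff (hp : p ∈ Set.Ioo (0 : ℝ) 1) {q : S ⊕ T → Prop} :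
    (∀ᵐ o ∂(mixLaw p P Q), q o) ↔ (∀ᵐ w ∂P, q (Sum.inl w)) ∧ ∀ᵐ v ∂Q, q (Sum.inr v) := by
  obtain ⟨h1, h2⟩ := ofReal_ne_zero_of_mem_Ioo hp
  rw [mixLaw, ae_add_measure_iff, Measure.ae_ennreal_smul_measure_iff h1,
    Measure.ae_ennreal_smul_measure_iff h2, measurableEmbedding_sumInl.ae_map_iff,
    measurableEmbedding_sumInr.ae_map_iff]

lemma lintegral_mixLaw (f : S ⊕ T → ENNReal) :
    ∫⁻ o, f o ∂(mixLaw p P Q) = ENNReal.ofReal p * ∫⁻ w, f (Sum.inl w) ∂P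
      + ENNReal.ofReal (1 - p) * ∫⁻ v, f (Sum.inr v) ∂Q := by
  rw [mixLaw, lintegral_add_measure, lintegral_smul_measure, lintegral_smul_measure,
    measurableEmbedding_sumInl.lintegral_map, measurableEmbedding_sumInr.lintegral_map]
  rfl

lemma integrable_mixLaw_iff (hp : p ∈ Set.Ioo (0 : ℝ) 1) {f : S ⊕ T → E} :
    Integrable f (mixLaw p P Q) ↔
      Integrable (fun w => f (Sum.inl w)) P ∧ Integrable (fun v => f (Sum.inr v)) Q := by
  obtain ⟨h1, h2⟩ := ofReal_ne_zero_of_mem_Ioo hp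
  rw [mixLaw, integrable_add_measure, integrable_smul_measure h1 ENNReal.ofReal_ne_top,
    integrable_smul_measure h2 ENNReal.ofReal_ne_top, measurableEmbedding_sumInl.integrable_map_iff,
    measurableEmbedding_sumInr.integrable_map_iff]
  rfl

lemma integral_mixLaw [NormedSpace ℝ E] (hp : p ∈ Set.Ioo (0 : ℝ) 1) {f : S ⊕ T → E}
    (hf : Integrable f (mixLaw p P Q)) :
    ∫ o, f o ∂(mixLaw p P Q) =
      p • ∫ w, f (Sum.inl w) ∂P + (1 - p) • ∫ v, f (Sum.inr v) ∂Q := by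
  obtain ⟨h1, h2⟩ := ofReal_ne_zero_of_mem_Ioo hp
  have hp1 := hp.1.le
  have hp2 : 0 ≤ 1 - p := by linarith [hp.2]
  rw [mixLaw, integrable_add_measure] at hf
  rw [mixLaw, integral_add_measure hf.1 hf.2, integral_smul_measure, integral_smul_measure,
    measurableEmbedding_sumInl.integral_map, measurableEmbedding_sumInr.integral_map,
    ENNReal.toReal_ofReal hp1, ENNReal.toReal_ofReal hp2]

lemma isProbabilityMeasure_mixLaw (hp : p ∈ Set.Ioo (0 : ℝ) 1) [IsProbabilityMeasure P]
    [IsProbabilityMeasure Q] : IsProbabilityMeasure (mixLaw p P Q) := by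
  constructor
  have := lintegral_mixLaw (p := p) (P := P) (Q := Q) (fun _ => 1)
  simp only [lintegral_const, measure_univ, mul_one, one_mul] at this
  rw [this, ← ENNReal.ofReal_add hp.1.le (by linarith [hp.2])]
  simp

lemma aestronglyMeasurable_smul_measure_iff {R : Measure S} {c : ENNReal} (hc : c ≠ 0)
    {f : S → E} : AEStronglyMeasurable f (c • R) ↔ AEStronglyMeasurable f R := by
  simp only [AEStronglyMeasurable, Filter.EventuallyEq, Measure.ae_ennreal_smul_measure_iff hc]

lemma aestronglyMeasurable_mixLaw_iff (hp : p ∈ Set.Ioo (0 : ℝ) 1) {f : S ⊕ T → E} :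
    AEStronglyMeasurable f (mixLaw p P Q) ↔ AEStronglyMeasurable (fun w => f (Sum.inl w)) P ∧
      AEStronglyMeasurable (fun v => f (Sum.inr v)) Q := by
  obtain ⟨h1, h2⟩ := ofReal_ne_zero_of_mem_Ioo hp
  rw [mixLaw, aestronglyMeasurable_add_measure_iff, aestronglyMeasurable_smul_measure_iff h1,
    aestronglyMeasurable_smul_measure_iff h2,
    measurableEmbedding_sumInl.aestronglyMeasurable_map_iff,
    measurableEmbedding_sumInr.aestronglyMeasurable_map_iff]
  rfl

lemma memLp_two_mixLaw_iff (hp : p ∈ Set.Ioo (0 : ℝ) 1) {f : S ⊕ T → E} :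
    MemLp f 2 (mixLaw p P Q) ↔
      MemLp (fun w => f (Sum.inl w)) 2 P ∧ MemLp (fun v => f (Sum.inr v)) 2 Q := by
  constructor
  · intro h
    obtain ⟨h1, h2⟩ := (aestronglyMeasurable_mixLaw_iff hp).1 h.1
    rw [memLp_two_iff_integrable_sq_norm h1, memLp_two_iff_integrable_sq_norm h2]
    rw [memLp_two_iff_integrable_sq_norm h.1] at h
    exact (integrable_mixLaw_iff hp).1 h
  · rintro ⟨h1, h2⟩
    have h := (aestronglyMeasurable_mixLaw_iff (p := p) (P := P) (Q := Q) hp).2 ⟨h1.1, h2.1⟩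
    rw [memLp_two_iff_integrable_sq_norm h]
    rw [memLp_two_iff_integrable_sq_norm h1.1] at h1
    rw [memLp_two_iff_integrable_sq_norm h2.1] at h2
    exact (integrable_mixLaw_iff hp).2 ⟨h1, h2⟩

end Mixture

/-! ### Events of probability tending to one -/

section HighProb

variable {Ω : Type*} [MeasurableSpace Ω] {μ : Measure Ω}

/-- The events `A k` have (outer) probability of failure tending to zero. -/
def WithHighProb (μ : Measure Ω) (A : ℕ → Ω → Prop) : Prop :=
  Tendsto (fun k => μ {ω | ¬ A k ω}) atTop (𝓝 0)

lemma WithHighProb.and {A B : ℕ → Ω → Prop} (hA : WithHighProb μ A) (hB : WithHighProb μ B) :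
    WithHighProb μ (fun k ω => A k ω ∧ B k ω) := by
  refine tendsto_of_tendsto_of_tendsto_of_le_of_le tendsto_const_nhds
    (by simpa using Tendsto.add hA hB) (fun _ => zero_le) fun k => ?_
  refine (measure_mono ?_).trans (measure_union_le _ _)
  intro ω hω
  simp only [Set.mem_ofPred_eq, not_and_or, Set.mem_union] at hω ⊢
  exact hω

lemma WithHighProb.mono_ae {A B : ℕ → Ω → Prop} (hA : WithHighProb μ A)
    (h : ∀ᵐ ω ∂μ, ∀ k, A k ω → B k ω) : WithHighProb μ B := by
  refine tendsto_of_tendsto_of_tendsto_of_le_of_le tendsto_const_nhds hA (fun _ => zero_le)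
    fun k => measure_mono_ae ?_
  filter_upwards [h] with ω hω hB hA
  exact hB (hω k hA)

lemma WithHighProb.mono {A B : ℕ → Ω → Prop} (hA : WithHighProb μ A)
    (h : ∀ k ω, A k ω → B k ω) : WithHighProb μ B :=
  hA.mono_ae (.of_forall fun ω k => h k ω)

lemma withHighProb_true : WithHighProb μ (fun _ _ => True) := by
  simp [WithHighProb]

lemma withHighProb_of_tendsto_ae [IsFiniteMeasure μ] {E : Type*} [PseudoMetricSpace E]
    {X : ℕ → Ω → E} {c : E}
    (hX : ∀ k, AEStronglyMeasurable (X k) μ) (h : ∀ᵐ ω ∂μ, Tendsto (fun k => X k ω) atTop (𝓝 c))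
    {U : Set E} (hU : U ∈ 𝓝 c) : WithHighProb μ (fun k ω => X k ω ∈ U) := by
  obtain ⟨ε, hε, hεU⟩ := Metric.mem_nhds_iff.1 hU
  have := tendstoInMeasure_of_tendsto_ae (g := fun _ => c) hX h (ENNReal.ofReal ε) (by simpa)
  refine tendsto_of_tendsto_of_tendsto_of_le_of_le tendsto_const_nhds this (fun _ => zero_le)
    fun k => measure_mono ?_
  intro ω hω
  simp only [Set.mem_ofPred_eq] at hω ⊢
  by_contra! h2
  refine hω (hεU ?_)
  rwa [edist_dist, ENNReal.ofReal_lt_ofReal_iff hε] at h2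

end HighProb

/-! ### Laws of large numbers and the central limit theorem for pooled means -/

section Pooled

variable {S T E : Type*} [MeasurableSpace S] [MeasurableSpace T]
  [NormedAddCommGroup E] [NormedSpace ℝ E]

/-- The mean of `h` over `n` points of the first kind and `N` points of the second kind. -/
noncomputable def pooledMean (h : S ⊕ T → E) (n N : ℕ) (x : ℕ → S) (y : ℕ → T) : E :=
  (1 / ((n : ℝ) + N)) •
    (∑ i ∈ Finset.range n, h (Sum.inl (x i)) + ∑ i ∈ Finset.range N, h (Sum.inr (y i)))

variable {Ω : Type*} [MeasurableSpace Ω] {μ : Measure Ω}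

/-- Two independent i.i.d. samples, with laws `P` and `Q`, whose sizes `n k` and `N k` tend to
infinity in such a way that the fraction of the first tends to `p`. -/
structure TwoSample (μ : Measure Ω) (p : ℝ) (P : Measure S) (Q : Measure T) (n N : ℕ → ℕ)
    (x : ℕ → Ω → S) (y : ℕ → Ω → T) : Prop where
  hp : p ∈ Set.Ioo (0 : ℝ) 1
  hn : Tendsto n atTop atTop
  hN : Tendsto N atTop atTop
  frac : Tendsto (fun k => (n k : ℝ) / ((n k : ℝ) + N k)) atTop (𝓝 p)
  law_fst : ∀ i, HasLaw (x i) P μ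
  law_snd : ∀ i, HasLaw (y i) Q μ
  indep_fst : iIndepFun x μ
  indep_snd : iIndepFun y μ
  indep : IndepFun (fun ω i => x i ω) (fun ω i => y i ω) μ

variable {p : ℝ} {P : Measure S} {Q : Measure T} {n N : ℕ → ℕ} {x : ℕ → Ω → S} {y : ℕ → Ω → T}

lemma TwoSample.frac' (H : TwoSample μ p P Q n N x y) :
    Tendsto (fun k => (N k : ℝ) / ((n k : ℝ) + N k)) atTop (𝓝 (1 - p)) := by
  refine (H.frac.const_sub 1).congr' ?_
  filter_upwards [H.hn.eventually_gt_atTop 0] with k hk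
  have : (n k : ℝ) + N k ≠ 0 := by positivity
  field_simp
  ring

/-- There are countably many sample points, so one null event serves the whole sample; this is how
envelope inequalities become pathwise. -/
lemma TwoSample.ae_of_ae (H : TwoSample μ p P Q n N x y) {q : S ⊕ T → Prop}
    (h : ∀ᵐ o ∂(mixLaw p P Q), q o) :
    ∀ᵐ ω ∂μ, (∀ i, q (Sum.inl (x i ω))) ∧ ∀ i, q (Sum.inr (y i ω)) := by
  obtain ⟨h1, h2⟩ := (ae_mixLaw_iff H.hp).1 h
  refine Filter.Eventually.and (ae_all_iff.2 fun i => ?_) (ae_all_iff.2 fun i => ?_)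
  · rw [← (H.law_fst i).map_eq] at h1
    exact ae_of_ae_map (H.law_fst i).aemeasurable h1
  · rw [← (H.law_snd i).map_eq] at h2
    exact ae_of_ae_map (H.law_snd i).aemeasurable h2

variable [MeasurableSpace E] [BorelSpace E] [SecondCountableTopology E]

lemma tendsto_mean_of_iid [CompleteSpace E] {X : ℕ → Ω → S} (hX : ∀ i, HasLaw (X i) P μ)
    (hind : iIndepFun X μ) {f : S → E} (hf : Measurable f) (hfi : Integrable f P) :
    ∀ᵐ ω ∂μ, Tendsto (fun m : ℕ => (m : ℝ)⁻¹ • ∑ i ∈ Finset.range m, f (X i ω)) atTop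
      (𝓝 (∫ w, f w ∂P)) := by
  have hid : ∀ i, IdentDistrib (X i) (X 0) μ μ := fun i =>
    ⟨(hX i).aemeasurable, (hX 0).aemeasurable, by rw [(hX i).map_eq, (hX 0).map_eq]⟩
  have h := strong_law_ae (μ := μ) (fun i ω => f (X i ω)) ?_ ?_ ?_
  · have e : ∫ ω, f (X 0 ω) ∂μ = ∫ w, f w ∂P :=
      (hX 0).integral_comp hf.aestronglyMeasurable
    rwa [e] at h
  · rw [← (hX 0).map_eq] at hfi
    exact hfi.comp_aemeasurable (hX 0).aemeasurable
  · intro i j hij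
    exact (hind.indepFun hij).comp hf hf
  · intro i
    exact (hid i).comp hf

/-- The pooled mean is the combination of the two sample means with weights n/(n+N) and N/(n+N).
These converge to p and 1 - p, so the limit is the mixture mean although the labels are not random.
-/
lemma TwoSample.tendsto_pooledMean [CompleteSpace E] (H : TwoSample μ p P Q n N x y)
    {h : S ⊕ T → E} (hm : Measurable h) (hi : Integrable h (mixLaw p P Q)) :
    ∀ᵐ ω ∂μ, Tendsto (fun k => pooledMean h (n k) (N k) (fun i => x i ω) (fun i => y i ω)) atTop
      (𝓝 (∫ o, h o ∂(mixLaw p P Q))) := by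
  obtain ⟨hi1, hi2⟩ := (integrable_mixLaw_iff H.hp).1 hi
  rw [integral_mixLaw H.hp hi]
  filter_upwards [tendsto_mean_of_iid H.law_fst H.indep_fst (hm.comp measurable_inl) hi1,
    tendsto_mean_of_iid H.law_snd H.indep_snd (hm.comp measurable_inr) hi2] with ω h1 h2
  refine ((H.frac.smul (h1.comp H.hn)).add (H.frac'.smul (h2.comp H.hN))).congr' ?_
  filter_upwards [H.hn.eventually_gt_atTop 0, H.hN.eventually_gt_atTop 0] with k hk hk'
  have e1 : (n k : ℝ) / (n k + N k) * (n k : ℝ)⁻¹ = 1 / (n k + N k) := by field_simp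
  have e2 : (N k : ℝ) / (n k + N k) * (N k : ℝ)⁻¹ = 1 / (n k + N k) := by field_simp
  simp only [Function.comp_apply, smul_smul, e1, e2, pooledMean, smul_add]

lemma TwoSample.aemeasurable_pooledMean (H : TwoSample μ p P Q n N x y)
    {h : S ⊕ T → E} (hm : Measurable h) (k : ℕ) :
    AEMeasurable (fun ω => pooledMean h (n k) (N k) (fun i => x i ω) (fun i => y i ω)) μ := by
  unfold pooledMean
  refine AEMeasurable.const_smul (.add ?_ ?_) _
  · exact Finset.aemeasurable_fun_sum _ fun i _ =>
      (hm.comp measurable_inl).comp_aemeasurable (H.law_fst i).aemeasurable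
  · exact Finset.aemeasurable_fun_sum _ fun i _ =>
      (hm.comp measurable_inr).comp_aemeasurable (H.law_snd i).aemeasurable

lemma TwoSample.withHighProb_pooledMean [CompleteSpace E] [IsFiniteMeasure μ]
    (H : TwoSample μ p P Q n N x y)
    {h : S ⊕ T → E} (hm : Measurable h) (hi : Integrable h (mixLaw p P Q)) {U : Set E}
    (hU : U ∈ 𝓝 (∫ o, h o ∂(mixLaw p P Q))) :
    WithHighProb μ (fun k ω =>
      pooledMean h (n k) (N k) (fun i => x i ω) (fun i => y i ω) ∈ U) :=
  withHighProb_of_tendsto_ae (fun k => (H.aemeasurable_pooledMean hm k).aestronglyMeasurable)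
    (H.tendsto_pooledMean hm hi) hU

/-- The characteristic function of the scaled sum of centered i.i.d. variables. -/
lemma tendsto_charFun_scaled_sum [IsProbabilityMeasure μ] {X : ℕ → Ω → S}
    (hX : ∀ i, HasLaw (X i) P μ) (hind : iIndepFun X μ) {f : S → ℝ} (hf : Measurable f)
    (hf2 : MemLp f 2 P) (hf0 : ∫ w, f w ∂P = 0) {m : ℕ → ℕ} (hm : Tendsto m atTop atTop)
    {c : ℕ → ℝ} {c₀ : ℝ} (hc : Tendsto c atTop (𝓝 c₀)) :
    Tendsto (fun k => charFun (μ.map fun ω =>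
      c k * ((√(m k : ℝ))⁻¹ * ∑ i ∈ Finset.range (m k), f (X i ω))) 1) atTop
      (𝓝 (Complex.exp (-(((c₀ ^ 2 * ∫ w, f w ^ 2 ∂P : ℝ) : ℂ) / 2)))) := by
  have hid : ∀ i, IdentDistrib (X i) (X 0) μ μ := fun i =>
    ⟨(hX i).aemeasurable, (hX 0).aemeasurable, by rw [(hX i).map_eq, (hX 0).map_eq]⟩
  have hm0 : ∫ ω, f (X 0 ω) ∂μ = 0 := by
    rw [← hf0]; exact (hX 0).integral_comp hf.aestronglyMeasurable
  have hvar : Var[fun ω => f (X 0 ω); μ] = ∫ w, f w ^ 2 ∂P := by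
    rw [variance_eq_integral (X := fun ω => f (X 0 ω)) (hf.comp_aemeasurable (hX 0).aemeasurable), hm0]
    simp only [sub_zero]
    exact (hX 0).integral_comp (f := fun w => f w ^ 2) (hf.pow_const 2).aestronglyMeasurable
  have hL2 : MemLp (fun ω => f (X 0 ω)) 2 μ := by
    rw [← (hX 0).map_eq] at hf2
    exact hf2.comp_of_map (hX 0).aemeasurable
  have hclt := tendstoInDistribution_inv_sqrt_mul_sum_sub (P := μ) (X := fun i ω => f (X i ω))
    (Y := id) (P' := gaussianReal 0 Var[fun ω => f (X 0 ω); μ].toNNReal) HasLaw.id hL2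
    (hind.comp (fun _ => f) (fun _ => hf)) (fun i => (hid i).comp hf)
  have hclt' : TendstoInDistribution
      (fun k ω => (√(m k : ℝ))⁻¹ * ∑ i ∈ Finset.range (m k), f (X i ω)) atTop id (fun _ => μ)
      (gaussianReal 0 Var[fun ω => f (X 0 ω); μ].toNNReal) := by
    refine ⟨fun k => ?_, aemeasurable_id, ?_⟩
    · refine AEMeasurable.const_mul (Finset.aemeasurable_fun_sum _ fun i _ => ?_) _
      exact hf.comp_aemeasurable (hX i).aemeasurable
    · have := hclt.tendsto.comp hm
      simp only [hm0, mul_zero, sub_zero] at this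
      exact this
  -- The deterministic factors `c k` enter as constant random variables converging in measure, so
  -- that Slutsky's theorem applies.
  have hs := hclt'.continuous_comp_prodMk_of_tendstoInMeasure_const (E' := ℝ)
    (g := fun z : ℝ × ℝ => z.2 * z.1) (by fun_prop) (Y := fun k _ => c k) (c := c₀)
    (tendstoInMeasure_of_tendsto_ae (fun _ => aestronglyMeasurable_const) (.of_forall fun _ => hc))
    (fun _ => aemeasurable_const)
  have := ProbabilityMeasure.tendsto_iff_tendsto_charFun.1 hs.tendsto 1
  have hnn : 0 ≤ ∫ w, f w ^ 2 ∂P := integral_nonneg fun _ => sq_nonneg _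
  have e : charFun ((gaussianReal 0 Var[fun ω => f (X 0 ω); μ].toNNReal).map
      (fun ω => c₀ * id ω)) 1 =
      Complex.exp (-(((c₀ ^ 2 * ∫ w, f w ^ 2 ∂P : ℝ) : ℂ) / 2)) := by
    rw [charFun_map_mul_comp aemeasurable_id, Measure.map_id, charFun_gaussianReal, hvar,
      Real.coe_toNNReal _ hnn]
    congr 1
    push_cast
    ring
  rw [← e]
  exact this

open scoped RealInnerProductSpace in
lemma inner_secondMoment {O : Type*} [MeasurableSpace O] {ν : Measure O} {q : ℕ} {D : O → Vec q}
    (hD : MemLp D 2 ν) (t : Vec q) :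
    t.ofLp ⬝ᵥ (secondMoment ν D).mulVec t.ofLp = ∫ o, ⟪D o, t⟫ ^ 2 ∂ν := by
  have hDi : ∀ i, MemLp (fun o => D o i) 2 ν := fun i =>
    (EuclideanSpace.proj (𝕜 := ℝ) i).comp_memLp' hD
  have hint : ∀ i j, Integrable (fun o => t i * (D o i * D o j * t j)) ν := fun i j =>
    (((hDi i).integrable_mul (hDi j)).mul_const _).const_mul _
  calc _ = ∑ i, ∑ j, ∫ o, t i * (D o i * D o j * t j) ∂ν := by
        simp only [dotProduct, Matrix.mulVec, secondMoment, Matrix.of_apply, Finset.mul_sum,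
          integral_const_mul, integral_mul_const]
    _ = ∫ o, ∑ i, ∑ j, t i * (D o i * D o j * t j) ∂ν := by
        rw [integral_finsetSum _ fun i _ => integrable_finsetSum _ fun j _ => hint i j]
        refine Finset.sum_congr rfl fun i _ => ?_
        rw [integral_finsetSum _ fun j _ => hint i j]
    _ = _ := by
        congr 1 with o
        simp only [PiLp.inner_apply, RCLike.inner_apply, conj_trivial, sq, Finset.sum_mul_sum]
        refine Finset.sum_congr rfl fun i _ => Finset.sum_congr rfl fun j _ => ?_
        ring

lemma posSemidef_secondMoment {O : Type*} [MeasurableSpace O] {ν : Measure O} {q : ℕ}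
    {D : O → Vec q} (hD : MemLp D 2 ν) : (secondMoment ν D).PosSemidef := by
  refine Matrix.PosSemidef.of_dotProduct_mulVec_nonneg ?_ fun t => ?_
  · ext i j
    simp [secondMoment, mul_comm]
  · have := inner_secondMoment hD (WithLp.toLp 2 t)
    simp only [star_trivial]
    simp only at this
    rw [this]
    exact integral_nonneg fun _ => sq_nonneg _

open scoped RealInnerProductSpace in
/-- **Central limit theorem** for pooled means of two independent samples. -/
theorem TwoSample.tendstoInDistribution_pooledMean [IsProbabilityMeasure μ]
    (H : TwoSample μ p P Q n N x y) {q : ℕ} {h : S ⊕ T → Vec q} (hm : Measurable h)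
    (h2 : MemLp h 2 (mixLaw p P Q)) (hl : ∫ w, h (Sum.inl w) ∂P = 0)
    (hr : ∫ v, h (Sum.inr v) ∂Q = 0) :
    TendstoInDistribution (fun k ω => √((n k : ℝ) + N k) •
        pooledMean h (n k) (N k) (fun i => x i ω) (fun i => y i ω)) atTop id (fun _ => μ)
      (multivariateGaussian 0 (secondMoment (mixLaw p P Q) h)) := by
  have : IsProbabilityMeasure P := (H.law_fst 0).isProbabilityMeasure_iff.1 ‹_›
  have : IsProbabilityMeasure Q := (H.law_snd 0).isProbabilityMeasure_iff.1 ‹_›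
  have hZ : ∀ k, AEMeasurable (fun ω => √((n k : ℝ) + N k) •
        pooledMean h (n k) (N k) (fun i => x i ω) (fun i => y i ω)) μ := fun k =>
    AEMeasurable.fun_const_smul (H.aemeasurable_pooledMean hm k) _
  refine ⟨hZ, aemeasurable_id, ProbabilityMeasure.tendsto_iff_tendsto_charFun.2 fun t => ?_⟩
  obtain ⟨h2l, h2r⟩ := (memLp_two_mixLaw_iff H.hp).1 h2
  set f : S ⊕ T → ℝ := fun o => ⟪h o, t⟫ with hf
  have hfm : Measurable f := by fun_prop
  have hfl : MemLp (fun w => f (Sum.inl w)) 2 P := h2l.inner_const t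
  have hfr : MemLp (fun v => f (Sum.inr v)) 2 Q := h2r.inner_const t
  have hfl0 : ∫ w, f (Sum.inl w) ∂P = 0 := by
    simp_rw [hf, real_inner_comm t]
    rw [integral_inner (h2l.integrable (by norm_num)), hl, inner_zero_right]
  have hfr0 : ∫ v, f (Sum.inr v) ∂Q = 0 := by
    simp_rw [hf, real_inner_comm t]
    rw [integral_inner (h2r.integrable (by norm_num)), hr, inner_zero_right]
  have hq : (1 - p : ℝ) ∈ Set.Ioo (0 : ℝ) 1 := ⟨by linarith [H.hp.2], by linarith [H.hp.1]⟩
  have L1 := tendsto_charFun_scaled_sum H.law_fst H.indep_fst (hfm.comp measurable_inl) hfl hfl0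
    H.hn (Real.continuous_sqrt.continuousAt.tendsto.comp H.frac)
  have L2 := tendsto_charFun_scaled_sum H.law_snd H.indep_snd (hfm.comp measurable_inr) hfr hfr0
    H.hN (Real.continuous_sqrt.continuousAt.tendsto.comp H.frac')
  have L := L1.mul L2
  rw [← Complex.exp_add] at L
  -- The stratum means vanish separately, so the two variances add up to the mixture second moment.
  -- A nonzero stratum mean would enter that moment but not the variance of a sum with fixed label
  -- counts.
  have htarget : charFun ((multivariateGaussian 0 (secondMoment (mixLaw p P Q) h)).map id) t =
      Complex.exp (-(((√p ^ 2 * ∫ w, f (Sum.inl w) ^ 2 ∂P : ℝ) : ℂ) / 2)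
        + -(((√(1 - p) ^ 2 * ∫ v, f (Sum.inr v) ^ 2 ∂Q : ℝ) : ℂ) / 2)) := by
    rw [Measure.map_id, charFun_multivariateGaussian (posSemidef_secondMoment h2),
      inner_secondMoment h2, integral_mixLaw H.hp (h2.inner_const t).integrable_sq,
      Real.sq_sqrt H.hp.1.le, Real.sq_sqrt hq.1.le]
    congr 1
    simp only [inner_zero_right, hf, smul_eq_mul]
    push_cast
    ring
  change Tendsto (fun k => charFun (μ.map fun ω => √((n k : ℝ) + N k) •
    pooledMean h (n k) (N k) (fun i => x i ω) (fun i => y i ω)) t) atTop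
    (𝓝 (charFun ((multivariateGaussian 0 (secondMoment (mixLaw p P Q) h)).map id) t))
  rw [htarget]
  refine L.congr' ?_
  filter_upwards [H.hn.eventually_gt_atTop 0, H.hN.eventually_gt_atTop 0] with k hk hk'
  have hml : AEMeasurable (fun ω => (√((n k : ℝ) / (n k + N k))) *
      ((√(n k : ℝ))⁻¹ * ∑ i ∈ Finset.range (n k), f (Sum.inl (x i ω)))) μ := by
    refine ((Finset.aemeasurable_fun_sum _ fun i _ => ?_).const_mul _).const_mul _
    exact (hfm.comp measurable_inl).comp_aemeasurable (H.law_fst i).aemeasurable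
  have hmr : AEMeasurable (fun ω => (√((N k : ℝ) / (n k + N k))) *
      ((√(N k : ℝ))⁻¹ * ∑ i ∈ Finset.range (N k), f (Sum.inr (y i ω)))) μ := by
    refine ((Finset.aemeasurable_fun_sum _ fun i _ => ?_).const_mul _).const_mul _
    exact (hfm.comp measurable_inr).comp_aemeasurable (H.law_snd i).aemeasurable
  have hind : IndepFun (fun ω => (√((n k : ℝ) / (n k + N k))) *
      ((√(n k : ℝ))⁻¹ * ∑ i ∈ Finset.range (n k), f (Sum.inl (x i ω))))
      (fun ω => (√((N k : ℝ) / (n k + N k))) *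
      ((√(N k : ℝ))⁻¹ * ∑ i ∈ Finset.range (N k), f (Sum.inr (y i ω)))) μ := by
    refine H.indep.comp (φ := fun a : ℕ → S => (√((n k : ℝ) / (n k + N k))) *
      ((√(n k : ℝ))⁻¹ * ∑ i ∈ Finset.range (n k), f (Sum.inl (a i))))
      (ψ := fun a : ℕ → T => (√((N k : ℝ) / (n k + N k))) *
      ((√(N k : ℝ))⁻¹ * ∑ i ∈ Finset.range (N k), f (Sum.inr (a i)))) ?_ ?_
    · refine ((Finset.measurable_fun_sum _ fun i _ => ?_).const_mul _).const_mul _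
      exact (hfm.comp measurable_inl).comp (measurable_pi_apply i)
    · refine ((Finset.measurable_fun_sum _ fun i _ => ?_).const_mul _).const_mul _
      exact (hfm.comp measurable_inr).comp (measurable_pi_apply i)
  have hprod := congrFun (hind.charFun_map_fun_add_eq_mul hml hmr) 1
  rw [Pi.mul_apply] at hprod
  refine hprod.symm.trans ?_
  have hkey : ∀ ω, (√((n k : ℝ) / (n k + N k))) *
      ((√(n k : ℝ))⁻¹ * ∑ i ∈ Finset.range (n k), f (Sum.inl (x i ω)))
      + (√((N k : ℝ) / (n k + N k))) *
      ((√(N k : ℝ))⁻¹ * ∑ i ∈ Finset.range (N k), f (Sum.inr (y i ω)))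
      = ⟪√((n k : ℝ) + N k) •
        pooledMean h (n k) (N k) (fun i => x i ω) (fun i => y i ω), t⟫ := by
    intro ω
    have hs : (0 : ℝ) < n k + N k := by positivity
    have hn0 : (0 : ℝ) < n k := by positivity
    have hN0 : (0 : ℝ) < N k := by positivity
    have e0 : √((n k : ℝ) + N k) * (1 / ((n k : ℝ) + N k)) = (√((n k : ℝ) + N k))⁻¹ := by
      have := (Real.sqrt_pos.2 hs).ne'
      field_simp
      rw [Real.sq_sqrt hs.le]
    have e1 : √((n k : ℝ) / (n k + N k)) * (√(n k : ℝ))⁻¹ = (√((n k : ℝ) + N k))⁻¹ := by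
      rw [Real.sqrt_div hn0.le]
      have := (Real.sqrt_pos.2 hn0).ne'
      field_simp
    have e2 : √((N k : ℝ) / (n k + N k)) * (√(N k : ℝ))⁻¹ = (√((n k : ℝ) + N k))⁻¹ := by
      rw [Real.sqrt_div hN0.le]
      have := (Real.sqrt_pos.2 hN0).ne'
      field_simp
    rw [← mul_assoc, ← mul_assoc, e1, e2, pooledMean, smul_smul, e0, real_inner_smul_left,
      inner_add_left, sum_inner, sum_inner, mul_add]
  simp_rw [hkey]
  rw [charFun_apply, charFun_apply, integral_map ((hZ k).inner_const) (by fun_prop),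
    integral_map (hZ k) (by fun_prop)]
  simp

end Pooled


/-! ### Algebra and norm bounds for pooled means -/

section PooledAlgebra

variable {S T E F : Type*} [NormedAddCommGroup E] [NormedSpace ℝ E] [NormedAddCommGroup F]
  [NormedSpace ℝ F]

lemma pooledMean_sub (h h' : S ⊕ T → E) (n N : ℕ) (x : ℕ → S) (y : ℕ → T) :
    pooledMean (fun o => h o - h' o) n N x y = pooledMean h n N x y - pooledMean h' n N x y := by
  simp only [pooledMean, Finset.sum_sub_distrib, ← smul_sub]
  congr 1
  abel

lemma pooledMean_clm_apply (L : S ⊕ T → E →L[ℝ] F) (v : E) (n N : ℕ) (x : ℕ → S) (y : ℕ → T) :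
    pooledMean (fun o => L o v) n N x y = pooledMean L n N x y v := by
  simp [pooledMean]

lemma pooledMean_mul_const (W : S ⊕ T → ℝ) (c : ℝ) (n N : ℕ) (x : ℕ → S) (y : ℕ → T) :
    pooledMean (fun o => W o * c) n N x y = pooledMean W n N x y * c := by
  simp only [pooledMean, ← Finset.sum_mul, ← add_mul, smul_eq_mul, mul_assoc]

lemma norm_pooledMean_le {h : S ⊕ T → E} {W : S ⊕ T → ℝ} (n N : ℕ) {x : ℕ → S} {y : ℕ → T}
    (hx : ∀ i, ‖h (Sum.inl (x i))‖ ≤ W (Sum.inl (x i)))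
    (hy : ∀ i, ‖h (Sum.inr (y i))‖ ≤ W (Sum.inr (y i))) :
    ‖pooledMean h n N x y‖ ≤ pooledMean W n N x y := by
  have h0 : (0 : ℝ) ≤ 1 / ((n : ℝ) + N) := by positivity
  rw [pooledMean, pooledMean, norm_smul, Real.norm_of_nonneg h0, smul_eq_mul]
  refine mul_le_mul_of_nonneg_left ((norm_add_le _ _).trans (add_le_add ?_ ?_)) h0
  · exact (norm_sum_le _ _).trans (Finset.sum_le_sum fun i _ => hx i)
  · exact (norm_sum_le _ _).trans (Finset.sum_le_sum fun i _ => hy i)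

end PooledAlgebra

/-! ### Consistency and asymptotic linearity of Z-estimators -/

section ZEstimator

variable {S T Ω : Type*} [MeasurableSpace S] [MeasurableSpace T] [MeasurableSpace Ω]
  {μ : Measure Ω} [IsProbabilityMeasure μ] {p : ℝ} {P : Measure S} {Q : Measure T} {n N : ℕ → ℕ}
  {x : ℕ → Ω → S} {y : ℕ → Ω → T} {q : ℕ} {Θ : Set (Vec q)} {θ₀ : Vec q}
  {Φ : Vec q → S ⊕ T → Vec q} {θhat : ℕ → Ω → Vec q}

/-- `f θ` varies little with `θ ∈ Θ` near each point, in the mean. -/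
def HasLocalModulus {O F : Type*} [MeasurableSpace O] [NormedAddCommGroup F] (ν : Measure O)
    (Θ : Set (Vec q)) (f : Vec q → O → F) : Prop :=
  ∀ θ ∈ Θ, ∀ ε > 0, ∃ δ > 0, ∃ W : O → ℝ, Measurable W ∧ Integrable W ν ∧ ∫ o, W o ∂ν < ε ∧
    ∀ᵐ o ∂ν, ∀ θ' ∈ Θ, dist θ' θ < δ → ‖f θ' o - f θ o‖ ≤ W o

/-- `f θ` is approximated by its linearization `L` near `θ₀`, in the mean. -/
def HasLinearization {O : Type*} [MeasurableSpace O] (ν : Measure O)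
    (f : Vec q → O → Vec q) (L : O → Vec q →L[ℝ] Vec q) (θ₀ : Vec q) : Prop :=
  ∀ ε > 0, ∃ δ > 0, ∃ W : O → ℝ, Measurable W ∧ Integrable W ν ∧ ∫ o, W o ∂ν < ε ∧
    ∀ᵐ o ∂ν, ∀ θ ∈ Metric.ball θ₀ δ, ∀ θ' ∈ Metric.ball θ₀ δ,
      ‖f θ o - f θ' o - L o (θ - θ')‖ ≤ W o * ‖θ - θ'‖

/-- Wald's argument. At each θ outside a ball around θ₀ the mean has norm c > 0. With high
probability the pooled mean there exceeds c/2 in norm, while its variation over a small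
neighbourhood stays below c/2, so that neighbourhood contains no root. Compactness leaves finitely
many neighbourhoods. -/
lemma TwoSample.consistency (H : TwoSample μ p P Q n N x y) (hΘ : IsCompact Θ)
    (hm : ∀ θ ∈ Θ, Measurable (Φ θ)) (hi : ∀ θ ∈ Θ, Integrable (Φ θ) (mixLaw p P Q))
    (hz : ∀ θ ∈ Θ, ∫ o, Φ θ o ∂(mixLaw p P Q) = 0 → θ = θ₀)
    (hloc : HasLocalModulus (mixLaw p P Q) Θ Φ)
    (hsol : WithHighProb μ (fun k ω => θhat k ω ∈ Θ ∧
      pooledMean (Φ (θhat k ω)) (n k) (N k) (fun i => x i ω) (fun i => y i ω) = 0))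
    {ε : ℝ} (hε : 0 < ε) : WithHighProb μ (fun k ω => dist (θhat k ω) θ₀ < ε) := by
  have hK : IsCompact (Θ \ Metric.ball θ₀ ε) := hΘ.diff Metric.isOpen_ball
  have key : WithHighProb μ (fun k ω => ∀ θ ∈ Θ \ Metric.ball θ₀ ε,
      pooledMean (Φ θ) (n k) (N k) (fun i => x i ω) (fun i => y i ω) ≠ 0) := by
    refine hK.induction_on (p := fun s => WithHighProb μ (fun k ω => ∀ θ ∈ s,
      pooledMean (Φ θ) (n k) (N k) (fun i => x i ω) (fun i => y i ω) ≠ 0)) ?_ ?_ ?_ ?_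
    · exact withHighProb_true.mono fun k ω _ θ hθ => absurd hθ (Set.notMem_empty _)
    · exact fun s t hst ht => ht.mono fun k ω h θ hθ => h θ (hst hθ)
    · exact fun s t hs ht => (hs.and ht).mono fun k ω h θ hθ => hθ.elim (h.1 θ) (h.2 θ)
    · rintro θ ⟨hθ, hθb⟩
      set c := ‖∫ o, Φ θ o ∂(mixLaw p P Q)‖ with hc
      have hc0 : 0 < c := by
        rw [hc, norm_pos_iff]
        intro h0
        rw [hz θ hθ h0] at hθb
        exact hθb (Metric.mem_ball_self hε)
      obtain ⟨δ, hδ, W, hWm, hWi, hW, hae⟩ := hloc θ hθ (c / 2) (by positivity)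
      refine ⟨Metric.ball θ δ ∩ (Θ \ Metric.ball θ₀ ε),
        inter_mem (mem_nhdsWithin_of_mem_nhds (Metric.ball_mem_nhds θ hδ)) self_mem_nhdsWithin,
        ?_⟩
      have e1 := H.withHighProb_pooledMean (hm θ hθ) (hi θ hθ) (U := {v | c / 2 < ‖v‖})
        ((isOpen_lt continuous_const continuous_norm).mem_nhds (by
          simp only [Set.mem_ofPred_eq]; linarith))
      have e2 := H.withHighProb_pooledMean hWm hWi (U := Set.Iio (c / 2)) (Iio_mem_nhds hW)
      refine (e1.and e2).mono_ae ?_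
      filter_upwards [H.ae_of_ae hae] with ω hω k hk θ' hθ' h0
      have := norm_pooledMean_le (h := fun o => Φ θ' o - Φ θ o) (n k) (N k)
        (fun i => hω.1 i θ' hθ'.2.1 hθ'.1) (fun i => hω.2 i θ' hθ'.2.1 hθ'.1)
      rw [pooledMean_sub, h0, zero_sub, norm_neg] at this
      have h1 : c / 2 < _ := hk.1
      have h2 := hk.2
      simp only [Set.mem_Iio] at h2
      linarith
  refine (hsol.and key).mono fun k ω h => ?_
  by_contra hd
  exact h.2 _ ⟨h.1.1, hd⟩ h.1.2

/-- The empirical function vanishes at the estimator. Replacing its increment from θ₀ by the pooled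
derivative costs at most ε/2 times the distance, and replacing the pooled derivative by its limit,
the identity, costs as much again. -/
lemma TwoSample.linear_expansion (H : TwoSample μ p P Q n N x y)
    {L : S ⊕ T → Vec q →L[ℝ] Vec q} (hLm : Measurable L) (hLi : Integrable L (mixLaw p P Q))
    (hL : ∫ o, L o ∂(mixLaw p P Q) = ContinuousLinearMap.id ℝ (Vec q))
    (hlin : HasLinearization (mixLaw p P Q) Φ L θ₀)
    (hsol : WithHighProb μ (fun k ω =>
      pooledMean (Φ (θhat k ω)) (n k) (N k) (fun i => x i ω) (fun i => y i ω) = 0))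
    (hcons : ∀ ε > 0, WithHighProb μ (fun k ω => dist (θhat k ω) θ₀ < ε))
    {ε : ℝ} (hε : 0 < ε) : WithHighProb μ (fun k ω =>
      ‖(θhat k ω - θ₀) + pooledMean (Φ θ₀) (n k) (N k) (fun i => x i ω) (fun i => y i ω)‖
        ≤ ε * ‖θhat k ω - θ₀‖) := by
  obtain ⟨δ, hδ, W, hWm, hWi, hW, hae⟩ := hlin (ε / 2) (by positivity)
  have e1 := H.withHighProb_pooledMean hWm hWi (U := Set.Iio (ε / 2)) (Iio_mem_nhds hW)
  have e2 := H.withHighProb_pooledMean hLm hLi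
    (U := Metric.ball (ContinuousLinearMap.id ℝ (Vec q)) (ε / 2))
    (by rw [hL]; exact Metric.ball_mem_nhds _ (by positivity))
  refine (((e1.and e2).and hsol).and (hcons δ hδ)).mono_ae ?_
  filter_upwards [H.ae_of_ae hae] with ω hω k hk
  obtain ⟨⟨⟨h1, h2⟩, h3⟩, h4⟩ := hk
  have h5 : θ₀ ∈ Metric.ball θ₀ δ := Metric.mem_ball_self hδ
  have h6 := norm_pooledMean_le (h := fun o => Φ (θhat k ω) o - Φ θ₀ o - L o (θhat k ω - θ₀))
    (W := fun o => W o * ‖θhat k ω - θ₀‖) (n k) (N k)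
    (fun i => hω.1 i _ h4 _ h5) (fun i => hω.2 i _ h4 _ h5)
  rw [pooledMean_sub, pooledMean_sub, h3, pooledMean_clm_apply, pooledMean_mul_const] at h6
  set M₀ := pooledMean (Φ θ₀) (n k) (N k) (fun i => x i ω) (fun i => y i ω)
  set A := pooledMean L (n k) (N k) (fun i => x i ω) (fun i => y i ω)
  set Δ := θhat k ω - θ₀
  have h7 : ‖(A - ContinuousLinearMap.id ℝ (Vec q)) Δ‖ ≤ ε / 2 * ‖Δ‖ := by
    refine (ContinuousLinearMap.le_opNorm _ _).trans ?_
    gcongr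
    rw [Metric.mem_ball, dist_eq_norm] at h2
    exact h2.le
  have h8 : Δ + M₀ = -((0 - M₀ - A Δ) + (A - ContinuousLinearMap.id ℝ (Vec q)) Δ) := by
    simp only [sub_apply, ContinuousLinearMap.id_apply]
    abel
  rw [h8, norm_neg]
  refine (norm_add_le _ _).trans ?_
  have h9 : pooledMean W (n k) (N k) (fun i => x i ω) (fun i => y i ω) * ‖Δ‖ ≤ ε / 2 * ‖Δ‖ := by
    gcongr
    exact (Set.mem_Iio.1 h1).le
  linarith

/-- Convergence of characteristic functions to a continuous limit forces tightness, which bounds the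
sequence in probability uniformly in k. -/
lemma withHighProb_norm_le_of_tendstoInDistribution {Z : ℕ → Ω → Vec q} {γ : Measure (Vec q)}
    [IsProbabilityMeasure γ]
    (hZ : TendstoInDistribution Z atTop id (fun _ => μ) γ) {η : ENNReal} (hη : 0 < η) :
    ∃ K > (0 : ℝ), ∀ k, μ {ω | K < ‖Z k ω‖} ≤ η := by
  have ht : IsTightMeasureSet (Set.range fun k => μ.map (Z k)) := by
    have : ∀ k, IsProbabilityMeasure (μ.map (Z k)) := fun k =>
      Measure.isProbabilityMeasure_map (hZ.forall_aemeasurable k)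
    have : IsProbabilityMeasure (γ.map id) := Measure.isProbabilityMeasure_map aemeasurable_id
    refine isTightMeasureSet_of_tendsto_charFun (f := charFun (γ.map id)) (by fun_prop) fun t => ?_
    exact ProbabilityMeasure.tendsto_iff_tendsto_charFun.1 hZ.tendsto t
  have h := tendsto_measure_norm_gt_of_isTightMeasureSet ht
  obtain ⟨K, hK, hK0⟩ := ((h.eventually_le_const hη).and (eventually_gt_atTop 0)).exists
  refine ⟨K, hK0, fun k => ?_⟩
  refine le_trans ?_ hK
  refine le_trans (le_of_eq ?_) (le_iSup₂ (f := fun (ν : Measure (Vec q)) (_ : ν ∈ Set.range _) =>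
    ν {x | K < ‖x‖}) (μ.map (Z k)) ⟨k, rfl⟩)
  rw [Measure.map_apply_of_aemeasurable (hZ.forall_aemeasurable k)
    (measurableSet_lt measurable_const measurable_norm)]
  rfl

/-- The remainder is small relative to the estimation error Δ, not yet relative to the sample size.
Absorbing it gives ‖Δ‖ ≤ 2‖M₀‖ for the pooled mean M₀, whose rescaling is tight; so the rescaled
remainder vanishes in probability and Slutsky's theorem concludes. -/
theorem asymptotic_linearity {γ : Measure (Vec q)}
    [IsProbabilityMeasure γ]
    (hexp : ∀ ε > 0, WithHighProb μ (fun k ω =>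
      ‖(θhat k ω - θ₀) + pooledMean (Φ θ₀) (n k) (N k) (fun i => x i ω) (fun i => y i ω)‖
        ≤ ε * ‖θhat k ω - θ₀‖))
    (hclt : TendstoInDistribution (fun k ω => √((n k : ℝ) + N k) •
        pooledMean (fun o => -Φ θ₀ o) (n k) (N k) (fun i => x i ω) (fun i => y i ω)) atTop id
        (fun _ => μ) γ)
    (hmeas : ∀ k, AEMeasurable (θhat k) μ) :
    TendstoInDistribution (fun k ω => √((n k : ℝ) + N k) • (θhat k ω - θ₀)) atTop id (fun _ => μ)
      γ := by
  refine tendstoInDistribution_of_tendstoInMeasure_sub _ _ hclt ?_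
    fun k => AEMeasurable.fun_const_smul ((hmeas k).sub_const _) _
  rw [tendstoInMeasure_iff_norm]
  intro a ha
  have hneg : ∀ k ω, pooledMean (fun o => -Φ θ₀ o) (n k) (N k) (fun i => x i ω) (fun i => y i ω)
      = -pooledMean (Φ θ₀) (n k) (N k) (fun i => x i ω) (fun i => y i ω) := fun k ω => by
    simp [pooledMean, Finset.sum_neg_distrib, ← neg_add_rev, add_comm]
  rw [ENNReal.tendsto_nhds_zero]
  intro η hη
  obtain ⟨K, hK, hKη⟩ := withHighProb_norm_le_of_tendstoInDistribution hclt
    (ENNReal.half_pos hη.ne')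
  -- The bound 1/2 permits the absorption; the bound a/(4K) makes the rescaled remainder, at most
  -- 2εK, no larger than a/2.
  set ε : ℝ := min (1 / 2) (a / (4 * K)) with hεdef
  have hε : 0 < ε := by positivity
  have h1 := hexp ε hε
  have h2 := (ENNReal.tendsto_nhds_zero.1 h1) (η / 2) (ENNReal.half_pos hη.ne')
  filter_upwards [h2] with k hk
  calc _ ≤ μ ({ω | ¬ (‖(θhat k ω - θ₀) + pooledMean (Φ θ₀) (n k) (N k) (fun i => x i ω)
          (fun i => y i ω)‖ ≤ ε * ‖θhat k ω - θ₀‖)} ∪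
          {ω | K < ‖√((n k : ℝ) + N k) • pooledMean (fun o => -Φ θ₀ o) (n k) (N k)
            (fun i => x i ω) (fun i => y i ω)‖}) := by
        refine measure_mono fun ω hω => ?_
        by_contra hcon
        simp only [Set.mem_union, Set.mem_ofPred_eq, not_or, not_not, not_lt, Pi.sub_apply,
          Pi.zero_apply, sub_zero] at hcon hω
        obtain ⟨hc1, hc2⟩ := hcon
        rw [hneg] at hω hc2
        set M₀ := pooledMean (Φ θ₀) (n k) (N k) (fun i => x i ω) (fun i => y i ω)
        set Δ := θhat k ω - θ₀
        rw [← smul_sub, sub_neg_eq_add, norm_smul] at hω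
        rw [norm_smul, norm_neg] at hc2
        have hε2 : ε ≤ 1 / 2 := min_le_left _ _
        have hεK : ε * (4 * K) ≤ a := by
          have : ε ≤ a / (4 * K) := min_le_right _ _
          rwa [le_div_iff₀ (by positivity)] at this
        have h3 : ‖Δ‖ ≤ ‖Δ + M₀‖ + ‖M₀‖ := by
          simpa using norm_sub_le (Δ + M₀) M₀
        have h4 : ‖Δ‖ ≤ 2 * ‖M₀‖ := by nlinarith [norm_nonneg Δ]
        have h5 : ‖Δ + M₀‖ ≤ ε * (2 * ‖M₀‖) := hc1.trans (by gcongr)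
        have h6 : ‖√((n k : ℝ) + N k)‖ * ‖Δ + M₀‖ ≤ 2 * ε * K := by
          calc _ ≤ ‖√((n k : ℝ) + N k)‖ * (ε * (2 * ‖M₀‖)) := by gcongr
            _ = 2 * ε * (‖√((n k : ℝ) + N k)‖ * ‖M₀‖) := by ring
            _ ≤ _ := by gcongr
        have : 0 < ε * K := by positivity
        linarith
    _ ≤ η / 2 + η / 2 := (measure_union_le _ _).trans (add_le_add hk (hKη k))
    _ = η := ENNReal.add_halves η

end ZEstimator


/-! ### Measurable envelopes of continuous families -/

section Suprema

variable {X O : Type*} [TopologicalSpace X] [TopologicalSpace.PseudoMetrizableSpace X]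
  [SecondCountableTopology X] [MeasurableSpace O] {ν : Measure O}

/-- A family of measurable functions, almost surely continuous in the index, has a measurable
least upper bound. -/
lemma exists_measurable_sup {A : Set X} {g : X → O → ℝ} (hm : ∀ x ∈ A, Measurable (g x))
    (hc : ∀ᵐ o ∂ν, ContinuousOn (fun x => g x o) A) :
    ∃ W : O → ENNReal, Measurable W ∧ (∀ᵐ o ∂ν, ∀ x ∈ A, ENNReal.ofReal (g x o) ≤ W o) ∧
      ∀ o b, (∀ x ∈ A, ENNReal.ofReal (g x o) ≤ b) → W o ≤ b := by
  -- A supremum over a countable dense subset is measurable, and by continuity it bounds the family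
  -- on all of `A` almost surely.
  obtain ⟨D, hDA, hD, hAD⟩ :=
    (TopologicalSpace.IsSeparable.of_separableSpace A).exists_countable_dense_subset
  refine ⟨fun o => ⨆ x ∈ D, ENNReal.ofReal (g x o),
    .biSup D hD fun x hx => (hm x (hDA hx)).ennreal_ofReal, ?_,
    fun o b h => iSup₂_le fun x hx => h x (hDA hx)⟩
  filter_upwards [hc] with o ho x hx
  have hcx : ContinuousWithinAt (fun x => ENNReal.ofReal (g x o)) D x :=
    (ENNReal.continuous_ofReal.continuousAt.comp_continuousWithinAt (ho x hx)).mono hDA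
  have := mem_closure_iff_nhdsWithin_neBot.1 (hAD hx)
  refine le_of_tendsto hcx ?_
  filter_upwards [self_mem_nhdsWithin] with z hz
  exact le_iSup₂ (f := fun x (_ : x ∈ D) => ENNReal.ofReal (g x o)) z hz

/-- If the index set shrinks so that the family becomes small pointwise, then the measurable
envelope becomes small in the mean. -/
lemma exists_integrable_modulus {A : ℕ → Set X} (hA : ∀ n, A n ⊆ A 0) {g : X → O → ℝ}
    (hm : ∀ x ∈ A 0, Measurable (g x)) (hc : ∀ᵐ o ∂ν, ContinuousOn (fun x => g x o) (A 0))
    {G : O → ENNReal} (hG : ∫⁻ o, G o ∂ν ≠ ⊤)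
    (hgG : ∀ᵐ o ∂ν, ∀ x ∈ A 0, ENNReal.ofReal (g x o) ≤ G o)
    (hlim : ∀ᵐ o ∂ν, ∀ ε > 0, ∀ᶠ n in atTop, ∀ x ∈ A n, g x o ≤ ε) {ε : ℝ} (hε : 0 < ε) :
    ∃ n, ∃ W : O → ℝ, Measurable W ∧ Integrable W ν ∧ ∫ o, W o ∂ν < ε ∧ (∀ o, 0 ≤ W o) ∧
      ∀ᵐ o ∂ν, ∀ x ∈ A n, g x o ≤ W o := by
  choose W hWm hW hWle using fun n => exists_measurable_sup (ν := ν) (A := A n) (g := g)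
    (fun x hx => hm x (hA n hx)) (hc.mono fun o ho => ho.mono (hA n))
  have hWG : ∀ n, ∀ᵐ o ∂ν, W n o ≤ G o := fun n => by
    filter_upwards [hgG] with o ho
    exact hWle n o _ fun x hx => ho x (hA n hx)
  have hT : Tendsto (fun n => ∫⁻ o, W n o ∂ν) atTop (𝓝 0) := by
    have := tendsto_lintegral_of_dominated_convergence (μ := ν) (F := W) (f := fun _ => 0) G hWm
      hWG hG ?_
    · simpa using this
    · filter_upwards [hlim] with o ho
      rw [ENNReal.tendsto_nhds_zero]
      intro η hη
      obtain ⟨ε', hε', hε'η⟩ : ∃ ε' : ℝ, 0 < ε' ∧ ENNReal.ofReal ε' ≤ η := by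
        rcases eq_or_ne η ⊤ with rfl | h
        · exact ⟨1, one_pos, le_top⟩
        · exact ⟨η.toReal, ENNReal.toReal_pos hη.ne' h, (ENNReal.ofReal_toReal h).le⟩
      filter_upwards [ho ε' hε'] with n hn
      exact (hWle n o _ fun x hx => ENNReal.ofReal_le_ofReal (hn x hx)).trans hε'η
  obtain ⟨n, hn⟩ := (hT.eventually_lt_const (ENNReal.ofReal_pos.2 hε)).exists
  have hfin : ∀ᵐ o ∂ν, W n o < ⊤ := ae_lt_top (hWm n) (hn.trans ENNReal.ofReal_lt_top).ne
  refine ⟨n, fun o => (W n o).toReal, (hWm n).ennreal_toReal,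
    integrable_toReal_of_lintegral_ne_top (hWm n).aemeasurable
      (hn.trans ENNReal.ofReal_lt_top).ne, ?_, fun o => ENNReal.toReal_nonneg, ?_⟩
  · rw [integral_toReal (hWm n).aemeasurable hfin]
    exact (ENNReal.lt_ofReal_iff_toReal_lt (hn.trans ENNReal.ofReal_lt_top).ne).1 hn
  · filter_upwards [hW n, hfin] with o ho hf x hx
    exact (ENNReal.ofReal_le_iff_le_toReal hf.ne).1 (ho x hx)

end Suprema

/-! ### Local moduli and linearizations in the mean -/

section Modulus

variable {O : Type*} [MeasurableSpace O] {ν : Measure O} {q : ℕ} {Θ : Set (Vec q)}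
  {f : Vec q → O → Vec q}

/-- An integrable envelope and continuity give a local modulus of continuity in the mean. -/
lemma hasLocalModulus_of_envelope (hm : ∀ θ ∈ Θ, Measurable (f θ))
    (hc : ∀ᵐ o ∂ν, ContinuousOn (fun θ => f θ o) Θ) {F : O → ℝ} (hF : Integrable F ν)
    (hfF : ∀ᵐ o ∂ν, ∀ θ ∈ Θ, ‖f θ o‖ ≤ F o) : HasLocalModulus ν Θ f := by
  intro θ hθ ε hε
  have key : ∃ n : ℕ, ∃ W : O → ℝ, Measurable W ∧ Integrable W ν ∧ ∫ o, W o ∂ν < ε ∧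
      (∀ o, 0 ≤ W o) ∧
      ∀ᵐ o ∂ν, ∀ θ' ∈ Θ ∩ Metric.ball θ (1 / ((n : ℝ) + 1)), ‖f θ' o - f θ o‖ ≤ W o := by
    refine exists_integrable_modulus (A := fun n : ℕ => Θ ∩ Metric.ball θ (1 / ((n : ℝ) + 1)))
      (g := fun θ' o => ‖f θ' o - f θ o‖) (G := fun o => ‖2 * F o‖ₑ) ?_ ?_ ?_ ?_ ?_ ?_ hε
    · intro n
      refine Set.inter_subset_inter_right _ (Metric.ball_subset_ball ?_)
      exact Nat.one_div_le_one_div (Nat.zero_le n)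
    · exact fun θ' hθ' => ((hm θ' hθ'.1).sub (hm θ hθ)).norm
    · filter_upwards [hc] with o ho
      exact ((ho.sub continuousOn_const).norm).mono Set.inter_subset_left
    · exact (hF.const_mul 2).2.ne
    · filter_upwards [hfF] with o ho θ' hθ'
      rw [← ofReal_norm]
      refine ENNReal.ofReal_le_ofReal ((norm_sub_le _ _).trans ?_)
      have := ho θ' hθ'.1
      have := ho θ hθ
      exact le_trans (by linarith) (le_abs_self (2 * F o))
    · filter_upwards [hc] with o ho ε' hε'
      obtain ⟨δ, hδ, h⟩ := Metric.continuousWithinAt_iff.1 (ho θ hθ) ε' hε'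
      filter_upwards [tendsto_one_div_add_atTop_nhds_zero_nat.eventually_lt_const hδ] with n hn θ' hθ'
      have := h hθ'.1 ((Metric.mem_ball.1 hθ'.2).trans hn)
      rw [dist_eq_norm] at this
      exact this.le
  obtain ⟨n, W, hWm, hWi, hW, -, hae⟩ := key
  refine ⟨1 / ((n : ℝ) + 1), Nat.one_div_pos_of_nat, W, hWm, hWi, hW, ?_⟩
  filter_upwards [hae] with o ho θ' hθ' hd using ho θ' ⟨hθ', hd⟩

/-- The matrix of `L` has as columns the limits of difference quotients; hence the derivative is
measurable. -/
lemma aemeasurable_fderiv {B : Set (Vec q)} (hB : IsOpen B) {θ₀ : Vec q} (hθ₀ : θ₀ ∈ B)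
    (hm : ∀ θ ∈ B, Measurable (f θ)) (hd : ∀ᵐ o ∂ν, DifferentiableAt ℝ (fun θ => f θ o) θ₀) :
    AEMeasurable (fun o => fderiv ℝ (fun θ => f θ o) θ₀) ν := by
  have hcol : ∀ v : Vec q, AEMeasurable (fun o => fderiv ℝ (fun θ => f θ o) θ₀ v) ν := by
    intro v
    have hev : ∀ᶠ n : ℕ in atTop, θ₀ + ((n : ℝ) + 1)⁻¹ • v ∈ B := by
      have : Tendsto (fun n : ℕ => θ₀ + ((n : ℝ) + 1)⁻¹ • v) atTop (𝓝 (θ₀ + (0 : ℝ) • v)) := by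
        refine tendsto_const_nhds.add (Tendsto.smul_const ?_ v)
        simpa using tendsto_one_div_add_atTop_nhds_zero_nat (𝕜 := ℝ)
      simp only [zero_smul, add_zero] at this
      exact this.eventually (hB.mem_nhds hθ₀)
    obtain ⟨m, hmB⟩ := eventually_atTop.1 hev
    -- The shift by `m` keeps every evaluation point inside `B`, where measurability is known.
    refine aemeasurable_of_tendsto_metrizable_ae' (f := fun (n : ℕ) o =>
      (((n + m : ℕ) : ℝ) + 1) • (f (θ₀ + (((n + m : ℕ) : ℝ) + 1)⁻¹ • v) o - f θ₀ o)) ?_ ?_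
    · exact fun n => (Measurable.fun_const_smul
        ((hm _ (hmB (n + m) (Nat.le_add_left m n))).sub (hm _ hθ₀)) _).aemeasurable
    · filter_upwards [hd] with o ho
      have h1 := (ho.hasFDerivAt.lim_real v).comp
        (tendsto_atTop_add_const_right atTop (1 : ℝ)
          (tendsto_natCast_atTop_atTop.comp (tendsto_add_atTop_nat m)))
      exact h1
  have e : (fun o => fderiv ℝ (fun θ => f θ o) θ₀) = fun o => ∑ j,
      (EuclideanSpace.proj (𝕜 := ℝ) j : Vec q →L[ℝ] ℝ).smulRight
        (fderiv ℝ (fun θ => f θ o) θ₀ (EuclideanSpace.single j 1)) := by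
    ext1 o
    ext1 v
    conv_lhs => rw [← (EuclideanSpace.basisFun (Fin q) ℝ).sum_repr v]
    simp [map_sum]
  rw [e]
  refine Finset.aemeasurable_fun_sum _ fun j _ => ?_
  have : Continuous fun u : Vec q =>
      (EuclideanSpace.proj (𝕜 := ℝ) j : Vec q →L[ℝ] ℝ).smulRight u :=
    (ContinuousLinearMap.smulRightL ℝ (Vec q) (Vec q)
      (EuclideanSpace.proj (𝕜 := ℝ) j : Vec q →L[ℝ] ℝ)).continuous
  exact this.measurable.comp_aemeasurable (hcol _)

/-- A dominated continuous derivative near `θ₀` gives a linearization in the mean. -/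
lemma exists_hasLinearization {B : Set (Vec q)} (hB : IsOpen B) {θ₀ : Vec q} (hθ₀ : θ₀ ∈ B)
    (hm : ∀ θ ∈ B, Measurable (f θ)) (hd : ∀ᵐ o ∂ν, ContDiffOn ℝ 1 (fun θ => f θ o) B)
    (hsup : (∫⁻ o, ⨆ θ ∈ B, ‖fderiv ℝ (fun θ' => f θ' o) θ‖ₑ ∂ν) < ⊤) :
    ∃ L : O → Vec q →L[ℝ] Vec q, Measurable L ∧ Integrable L ν ∧
      (∀ᵐ o ∂ν, fderiv ℝ (fun θ => f θ o) θ₀ = L o) ∧ HasLinearization ν f L θ₀ := by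
  have hdiff : ∀ᵐ o ∂ν, ∀ θ ∈ B, DifferentiableAt ℝ (fun θ => f θ o) θ := by
    filter_upwards [hd] with o ho θ hθ
    exact (ho.differentiableOn one_ne_zero).differentiableAt (hB.mem_nhds hθ)
  have hae := aemeasurable_fderiv hB hθ₀ hm (hdiff.mono fun o ho => ho θ₀ hθ₀)
  obtain ⟨L, hLm, hL⟩ := hae
  have hLi : Integrable L ν := by
    refine ⟨hLm.aestronglyMeasurable, lt_of_le_of_lt (lintegral_mono_ae ?_) hsup⟩
    filter_upwards [hL] with o ho
    rw [← ho]
    exact le_iSup₂ (f := fun θ (_ : θ ∈ B) => ‖fderiv ℝ (fun θ' => f θ' o) θ‖ₑ) θ₀ hθ₀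
  refine ⟨L, hLm, hLi, hL, fun ε hε => ?_⟩
  obtain ⟨r, hr, hrB⟩ := Metric.isOpen_iff.1 hB θ₀ hθ₀
  have hball : ∀ n : ℕ, Metric.ball θ₀ (r / ((n : ℝ) + 1)) ⊆ Metric.ball θ₀ r := fun n =>
    Metric.ball_subset_ball (div_le_self hr.le (by linarith [n.cast_nonneg (α := ℝ)]))
  -- Mean value inequality on a ball, used twice: with a crude `c` for domination and with a small
  -- `c` for pointwise convergence.
  have hmv : ∀ o, (∀ θ ∈ B, DifferentiableAt ℝ (fun θ => f θ o) θ) → ∀ (ρ c : ℝ), ρ ≤ r →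
      (∀ θ ∈ Metric.ball θ₀ ρ, ‖fderiv ℝ (fun θ' => f θ' o) θ - L o‖ ≤ c) →
      ∀ θ ∈ Metric.ball θ₀ ρ, ∀ θ' ∈ Metric.ball θ₀ ρ,
        ‖f θ o - f θ' o - L o (θ - θ')‖ ≤ c * ‖θ - θ'‖ := by
    intro o ho ρ c hρ hc θ hθ θ' hθ'
    exact (convex_ball θ₀ ρ).norm_image_sub_le_of_norm_hasFDerivWithin_le'
      (fun z hz => (ho z (hrB (Metric.ball_subset_ball hρ hz))).hasFDerivAt.hasFDerivWithinAt)
      hc hθ' hθ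
  -- Off the diagonal the normalized error is continuous in the pair, so the envelope lemma applies
  -- with pairs as indices; on the diagonal the claim is trivial. The dominating function is twice
  -- the supremum of the derivative, once for the running point and once for θ₀.
  have key : ∃ n : ℕ, ∃ W : O → ℝ, Measurable W ∧ Integrable W ν ∧ ∫ o, W o ∂ν < ε ∧
      (∀ o, 0 ≤ W o) ∧
      ∀ᵐ o ∂ν, ∀ z ∈ {z : Vec q × Vec q | z.1 ∈ Metric.ball θ₀ (r / ((n : ℝ) + 1)) ∧
        z.2 ∈ Metric.ball θ₀ (r / ((n : ℝ) + 1)) ∧ z.1 ≠ z.2},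
        ‖f z.1 o - f z.2 o - L o (z.1 - z.2)‖ / ‖z.1 - z.2‖ ≤ W o := by
    refine exists_integrable_modulus
      (A := fun n : ℕ => {z : Vec q × Vec q | z.1 ∈ Metric.ball θ₀ (r / ((n : ℝ) + 1)) ∧
        z.2 ∈ Metric.ball θ₀ (r / ((n : ℝ) + 1)) ∧ z.1 ≠ z.2})
      (g := fun z o => ‖f z.1 o - f z.2 o - L o (z.1 - z.2)‖ / ‖z.1 - z.2‖)
      (G := fun o => 2 * ⨆ θ ∈ B, ‖fderiv ℝ (fun θ' => f θ' o) θ‖ₑ) ?_ ?_ ?_ ?_ ?_ ?_ hε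
    · intro n z hz
      simp only [Nat.cast_zero, zero_add, div_one]
      exact ⟨hball n hz.1, hball n hz.2.1, hz.2.2⟩
    · intro z hz
      have h1 := hm _ (hrB (hball 0 hz.1))
      have h2 := hm _ (hrB (hball 0 hz.2.1))
      have h3 : Measurable fun o => L o (z.1 - z.2) :=
        (ContinuousLinearMap.apply ℝ (Vec q) (z.1 - z.2)).continuous.measurable.comp hLm
      exact ((h1.sub h2).sub h3).norm.div_const _
    · filter_upwards [hd] with o ho z hz
      have hc1 : ContinuousOn (fun z : Vec q × Vec q => f z.1 o) {z | z.1 ∈ B} :=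
        ho.continuousOn.comp continuousOn_fst fun z hz => hz
      have hc2 : ContinuousOn (fun z : Vec q × Vec q => f z.2 o) {z | z.2 ∈ B} :=
        ho.continuousOn.comp continuousOn_snd fun z hz => hz
      have hL1 : Continuous fun z : Vec q × Vec q => L o (z.1 - z.2) :=
        (L o).continuous.comp (continuous_fst.sub continuous_snd)
      refine ContinuousWithinAt.div ?_ (by fun_prop) (norm_ne_zero_iff.2 (sub_ne_zero.2 hz.2.2))
      refine ((ContinuousWithinAt.sub ?_ ?_).sub hL1.continuousWithinAt).norm
      · exact (hc1 z (hrB (hball 0 hz.1))).mono fun w hw => hrB (hball 0 hw.1)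
      · exact (hc2 z (hrB (hball 0 hz.2.1))).mono fun w hw => hrB (hball 0 hw.2.1)
    · rw [lintegral_const_mul' _ _ (by simp)]
      exact (ENNReal.mul_lt_top (by simp) hsup).ne
    · filter_upwards [hdiff, hL] with o ho hLo z hz
      set s := ⨆ θ ∈ B, ‖fderiv ℝ (fun θ' => f θ' o) θ‖ₑ with hs
      rcases eq_or_ne s ⊤ with htop | htop
      · simp [htop]
      have hle : ∀ θ ∈ B, ‖fderiv ℝ (fun θ' => f θ' o) θ‖ ≤ s.toReal := by
        intro θ hθ
        rw [← toReal_enorm]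
        exact ENNReal.toReal_mono htop
          (le_iSup₂ (f := fun θ (_ : θ ∈ B) => ‖fderiv ℝ (fun θ' => f θ' o) θ‖ₑ) θ hθ)
      have h2 : (2 : ENNReal) * s = ENNReal.ofReal (2 * s.toReal) := by
        rw [ENNReal.ofReal_mul (by norm_num), ENNReal.ofReal_toReal htop]
        simp
      rw [h2]
      refine ENNReal.ofReal_le_ofReal ?_
      rw [div_le_iff₀ (norm_pos_iff.2 (sub_ne_zero.2 hz.2.2))]
      refine hmv o ho r _ le_rfl (fun θ hθ => ?_) _ (hball 0 hz.1) _ (hball 0 hz.2.1)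
      refine (norm_sub_le _ _).trans ?_
      rw [← hLo]
      have := hle θ (hrB hθ)
      have := hle θ₀ hθ₀
      linarith
    · filter_upwards [hd, hdiff, hL] with o ho hdo hLo ε' hε'
      have hcont : ContinuousAt (fun θ => fderiv ℝ (fun θ' => f θ' o) θ) θ₀ :=
        (ho.continuousOn_fderiv_of_isOpen hB le_rfl).continuousAt (hB.mem_nhds hθ₀)
      obtain ⟨δ, hδ, hδε⟩ := Metric.continuousAt_iff.1 hcont ε' hε'
      have ht : Tendsto (fun n : ℕ => r / ((n : ℝ) + 1)) atTop (𝓝 0) := by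
        simpa [div_eq_mul_inv] using
          (tendsto_one_div_add_atTop_nhds_zero_nat (𝕜 := ℝ)).const_mul r
      filter_upwards [ht.eventually_lt_const hδ] with n hn z hz
      rw [div_le_iff₀ (norm_pos_iff.2 (sub_ne_zero.2 hz.2.2))]
      refine hmv o hdo (r / ((n : ℝ) + 1)) _ ?_ (fun θ hθ => ?_) _ hz.1 _ hz.2.1
      · exact div_le_self hr.le (by linarith [n.cast_nonneg (α := ℝ)])
      · have := hδε ((Metric.mem_ball.1 hθ).trans hn)
        rw [dist_eq_norm, hLo] at this
        exact this.le
  obtain ⟨n, W, hWm, hWi, hW, hW0, hWae⟩ := key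
  refine ⟨r / ((n : ℝ) + 1), by positivity, W, hWm, hWi, hW, ?_⟩
  filter_upwards [hWae] with o ho θ hθ θ' hθ'
  rcases eq_or_ne θ θ' with rfl | hne
  · simp
  · have := ho (θ, θ') ⟨hθ, hθ', hne⟩
    rwa [div_le_iff₀ (norm_pos_iff.2 (sub_ne_zero.2 hne))] at this

/-- Integrated form of the linearization. -/
lemma HasLinearization.integral {L : O → Vec q →L[ℝ] Vec q} {θ₀ : Vec q}
    (h : HasLinearization ν f L θ₀) (hL : Integrable L ν)
    (hi : ∀ᶠ θ in 𝓝 θ₀, Integrable (f θ) ν) {ε : ℝ} (hε : 0 < ε) :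
    ∃ δ > 0, ∀ θ ∈ Metric.ball θ₀ δ, ∀ θ' ∈ Metric.ball θ₀ δ,
      ‖(∫ o, f θ o ∂ν) - (∫ o, f θ' o ∂ν) - (∫ o, L o ∂ν) (θ - θ')‖ ≤ ε * ‖θ - θ'‖ := by
  obtain ⟨δ, hδ, W, hWm, hWi, hW, hae⟩ := h ε hε
  obtain ⟨δ', hδ', hi'⟩ := Metric.eventually_nhds_iff_ball.1 hi
  refine ⟨min δ δ', lt_min hδ hδ', fun θ hθ θ' hθ' => ?_⟩
  have i1 := hi' θ (Metric.ball_subset_ball (min_le_right _ _) hθ)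
  have i2 := hi' θ' (Metric.ball_subset_ball (min_le_right _ _) hθ')
  rw [ContinuousLinearMap.integral_apply hL, ← integral_sub i1 i2,
    ← integral_sub (f := fun o => f θ o - f θ' o) (i1.sub i2) (hL.apply_continuousLinearMap _)]
  calc _ ≤ ∫ o, W o * ‖θ - θ'‖ ∂ν := by
        refine norm_integral_le_of_norm_le (hWi.mul_const _) ?_
        filter_upwards [hae] with o ho
        exact ho θ (Metric.ball_subset_ball (min_le_left _ _) hθ) θ'
          (Metric.ball_subset_ball (min_le_left _ _) hθ')
    _ = (∫ o, W o ∂ν) * ‖θ - θ'‖ := integral_mul_const _ _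
    _ ≤ _ := by gcongr

lemma HasLocalModulus.continuousOn_integral (h : HasLocalModulus ν Θ f)
    (hi : ∀ θ ∈ Θ, Integrable (f θ) ν) : ContinuousOn (fun θ => ∫ o, f θ o ∂ν) Θ := by
  intro θ hθ
  rw [Metric.continuousWithinAt_iff]
  intro ε hε
  obtain ⟨δ, hδ, W, hWm, hWi, hW, hae⟩ := h θ hθ ε hε
  refine ⟨δ, hδ, fun {θ'} hθ' hd => ?_⟩
  rw [dist_eq_norm, ← integral_sub (hi θ' hθ') (hi θ hθ)]
  refine (norm_integral_le_of_norm_le hWi ?_).trans_lt hW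
  filter_upwards [hae] with o ho using ho θ' hθ' hd

end Modulus


/-! ### Conditional means and the augmented weighted lift -/

section CondAvg

variable {V E F : Type*} [MeasurableSpace V] [NormedAddCommGroup E] [NormedSpace ℝ E]
  [NormedAddCommGroup F] [NormedSpace ℝ F] {P : Measure (ℝ × V)} [IsProbabilityMeasure P]

/-- The conditional mean of `f` given the second component. -/
noncomputable def condAvg (P : Measure (ℝ × V)) [IsFiniteMeasure P] (f : ℝ × V → E) (v : V) : E :=
  ∫ y, f (y, v) ∂(condDistrib (fun w : ℝ × V => w.1) (fun w : ℝ × V => w.2) P v)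

lemma measurableEmbedding_swap : MeasurableEmbedding (fun w : ℝ × V => (w.2, w.1)) :=
  MeasurableEquiv.prodComm.measurableEmbedding

lemma compProd_condDistrib : (P.map Prod.snd) ⊗ₘ
    (condDistrib (fun w : ℝ × V => w.1) (fun w : ℝ × V => w.2) P)
      = P.map fun w => (w.2, w.1) :=
  compProd_map_condDistrib measurable_fst.aemeasurable

/-- Null sets disintegrate. The predicate may itself quantify over uncountably many θ, so one
exceptional set of covariates serves them all; this is where a single regular conditional
distribution matters. -/
lemma ae_condDistrib_of_ae {r : ℝ × V → Prop} (h : ∀ᵐ w ∂P, r w) :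
    ∀ᵐ v ∂(P.map Prod.snd),
      ∀ᵐ y ∂(condDistrib (fun w : ℝ × V => w.1) (fun w : ℝ × V => w.2) P v), r (y, v) := by
  refine Measure.ae_ae_of_ae_compProd (p := fun z : V × ℝ => r (z.2, z.1)) ?_
  rw [compProd_condDistrib, measurableEmbedding_swap.ae_map_iff]
  exact h

lemma lintegral_condDistrib {g : ℝ × V → ENNReal} (hg : Measurable g) :
    ∫⁻ v, ∫⁻ y, g (y, v) ∂(condDistrib (fun w : ℝ × V => w.1) (fun w : ℝ × V => w.2) P v)
      ∂(P.map Prod.snd) = ∫⁻ w, g w ∂P := by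
  have h := Measure.lintegral_compProd (μ := P.map Prod.snd)
    (κ := condDistrib (fun w : ℝ × V => w.1) (fun w : ℝ × V => w.2) P)
    (f := fun z : V × ℝ => g (z.2, z.1)) (by fun_prop)
  rw [compProd_condDistrib, measurableEmbedding_swap.lintegral_map] at h
  exact h.symm

lemma integrable_swap {f : ℝ × V → E} (hf : Integrable f P) :
    Integrable (fun z : V × ℝ => f (z.2, z.1)) (P.map fun w => (w.2, w.1)) :=
  measurableEmbedding_swap.integrable_map_iff.2 hf

lemma integrable_condDistrib {f : ℝ × V → E} (hf : Integrable f P) :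
    ∀ᵐ v ∂(P.map Prod.snd), Integrable (fun y => f (y, v))
      (condDistrib (fun w : ℝ × V => w.1) (fun w : ℝ × V => w.2) P v) :=
  (integrable_swap hf).condDistrib_ae_map measurable_fst.aemeasurable

lemma integrable_condAvg {f : ℝ × V → E} (hf : Integrable f P) :
    Integrable (condAvg P f) (P.map Prod.snd) :=
  (integrable_swap hf).integral_condDistrib_map measurable_fst.aemeasurable

lemma integral_condAvg {f : ℝ × V → E} (hf : Integrable f P) :
    ∫ v, condAvg P f v ∂(P.map Prod.snd) = ∫ w, f w ∂P := by
  have h := Measure.integral_compProd (μ := P.map Prod.snd)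
    (κ := condDistrib (fun w : ℝ × V => w.1) (fun w : ℝ × V => w.2) P)
    (f := fun z : V × ℝ => f (z.2, z.1))
    (by rw [compProd_condDistrib]; exact integrable_swap hf)
  rw [compProd_condDistrib, measurableEmbedding_swap.integral_map] at h
  exact h.symm

lemma measurable_condAvg [MeasurableSpace E] [BorelSpace E] [SecondCountableTopology E]
    {f : ℝ × V → E} (hf : Measurable f) : Measurable (condAvg P f) :=
  (StronglyMeasurable.integral_condDistrib (Y := fun w : ℝ × V => w.1) (X := fun w : ℝ × V => w.2)
    (f := fun z : V × ℝ => f (z.2, z.1)) (μ := P)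
    (hf.comp measurable_swap).stronglyMeasurable).measurable

/-- The conditional mean is a contraction of `L²`. -/
lemma lintegral_condAvg_sq_le [MeasurableSpace E] [BorelSpace E] [SecondCountableTopology E]
    {f : ℝ × V → E} (hf : Measurable f) :
    ∫⁻ v, ‖condAvg P f v‖ₑ ^ 2 ∂(P.map Prod.snd) ≤ ∫⁻ w, ‖f w‖ₑ ^ 2 ∂P := by
  rw [← lintegral_condDistrib (P := P) (g := fun w => ‖f w‖ₑ ^ 2) (by fun_prop)]
  refine lintegral_mono fun v => ?_
  set κ := condDistrib (fun w : ℝ × V => w.1) (fun w : ℝ × V => w.2) P v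
  have hfv : Measurable fun y => f (y, v) := hf.comp measurable_prodMk_right
  have h1 : ‖condAvg P f v‖ₑ ≤ eLpNorm (fun y => f (y, v)) 2 κ := by
    refine (enorm_integral_le_lintegral_enorm _).trans ?_
    rw [← eLpNorm_one_eq_lintegral_enorm]
    exact eLpNorm_le_eLpNorm_of_exponent_le (by norm_num) hfv.aestronglyMeasurable
  calc _ ≤ eLpNorm (fun y => f (y, v)) 2 κ ^ 2 := by gcongr
    _ = _ := by
      have := eLpNorm_nnreal_pow_eq_lintegral (f := fun y => f (y, v)) (μ := κ) (p := 2)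
        two_ne_zero
      simpa using this

lemma memLp_two_iff_lintegral {O : Type*} [MeasurableSpace O] {ν : Measure O} {f : O → E}
    (hf : AEStronglyMeasurable f ν) : MemLp f 2 ν ↔ ∫⁻ o, ‖f o‖ₑ ^ 2 ∂ν < ⊤ := by
  have := eLpNorm_nnreal_pow_eq_lintegral (f := f) (μ := ν) (p := 2) two_ne_zero
  simp only [ENNReal.coe_ofNat, NNReal.coe_ofNat, ENNReal.rpow_ofNat] at this
  rw [← this]
  constructor
  · intro h
    exact ENNReal.pow_lt_top h.2
  · intro h
    refine ⟨hf, ?_⟩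
    by_contra hc
    rw [not_lt, top_le_iff] at hc
    simp [hc] at h

lemma memLp_condAvg [MeasurableSpace E] [BorelSpace E] [SecondCountableTopology E]
    {f : ℝ × V → E} (hf : Measurable f) (h2 : MemLp f 2 P) :
    MemLp (condAvg P f) 2 (P.map Prod.snd) := by
  rw [memLp_two_iff_lintegral (measurable_condAvg hf).aestronglyMeasurable]
  exact (lintegral_condAvg_sq_le hf).trans_lt ((memLp_two_iff_lintegral h2.1).1 h2)

/-- The inverse-probability-weighted, augmented version of a function `f` of the full data. -/
noncomputable def obsLift (p : ℝ) (P : Measure (ℝ × V)) [IsFiniteMeasure P] (f : ℝ × V → E) :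
    (ℝ × V) ⊕ V → E
  | Sum.inl w => (1 / p) • (f w - condAvg P f w.2) + condAvg P f w.2
  | Sum.inr v => condAvg P f v

variable {p : ℝ}

lemma measurable_obsLift [MeasurableSpace E] [BorelSpace E] [SecondCountableTopology E]
    {f : ℝ × V → E} (hf : Measurable f) : Measurable (obsLift p P f) := by
  have h := measurable_condAvg (P := P) hf
  refine measurable_fun_sum (f := obsLift p P f) ?_ h
  exact ((hf.sub (h.comp measurable_snd)).const_smul _).add (h.comp measurable_snd)

lemma integrable_comp_snd {k : V → E} (hk : Integrable k (P.map Prod.snd)) :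
    Integrable (fun w : ℝ × V => k w.2) P :=
  hk.comp_measurable measurable_snd

lemma integral_comp_snd {k : V → E} (hk : Integrable k (P.map Prod.snd)) :
    ∫ w, k w.2 ∂P = ∫ v, k v ∂(P.map Prod.snd) :=
  (integral_map measurable_snd.aemeasurable hk.1).symm

lemma integrable_obsLift (hp : p ∈ Set.Ioo (0 : ℝ) 1) {f : ℝ × V → E} (hf : Integrable f P) :
    Integrable (obsLift p P f) (mixLaw p P (P.map Prod.snd)) := by
  have h := integrable_condAvg hf
  have h' := integrable_comp_snd h
  exact (integrable_mixLaw_iff hp).2 ⟨((hf.sub h').smul (1 / p)).add h', h⟩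

/-- The weighted residual has mean zero by the tower property, whatever the weight. Hence the
labeled mean agrees with the unlabeled one, as the two-sample central limit theorem needs. -/
lemma integral_obsLift_inl {f : ℝ × V → E} (hf : Integrable f P) :
    ∫ w, obsLift p P f (Sum.inl w) ∂P = ∫ w, f w ∂P := by
  have h := integrable_condAvg hf
  have h' := integrable_comp_snd h
  have e : ∫ w : ℝ × V, condAvg P f w.2 ∂P = ∫ w, f w ∂P := by
    rw [integral_comp_snd h, integral_condAvg hf]
  calc _ = ∫ w, ((1 / p) • (f w - condAvg P f w.2) + condAvg P f w.2) ∂P := rfl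
    _ = (1 / p) • (∫ w, f w ∂P - ∫ w : ℝ × V, condAvg P f w.2 ∂P)
        + ∫ w : ℝ × V, condAvg P f w.2 ∂P := by
      rw [integral_add (f := fun w : ℝ × V => (1 / p) • (f w - condAvg P f w.2))
        ((hf.sub h').smul (1 / p)) h', integral_smul, integral_sub hf h']
    _ = _ := by rw [e, sub_self, smul_zero, zero_add]

lemma integral_obsLift (hp : p ∈ Set.Ioo (0 : ℝ) 1) {f : ℝ × V → E} (hf : Integrable f P) :
    ∫ o, obsLift p P f o ∂(mixLaw p P (P.map Prod.snd)) = ∫ w, f w ∂P := by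
  rw [integral_mixLaw hp (integrable_obsLift hp hf), integral_obsLift_inl hf]
  change p • _ + (1 - p) • ∫ v, condAvg P f v ∂(P.map Prod.snd) = _
  rw [integral_condAvg hf, ← add_smul]
  simp

lemma memLp_obsLift [MeasurableSpace E] [BorelSpace E] [SecondCountableTopology E]
    (hp : p ∈ Set.Ioo (0 : ℝ) 1) {f : ℝ × V → E} (hf : Measurable f)
    (h2 : MemLp f 2 P) : MemLp (obsLift p P f) 2 (mixLaw p P (P.map Prod.snd)) := by
  have h := memLp_condAvg hf h2
  have h' : MemLp (fun w : ℝ × V => condAvg P f w.2) 2 P :=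
    h.comp_of_map measurable_snd.aemeasurable
  exact (memLp_two_mixLaw_iff hp).2 ⟨((h2.sub h').const_smul (1 / p)).add h', h⟩

/-- The upper bound for `obsLift` that a bound `W` on the full data provides. -/
noncomputable def obsBound (p : ℝ) (P : Measure (ℝ × V)) [IsFiniteMeasure P] (W : ℝ × V → ℝ) :
    (ℝ × V) ⊕ V → ℝ
  | Sum.inl w => (1 / p) * (W w + condAvg P W w.2) + condAvg P W w.2
  | Sum.inr v => condAvg P W v

lemma measurable_obsBound {W : ℝ × V → ℝ} (hW : Measurable W) : Measurable (obsBound p P W) := by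
  have h := measurable_condAvg (P := P) hW
  refine measurable_fun_sum (f := obsBound p P W) ?_ h
  exact ((hW.add (h.comp measurable_snd)).const_mul _).add (h.comp measurable_snd)

lemma integrable_obsBound (hp : p ∈ Set.Ioo (0 : ℝ) 1) {W : ℝ × V → ℝ} (hW : Integrable W P) :
    Integrable (obsBound p P W) (mixLaw p P (P.map Prod.snd)) := by
  have h := integrable_condAvg hW
  have h' := integrable_comp_snd h
  exact (integrable_mixLaw_iff hp).2 ⟨((hW.add h').const_mul (1 / p)).add h', h⟩

/-- With m the mean of `W`, labeled points contribute p(2m/p + m) and unlabeled points (1 - p)m. The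
resulting factor 3 is why later arguments start from ε/3. -/
lemma integral_obsBound (hp : p ∈ Set.Ioo (0 : ℝ) 1) {W : ℝ × V → ℝ} (hW : Integrable W P) :
    ∫ o, obsBound p P W o ∂(mixLaw p P (P.map Prod.snd)) = 3 * ∫ w, W w ∂P := by
  have h := integrable_condAvg hW
  have h' := integrable_comp_snd h
  have e : ∫ w : ℝ × V, condAvg P W w.2 ∂P = ∫ w, W w ∂P := by
    rw [integral_comp_snd h, integral_condAvg hW]
  have e1 : ∫ w, obsBound p P W (Sum.inl w) ∂P =
      (1 / p) * (∫ w, W w ∂P + ∫ w, W w ∂P) + ∫ w, W w ∂P := by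
    calc _ = ∫ w, ((1 / p) * (W w + condAvg P W w.2) + condAvg P W w.2) ∂P := rfl
      _ = _ := by
        rw [integral_add (f := fun w : ℝ × V => (1 / p) * (W w + condAvg P W w.2))
          ((hW.add h').const_mul (1 / p)) h', integral_const_mul,
          integral_add hW h', e]
  rw [integral_mixLaw hp (integrable_obsBound hp hW), e1]
  change p • _ + (1 - p) • ∫ v, condAvg P W v ∂(P.map Prod.snd) = _
  rw [integral_condAvg hW]
  have := hp.1.ne'
  simp only [smul_eq_mul]
  field_simp
  ring

/-- A bound valid for all indices off one null set survives integration against the conditional law.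
The factor `c i` lets one statement serve both the modulus (`c = 1`) and the linearization (`c` the
distance between the two parameters). -/
lemma norm_obsLift_le (hp : p ∈ Set.Ioo (0 : ℝ) 1) {ι : Type*} {I : Set ι} {f : ι → ℝ × V → E}
    {c : ι → ℝ} {W : ℝ × V → ℝ} (hW : Integrable W P)
    (h : ∀ᵐ w ∂P, ∀ i ∈ I, ‖f i w‖ ≤ W w * c i) :
    ∀ᵐ o ∂(mixLaw p P (P.map Prod.snd)), ∀ i ∈ I,
      ‖obsLift p P (f i) o‖ ≤ obsBound p P W o * c i := by
  have hV : ∀ᵐ v ∂(P.map Prod.snd), ∀ i ∈ I, ‖condAvg P (f i) v‖ ≤ condAvg P W v * c i := by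
    filter_upwards [ae_condDistrib_of_ae h, integrable_condDistrib hW] with v hv hWv i hi
    rw [condAvg, condAvg, ← integral_mul_const]
    exact norm_integral_le_of_norm_le (hWv.mul_const _) (hv.mono fun y hy => hy i hi)
  refine (ae_mixLaw_iff hp).2 ⟨?_, hV⟩
  filter_upwards [h, ae_of_ae_map measurable_snd.aemeasurable hV] with w hw hwV i hi
  have hp0 : 0 ≤ 1 / p := (one_div_pos.2 hp.1).le
  have h1 := hw i hi
  have h2 := hwV i hi
  calc _ ≤ ‖(1 / p) • (f i w - condAvg P (f i) w.2)‖ + ‖condAvg P (f i) w.2‖ := norm_add_le _ _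
    _ ≤ (1 / p) * (‖f i w‖ + ‖condAvg P (f i) w.2‖) + ‖condAvg P (f i) w.2‖ := by
      rw [norm_smul, Real.norm_of_nonneg hp0]
      gcongr
      exact norm_sub_le _ _
    _ ≤ (1 / p) * (W w * c i + condAvg P W w.2 * c i) + condAvg P W w.2 * c i := by gcongr
    _ = obsBound p P W (Sum.inl w) * c i := by simp only [obsBound]; ring

/-- The conditional mean need not be additive at covariates where a section fails to be integrable,
so additivity is assumed at the covariates of the given point only. -/
lemma obsLift_sub_of_integrable {f g : ℝ × V → E} {o : (ℝ × V) ⊕ V}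
    (h : condAvg P (fun w => f w - g w) (Sum.elim Prod.snd id o) =
      condAvg P f (Sum.elim Prod.snd id o) - condAvg P g (Sum.elim Prod.snd id o)) :
    obsLift p P (fun w => f w - g w) o = obsLift p P f o - obsLift p P g o := by
  rcases o with w | v
  · simp only [Sum.elim_inl] at h
    simp only [obsLift, h]
    module
  · exact h

lemma ae_elim_snd (hp : p ∈ Set.Ioo (0 : ℝ) 1) {r : V → Prop} (h : ∀ᵐ v ∂(P.map Prod.snd), r v) :
    ∀ᵐ o ∂(mixLaw p P (P.map Prod.snd)), r (Sum.elim Prod.snd id o) :=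
  (ae_mixLaw_iff hp).2 ⟨ae_of_ae_map measurable_snd.aemeasurable h, h⟩

lemma condAvg_sub {f g : ℝ × V → E} {v : V}
    (hf : Integrable (fun y => f (y, v))
      (condDistrib (fun w : ℝ × V => w.1) (fun w : ℝ × V => w.2) P v))
    (hg : Integrable (fun y => g (y, v))
      (condDistrib (fun w : ℝ × V => w.1) (fun w : ℝ × V => w.2) P v)) :
    condAvg P (fun w => f w - g w) v = condAvg P f v - condAvg P g v :=
  integral_sub hf hg

end CondAvg

/-! ### Passing regularity from ψ to φ -/

section Transfer

variable {V : Type*} [MeasurableSpace V] {P : Measure (ℝ × V)} [IsProbabilityMeasure P] {p : ℝ}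
  {q : ℕ} {Θ : Set (Vec q)} {f : Vec q → ℝ × V → Vec q} {θ₀ : Vec q}

/-- The envelope makes the exceptional set of covariates independent of θ. -/
lemma integrable_condDistrib_of_envelope {F : ℝ × V → ℝ} (hF : Integrable F P)
    (hm : ∀ θ ∈ Θ, Measurable (f θ)) (hfF : ∀ᵐ w ∂P, ∀ θ ∈ Θ, ‖f θ w‖ ≤ F w) :
    ∀ᵐ v ∂(P.map Prod.snd), ∀ θ ∈ Θ, Integrable (fun y => f θ (y, v))
      (condDistrib (fun w : ℝ × V => w.1) (fun w : ℝ × V => w.2) P v) := by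
  filter_upwards [ae_condDistrib_of_ae hfF, integrable_condDistrib hF] with v hv hFv θ hθ
  exact hFv.mono' ((hm θ hθ).comp measurable_prodMk_right).aestronglyMeasurable
    (hv.mono fun y hy => hy θ hθ)

lemma HasLocalModulus.obsLift (hp : p ∈ Set.Ioo (0 : ℝ) 1) {F : ℝ × V → ℝ} (hF : Integrable F P)
    (hm : ∀ θ ∈ Θ, Measurable (f θ)) (hfF : ∀ᵐ w ∂P, ∀ θ ∈ Θ, ‖f θ w‖ ≤ F w)
    (h : HasLocalModulus P Θ f) :
    HasLocalModulus (mixLaw p P (P.map Prod.snd)) Θ (fun θ => obsLift p P (f θ)) := by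
  intro θ hθ ε hε
  obtain ⟨δ, hδ, W, hWm, hWi, hW, hae⟩ := h θ hθ (ε / 3) (by positivity)
  refine ⟨δ, hδ, obsBound p P W, measurable_obsBound hWm, integrable_obsBound hp hWi, ?_, ?_⟩
  · rw [integral_obsBound hp hWi]
    linarith
  have h1 := norm_obsLift_le hp (I := {θ' | θ' ∈ Θ ∧ dist θ' θ < δ}) (f := fun θ' w => f θ' w - f θ w)
    (c := fun _ => 1) hWi (by
      filter_upwards [hae] with w hw θ' hθ'
      rw [mul_one]
      exact hw θ' hθ'.1 hθ'.2)
  filter_upwards [h1, ae_elim_snd hp (integrable_condDistrib_of_envelope hF hm hfF)]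
    with o ho hio θ' hθ' hd
  have := ho θ' ⟨hθ', hd⟩
  rw [mul_one, obsLift_sub_of_integrable (condAvg_sub (hio θ' hθ') (hio θ hθ))] at this
  exact this

lemma obsLift_clm_apply {L : ℝ × V → Vec q →L[ℝ] Vec q} {o : (ℝ × V) ⊕ V}
    (hL : Integrable (fun y => L (y, Sum.elim Prod.snd id o))
      (condDistrib (fun w : ℝ × V => w.1) (fun w : ℝ × V => w.2) P (Sum.elim Prod.snd id o)))
    (z : Vec q) : PostPred.obsLift p P (fun w => L w z) o = PostPred.obsLift p P L o z := by
  have h : condAvg P (fun w => L w z) (Sum.elim Prod.snd id o)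
      = condAvg P L (Sum.elim Prod.snd id o) z := by
    rw [condAvg, condAvg, ContinuousLinearMap.integral_apply hL]
  rcases o with w | v
  · simp only [Sum.elim_inl] at h
    simp [PostPred.obsLift, h]
  · exact h

/-- The linearization inequality is integrated against the conditional law, so the conditional mean
inherits a linearization with the conditional mean of `L` as derivative, without differentiating
under the integral. -/
lemma HasLinearization.obsLift (hp : p ∈ Set.Ioo (0 : ℝ) 1) {F : ℝ × V → ℝ} (hF : Integrable F P)
    (hm : ∀ θ ∈ Θ, Measurable (f θ)) (hfF : ∀ᵐ w ∂P, ∀ θ ∈ Θ, ‖f θ w‖ ≤ F w) (hΘ : Θ ∈ 𝓝 θ₀)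
    {L : ℝ × V → Vec q →L[ℝ] Vec q} (hL : Integrable L P)
    (h : HasLinearization P f L θ₀) :
    HasLinearization (mixLaw p P (P.map Prod.snd)) (fun θ => obsLift p P (f θ)) (obsLift p P L)
      θ₀ := by
  intro ε hε
  obtain ⟨r, hr, hrΘ⟩ := Metric.mem_nhds_iff.1 hΘ
  obtain ⟨δ, hδ, W, hWm, hWi, hW, hae⟩ := h (ε / 3) (by positivity)
  refine ⟨min r δ, lt_min hr hδ, obsBound p P W, measurable_obsBound hWm,
    integrable_obsBound hp hWi, ?_, ?_⟩
  · rw [integral_obsBound hp hWi]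
    linarith
  have h1 := norm_obsLift_le hp (I := Metric.ball θ₀ (min r δ) ×ˢ Metric.ball θ₀ (min r δ))
    (f := fun z w => f z.1 w - f z.2 w - L w (z.1 - z.2))
    (c := fun z => ‖z.1 - z.2‖) hWi (by
      filter_upwards [hae] with w hw z hz
      exact hw z.1 (Metric.ball_subset_ball (min_le_right _ _) hz.1) z.2
        (Metric.ball_subset_ball (min_le_right _ _) hz.2))
  filter_upwards [h1, ae_elim_snd hp (integrable_condDistrib_of_envelope hF hm hfF),
    ae_elim_snd hp (integrable_condDistrib hL)] with o ho hio hLo θ hθ θ' hθ'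
  have := ho (θ, θ') ⟨hθ, hθ'⟩
  have i1 := hio θ (hrΘ (Metric.ball_subset_ball (min_le_left _ _) hθ))
  have i2 := hio θ' (hrΘ (Metric.ball_subset_ball (min_le_left _ _) hθ'))
  rw [obsLift_sub_of_integrable (condAvg_sub (f := fun w => f θ w - f θ' w) (i1.sub i2)
      (hLo.apply_continuousLinearMap _)), obsLift_sub_of_integrable (condAvg_sub i1 i2),
      obsLift_clm_apply hLo] at this
  exact this

variable {O : Type*} [MeasurableSpace O] {ν : Measure O} {φ : Vec q → O → Vec q}

lemma HasLocalModulus.clm_comp (h : HasLocalModulus ν Θ φ) (T : Vec q →L[ℝ] Vec q) :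
    HasLocalModulus ν Θ (fun θ o => T (φ θ o)) := by
  intro θ hθ ε hε
  obtain ⟨δ, hδ, W, hWm, hWi, hW, hae⟩ := h θ hθ (ε / (‖T‖ + 1)) (by positivity)
  refine ⟨δ, hδ, fun o => (‖T‖ + 1) * W o, hWm.const_mul _, hWi.const_mul _, ?_, ?_⟩
  · rw [integral_const_mul]
    rwa [lt_div_iff₀' (by positivity)] at hW
  · filter_upwards [hae] with o ho θ' hθ' hd
    rw [← map_sub]
    refine (T.le_opNorm _).trans ?_
    have := ho θ' hθ' hd
    gcongr
    linarith

lemma HasLinearization.clm_comp {L : O → Vec q →L[ℝ] Vec q} (h : HasLinearization ν φ L θ₀)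
    (T : Vec q →L[ℝ] Vec q) : HasLinearization ν (fun θ o => T (φ θ o)) (fun o => T ∘L L o) θ₀ := by
  intro ε hε
  obtain ⟨δ, hδ, W, hWm, hWi, hW, hae⟩ := h (ε / (‖T‖ + 1)) (by positivity)
  refine ⟨δ, hδ, fun o => (‖T‖ + 1) * W o, hWm.const_mul _, hWi.const_mul _, ?_, ?_⟩
  · rw [integral_const_mul]
    rwa [lt_div_iff₀' (by positivity)] at hW
  · filter_upwards [hae] with o ho θ hθ θ' hθ'
    rw [ContinuousLinearMap.comp_apply, ← map_sub, ← map_sub, mul_assoc]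
    refine (T.le_opNorm _).trans ?_
    have := ho θ hθ θ' hθ'
    gcongr
    linarith

end Transfer


/-! ### Means along paths differentiable in quadratic mean -/

section QMD

variable {O E : Type*} [MeasurableSpace O] [NormedAddCommGroup E] [NormedSpace ℝ E]
  {ν : Measure O}

lemma eLpNorm_smul_le {k : O → ℝ} {z : O → E} (hk : AEStronglyMeasurable k ν)
    (hz : AEStronglyMeasurable z ν) :
    eLpNorm (fun o => k o • z o) 1 ν ≤ eLpNorm k 2 ν * eLpNorm z 2 ν :=
  eLpNorm_smul_le_mul_eLpNorm hz hk

lemma eLpNorm_two_sq (z : O → E) : eLpNorm z 2 ν ^ 2 = ∫⁻ o, ‖z o‖ₑ ^ 2 ∂ν := by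
  have := eLpNorm_nnreal_pow_eq_lintegral (f := z) (μ := ν) (p := 2) two_ne_zero
  simpa using this

lemma enorm_sqrt_sq {a : ℝ} (ha : 0 ≤ a) : ‖√a‖ₑ ^ 2 = ENNReal.ofReal a := by
  rw [← ofReal_norm, Real.norm_of_nonneg (Real.sqrt_nonneg _),
    ← ENNReal.ofReal_pow (Real.sqrt_nonneg _), Real.sq_sqrt ha]

lemma integral_withDensity_ofReal {f : O → ℝ} (hf : Measurable f) (hf0 : ∀ o, 0 ≤ f o)
    (h : O → E) :
    ∫ o, h o ∂(ν.withDensity fun o => ENNReal.ofReal (f o)) = ∫ o, f o • h o ∂ν := by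
  rw [integral_withDensity_eq_integral_toReal_smul hf.ennreal_ofReal
    (.of_forall fun _ => ENNReal.ofReal_lt_top)]
  simp only [ENNReal.toReal_ofReal (hf0 _)]

lemma integrable_smul_of_memLp_two {k : O → ℝ} {z : O → E} (hk : MemLp k 2 ν) (hz : MemLp z 2 ν) :
    Integrable (fun o => k o • z o) ν :=
  memLp_one_iff_integrable.1 (hz.smul hk)

variable [MeasurableSpace E] [BorelSpace E] [SecondCountableTopology E]

/-- Multiplication by the root density moves L² norms under the varying laws to one fixed measure,
where they can be compared. -/
lemma eLpNorm_withDensity {f : O → ℝ} (hf : Measurable f) (hf0 : ∀ o, 0 ≤ f o) {h : O → E}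
    (hh : Measurable h) :
    eLpNorm h 2 (ν.withDensity fun o => ENNReal.ofReal (f o)) =
      eLpNorm (fun o => √(f o) • h o) 2 ν := by
  refine (ENNReal.pow_right_strictMono two_ne_zero).injective ?_
  simp only [eLpNorm_two_sq]
  rw [lintegral_withDensity_eq_lintegral_mul _ hf.ennreal_ofReal (hh.enorm.pow_const 2)]
  refine lintegral_congr fun o => ?_
  rw [Pi.mul_apply, enorm_smul, mul_pow, enorm_sqrt_sq (hf0 o)]

/-- Pairing a fixed function of `L²` with a bounded family: it suffices to control the family on
the sets where `F` is bounded. -/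
lemma tendsto_eLpNorm_smul_of_truncation {ι : Type*} {l : Filter ι} {k : O → ℝ} (hk : MemLp k 2 ν)
    (hkm : Measurable k) {z : ι → O → E} (hz : ∀ᶠ i in l, Measurable (z i)) {C : ENNReal}
    (hC : C ≠ ⊤) (hzC : ∀ᶠ i in l, eLpNorm (z i) 2 ν ≤ C) {F : O → ℝ} (hF : Measurable F)
    (hM : ∀ M : ℕ, Tendsto (fun i => eLpNorm ({o | F o ≤ M}.indicator fun o => k o • z i o) 1 ν) l
      (𝓝 0)) :
    Tendsto (fun i => eLpNorm (fun o => k o • z i o) 1 ν) l (𝓝 0) := by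
  have hFM : ∀ M : ℕ, MeasurableSet {o | F o ≤ M} := fun M => measurableSet_le hF measurable_const
  -- Off the truncation set Cauchy–Schwarz pairs the L² tail of the fixed `k` with the uniform bound
  -- `C`; no uniform integrability of the family is needed.
  have htail : Tendsto (fun M : ℕ => eLpNorm ({o | F o ≤ M}ᶜ.indicator k) 2 ν) atTop (𝓝 0) := by
    have h2 : Tendsto (fun M : ℕ => eLpNorm ({o | F o ≤ M}ᶜ.indicator k) 2 ν ^ 2) atTop (𝓝 0) := by
      simp only [eLpNorm_two_sq]
      have := tendsto_lintegral_of_dominated_convergence (μ := ν)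
        (F := fun (M : ℕ) o => ‖{o | F o ≤ M}ᶜ.indicator k o‖ₑ ^ 2) (f := fun _ => 0)
        (fun o => ‖k o‖ₑ ^ 2) (fun M => ((hkm.indicator (hFM M).compl).enorm.pow_const 2))
        (fun M => .of_forall fun o => ?_) ((memLp_two_iff_lintegral hk.1).1 hk).ne
        (.of_forall fun o => ?_)
      · simpa using this
      · simp only
        gcongr
        rw [enorm_indicator_eq_indicator_enorm]
        exact Set.indicator_le_self _ _ o
      · refine tendsto_const_nhds.congr' ?_
        obtain ⟨M₀, hM₀⟩ := exists_nat_ge (F o)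
        filter_upwards [eventually_ge_atTop M₀] with M hM
        have : F o ≤ M := hM₀.trans (by exact_mod_cast hM)
        rw [Set.indicator_of_notMem (by simpa using this)]
        simp
    have h3 := (ENNReal.continuous_rpow_const (y := (1 / 2 : ℝ))).continuousAt.tendsto.comp h2
    rw [ENNReal.zero_rpow_of_pos (by norm_num)] at h3
    refine h3.congr fun M => ?_
    simp only [Function.comp_apply]
    rw [← ENNReal.rpow_natCast, ← ENNReal.rpow_mul]
    norm_num
  rw [ENNReal.tendsto_nhds_zero]
  intro η hη
  have htail' : Tendsto (fun M : ℕ => eLpNorm ({o | F o ≤ M}ᶜ.indicator k) 2 ν * C) atTop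
      (𝓝 0) := by
    simpa using ENNReal.Tendsto.mul_const htail (Or.inr hC)
  obtain ⟨M, hMη⟩ := (htail'.eventually_le_const (ENNReal.half_pos hη.ne')).exists
  filter_upwards [hz, hzC, (hM M).eventually_le_const (ENNReal.half_pos hη.ne')] with i hzi hzCi hi
  have hsplit : (fun o => k o • z i o) = ({o | F o ≤ M}.indicator fun o => k o • z i o)
      + fun o => {o | F o ≤ M}ᶜ.indicator k o • z i o := by
    ext1 o
    by_cases ho : F o ≤ M <;> simp [Set.indicator, ho]
  rw [hsplit]
  refine (eLpNorm_add_le ((hkm.smul hzi).indicator (hFM M)).aestronglyMeasurable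
    ((hkm.indicator (hFM M).compl).smul hzi).aestronglyMeasurable le_rfl).trans ?_
  rw [← ENNReal.add_halves η]
  refine add_le_add hi (le_trans ?_ hMη)
  refine (eLpNorm_smul_le (hkm.indicator (hFM M).compl).aestronglyMeasurable
    hzi.aestronglyMeasurable).trans ?_
  gcongr

/-- Square roots of densities along a path that is differentiable in quadratic mean, with a
measurable version `g'` of the score. -/
lemma IsQMD.exists_density {Q : ℝ → Measure O} [∀ t, IsProbabilityMeasure (Q t)] {g : O → ℝ}
    (hQ : IsQMD Q g) :
    ∃ (ν : Measure O) (f : ℝ → O → ℝ) (g' : O → ℝ), (∀ t, Measurable (f t)) ∧ (∀ t o, 0 ≤ f t o) ∧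
      (∀ t, Q t = ν.withDensity fun o => ENNReal.ofReal (f t o)) ∧ Measurable g' ∧ g' =ᵐ[Q 0] g ∧
      (∀ t, MemLp (fun o => √(f t o)) 2 ν) ∧ MemLp (fun o => g' o * √(f 0 o)) 2 ν ∧
      Tendsto (fun t => eLpNorm
        (fun o => (√(f t o) - √(f 0 o)) / t - 1 / 2 * (g' o * √(f 0 o))) 2 ν) (𝓝[≠] 0) (𝓝 0) ∧
      Tendsto (fun t => eLpNorm (fun o => √(f t o) - √(f 0 o)) 2 ν) (𝓝[≠] 0) (𝓝 0) := by
  obtain ⟨ν, f, -, hfm, hf0, hQf, hg, hlim⟩ := hQ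
  obtain ⟨g', hg'm, hgg'⟩ := hg.1
  have hg'm' := hg'm.measurable
  -- The two versions of the score may differ where `f 0` vanishes, but there the factor `√(f 0 o)`
  -- removes the difference.
  have hν : ∀ᵐ o ∂ν, f 0 o ≠ 0 → g o = g' o := by
    have := hgg'
    rw [hQf 0] at this
    have h2 := (ae_withDensity_iff (hfm 0).ennreal_ofReal).1 this
    filter_upwards [h2] with o ho h
    exact ho (by simpa using lt_of_le_of_ne (hf0 0 o) (Ne.symm h))
  have hgs : ∀ᵐ o ∂ν, g o * √(f 0 o) = g' o * √(f 0 o) := by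
    filter_upwards [hν] with o ho
    by_cases h : f 0 o = 0
    · simp [h]
    · rw [ho h]
  have hs : ∀ t, MemLp (fun o => √(f t o)) 2 ν := by
    intro t
    refine ⟨(hfm t).sqrt.aestronglyMeasurable, ?_⟩
    have h1 := eLpNorm_withDensity (ν := ν) (hfm t) (hf0 t) (h := fun _ => (1 : ℝ))
      measurable_const
    rw [← hQf t] at h1
    simp only [smul_eq_mul, mul_one] at h1
    rw [← h1]
    exact (memLp_const (1 : ℝ)).2
  have hk : MemLp (fun o => g' o * √(f 0 o)) 2 ν := by
    refine ⟨(hg'm'.mul (hfm 0).sqrt).aestronglyMeasurable, ?_⟩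
    have h1 := eLpNorm_withDensity (ν := ν) (hfm 0) (hf0 0) hg'm'
    rw [← hQf 0, eLpNorm_congr_ae hgg'.symm] at h1
    simp only [smul_eq_mul] at h1
    simp only [mul_comm (g' _)]
    rw [← h1]
    exact hg.2
  have hr : Tendsto (fun t => eLpNorm
      (fun o => (√(f t o) - √(f 0 o)) / t - 1 / 2 * (g' o * √(f 0 o))) 2 ν) (𝓝[≠] 0) (𝓝 0) := by
    refine hlim.congr fun t => eLpNorm_congr_ae ?_
    filter_upwards [hgs] with o ho
    rw [← ho, mul_assoc]
  refine ⟨ν, f, g', hfm, hf0, hQf, hg'm', hgg'.symm, hs, hk, hr, ?_⟩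
  -- The increment is `t` times remainder plus half score, hence tends to zero in L².
  have hbound : ∀ᶠ t in 𝓝[≠] (0 : ℝ), eLpNorm (fun o => √(f t o) - √(f 0 o)) 2 ν ≤
      ‖t‖ₑ * (eLpNorm (fun o => (√(f t o) - √(f 0 o)) / t - 1 / 2 * (g' o * √(f 0 o))) 2 ν
        + eLpNorm (fun o => 1 / 2 * (g' o * √(f 0 o))) 2 ν) := by
    filter_upwards [self_mem_nhdsWithin] with t ht
    have ht0 : t ≠ 0 := ht
    have e : (fun o => √(f t o) - √(f 0 o)) = t •
        ((fun o => (√(f t o) - √(f 0 o)) / t - 1 / 2 * (g' o * √(f 0 o)))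
          + fun o => 1 / 2 * (g' o * √(f 0 o))) := by
      ext1 o
      simp only [Pi.smul_apply, Pi.add_apply, smul_eq_mul]
      field_simp
      ring
    conv_lhs => rw [e]
    rw [eLpNorm_const_smul]
    gcongr
    refine eLpNorm_add_le ?_ ?_ (by norm_num)
    · exact ((((hfm t).sqrt.sub (hfm 0).sqrt).div_const t).sub
        ((hg'm'.mul (hfm 0).sqrt).const_mul _)).aestronglyMeasurable
    · exact ((hg'm'.mul (hfm 0).sqrt).const_mul _).aestronglyMeasurable
  have hT : Tendsto (fun t : ℝ => ‖t‖ₑ * (eLpNorm (fun o => (√(f t o) - √(f 0 o)) / t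
      - 1 / 2 * (g' o * √(f 0 o))) 2 ν + eLpNorm (fun o => 1 / 2 * (g' o * √(f 0 o))) 2 ν))
      (𝓝[≠] 0) (𝓝 (0 * (0 + eLpNorm (fun o => 1 / 2 * (g' o * √(f 0 o))) 2 ν))) := by
    refine ENNReal.Tendsto.mul ?_ (Or.inr ?_) (hr.add_const _) (Or.inr (by simp))
    · have : Tendsto (fun t : ℝ => ‖t‖ₑ) (𝓝 0) (𝓝 ‖(0 : ℝ)‖ₑ) :=
        continuous_enorm.tendsto 0
      rw [enorm_zero] at this
      exact this.mono_left nhdsWithin_le_nhds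
    · rw [zero_add]
      exact (hk.const_mul (1 / 2)).2.ne
  rw [zero_mul] at hT
  exact tendsto_of_tendsto_of_tendsto_of_le_of_le' tendsto_const_nhds hT
    (.of_forall fun _ => zero_le) hbound

lemma memLp_two_of_eLpNorm_le {O' : Type*} [MeasurableSpace O'] {R : Measure O'} {C : ENNReal}
    (hC : C ≠ ⊤) {z : O' → E} (hz : Measurable z) (h : eLpNorm z 2 R ≤ C) : MemLp z 2 R :=
  ⟨hz.aestronglyMeasurable, h.trans_lt hC.lt_top⟩

/-- Along a path that is differentiable in quadratic mean, the mean of a family of functions,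
bounded in `L²` and converging pointwise, is differentiable in the weak sense. -/
theorem IsQMD.tendsto_integral_sub [CompleteSpace E] {Q : ℝ → Measure O}
    [∀ t, IsProbabilityMeasure (Q t)]
    {g : O → ℝ} (hQ : IsQMD Q g) {h : ℝ → O → E} {h₀ : O → E} {C : ENNReal} (hC : C ≠ ⊤)
    (hm : ∀ᶠ t in 𝓝[≠] 0, Measurable (h t)) (hm₀ : Measurable h₀)
    (hb : ∀ᶠ t in 𝓝[≠] 0, eLpNorm (h t) 2 (Q t) ≤ C)
    (hb' : ∀ᶠ t in 𝓝[≠] 0, eLpNorm (h t) 2 (Q 0) ≤ C) (hb₀ : eLpNorm h₀ 2 (Q 0) ≤ C)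
    {F : O → ℝ} (hF : Measurable F) (hhF : ∀ᶠ t in 𝓝[≠] 0, ∀ᵐ o ∂(Q 0), ‖h t o‖ ≤ F o)
    (hhF₀ : ∀ᵐ o ∂(Q 0), ‖h₀ o‖ ≤ F o)
    (hlim : ∀ᵐ o ∂(Q 0), Tendsto (fun t => h t o) (𝓝[≠] 0) (𝓝 (h₀ o))) :
    Tendsto (fun t => t⁻¹ • (∫ o, h t o ∂(Q t) - ∫ o, h t o ∂(Q 0))) (𝓝[≠] 0)
      (𝓝 (∫ o, g o • h₀ o ∂(Q 0))) := by
  obtain ⟨ν, f, g', hfm, hf0, hQf, hg'm, hg', hs, hk, hr, hσ⟩ := hQ.exists_density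
  have hsm : ∀ t, Measurable fun o => √(f t o) := fun t => (hfm t).sqrt
  set k : O → ℝ := fun o => g' o * √(f 0 o) with hkdef
  have hkm : Measurable k := hg'm.mul (hsm 0)
  set r : ℝ → O → ℝ := fun t o => (√(f t o) - √(f 0 o)) / t - 1 / 2 * k o with hrdef
  have hrm : ∀ t, Measurable (r t) := fun t =>
    (((hsm t).sub (hsm 0)).div_const t).sub (hkm.const_mul _)
  have hbu : ∀ᶠ t in 𝓝[≠] 0, eLpNorm (fun o => √(f t o) • h t o) 2 ν ≤ C := by
    filter_upwards [hm, hb] with t hmt hbt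
    rwa [hQf t, eLpNorm_withDensity (hfm t) (hf0 t) hmt] at hbt
  have hbv : ∀ᶠ t in 𝓝[≠] 0, eLpNorm (fun o => √(f 0 o) • h t o) 2 ν ≤ C := by
    filter_upwards [hm, hb'] with t hmt hbt
    rwa [hQf 0, eLpNorm_withDensity (hfm 0) (hf0 0) hmt] at hbt
  have hbw : eLpNorm (fun o => √(f 0 o) • h₀ o) 2 ν ≤ C := by
    rwa [hQf 0, eLpNorm_withDensity (hfm 0) (hf0 0) hm₀] at hb₀
  -- Facts known under `Q 0` reach `ν` only where `f 0` is positive. That suffices below, since `k`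
  -- vanishes elsewhere.
  have hν : ∀ {a : O → Prop}, (∀ᵐ o ∂(Q 0), a o) → ∀ᵐ o ∂ν, f 0 o ≠ 0 → a o := by
    intro a ha
    rw [hQf 0] at ha
    filter_upwards [(ae_withDensity_iff (hfm 0).ennreal_ofReal).1 ha] with o ho h
    exact ho (by simpa using lt_of_le_of_ne (hf0 0 o) (Ne.symm h))
  have hC2 : C + C ≠ ⊤ := ENNReal.add_ne_top.2 ⟨hC, hC⟩
  -- the change of the density multiplying the score
  have hX : Tendsto (fun t => eLpNorm (fun o => k o • ((√(f t o) - √(f 0 o)) • h t o)) 1 ν)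
      (𝓝[≠] 0) (𝓝 0) := by
    refine tendsto_eLpNorm_smul_of_truncation hk hkm
      (hm.mono fun t hmt => ((hsm t).sub (hsm 0)).smul hmt) hC2 ?_ hF fun M => ?_
    · filter_upwards [hm, hbu, hbv] with t hmt hu hv
      have e : (fun o => (√(f t o) - √(f 0 o)) • h t o) =
          (fun o => √(f t o) • h t o) - fun o => √(f 0 o) • h t o := by
        ext1 o; simp [sub_smul]
      rw [e]
      exact (eLpNorm_sub_le ((hsm t).smul hmt).aestronglyMeasurable
        ((hsm 0).smul hmt).aestronglyMeasurable (by norm_num)).trans (add_le_add hu hv)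
    · have hT : Tendsto (fun t => eLpNorm (fun o => (M : ℝ) * k o) 2 ν *
          eLpNorm (fun o => √(f t o) - √(f 0 o)) 2 ν) (𝓝[≠] 0)
          (𝓝 (eLpNorm (fun o => (M : ℝ) * k o) 2 ν * 0)) :=
        ENNReal.Tendsto.const_mul hσ (Or.inr (hk.const_mul (M : ℝ)).2.ne)
      rw [mul_zero] at hT
      refine tendsto_of_tendsto_of_tendsto_of_le_of_le' tendsto_const_nhds hT
        (.of_forall fun _ => zero_le) ?_
      filter_upwards [hhF] with t hFt
      refine le_trans (eLpNorm_mono_ae (g := fun o => ((M : ℝ) * k o) • (√(f t o) - √(f 0 o))) ?_)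
        (eLpNorm_smul_le (hkm.const_mul _).aestronglyMeasurable
          ((hsm t).sub (hsm 0)).aestronglyMeasurable)
      filter_upwards [hν hFt] with o ho
      by_cases h0 : f 0 o = 0
      · have : k o = 0 := by simp [hkdef, h0]
        simp [this, Set.indicator]
      by_cases hFM : F o ≤ M
      · rw [Set.indicator_of_mem (show o ∈ {o | F o ≤ M} from hFM), norm_smul (k o),
          norm_smul (√(f t o) - √(f 0 o)), norm_smul (_ * k o), norm_mul _ (k o), Real.norm_natCast]
        have : ‖h t o‖ ≤ M := (ho h0).trans hFM
        calc _ ≤ ‖k o‖ * (‖√(f t o) - √(f 0 o)‖ * M) := by gcongr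
          _ = _ := by ring
      · rw [Set.indicator_of_notMem (show o ∉ {o | F o ≤ M} from hFM), norm_zero]
        exact norm_nonneg _
  -- the change of the function
  have hY : Tendsto (fun t => eLpNorm (fun o => k o • (√(f 0 o) • (h t o - h₀ o))) 1 ν)
      (𝓝[≠] 0) (𝓝 0) := by
    refine tendsto_eLpNorm_smul_of_truncation hk hkm
      (hm.mono fun t hmt => (hsm 0).smul (hmt.sub hm₀)) hC2 ?_ hF fun M => ?_
    · filter_upwards [hm, hbv] with t hmt hv
      simp only [smul_sub]
      exact (eLpNorm_sub_le ((hsm 0).smul hmt).aestronglyMeasurable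
        ((hsm 0).smul hm₀).aestronglyMeasurable (by norm_num)).trans (add_le_add hv hbw)
    · simp only [eLpNorm_one_eq_lintegral_enorm]
      have := tendsto_lintegral_filter_of_dominated_convergence (μ := ν) (l := 𝓝[≠] (0 : ℝ))
        (F := fun t o => ‖{o | F o ≤ M}.indicator
          (fun o => k o • (√(f 0 o) • (h t o - h₀ o))) o‖ₑ) (f := fun _ => 0)
        (fun o => ‖k o * (√(f 0 o) * (2 * M))‖ₑ) ?_ ?_ ?_ ?_
      · simpa using this
      · filter_upwards [hm] with t hmt
        exact ((hkm.smul ((hsm 0).smul (hmt.sub hm₀))).indicator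
          (measurableSet_le hF measurable_const)).enorm
      · filter_upwards [hhF] with t hFt
        filter_upwards [hν hFt, hν hhF₀] with o ho ho'
        by_cases h0 : f 0 o = 0
        · have : k o = 0 := by simp [hkdef, h0]
          simp [this, Set.indicator]
        by_cases hFM : F o ≤ M
        · rw [Set.indicator_of_mem (show o ∈ {o | F o ≤ M} from hFM), enorm_smul (k o),
            enorm_smul (√(f 0 o)), enorm_mul (k o), enorm_mul (√(f 0 o))]
          gcongr
          refine enorm_le_iff_norm_le.2 ((norm_sub_le _ _).trans ?_)
          have h1 : ‖h t o‖ ≤ M := (ho h0).trans hFM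
          have h2 : ‖h₀ o‖ ≤ M := (ho' h0).trans hFM
          exact le_trans (by linarith) (le_abs_self (2 * (M : ℝ)))
        · rw [Set.indicator_of_notMem (show o ∉ {o | F o ≤ M} from hFM)]
          simp
      · rw [← eLpNorm_one_eq_lintegral_enorm]
        exact (memLp_one_iff_integrable.2 (hk.integrable_mul ((hs 0).mul_const (2 * M)))).2.ne
      · filter_upwards [hν hlim] with o ho
        by_cases h0 : f 0 o = 0
        · have : k o = 0 := by simp [hkdef, h0]
          simp [this, Set.indicator]
        by_cases hFM : F o ≤ M
        · simp only [Set.indicator_of_mem (show o ∈ {o | F o ≤ M} from hFM)]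
          have h1 : Tendsto (fun t => k o • (√(f 0 o) • (h t o - h₀ o))) (𝓝[≠] 0)
              (𝓝 (k o • (√(f 0 o) • (h₀ o - h₀ o)))) :=
            (((ho h0).sub_const _).const_smul _).const_smul _
          simpa using h1.enorm
        · simp only [Set.indicator_of_notMem (show o ∉ {o | F o ≤ M} from hFM)]
          simp
  -- the total error
  have hT : Tendsto (fun t => eLpNorm (r t) 2 ν * C + eLpNorm (r t) 2 ν * C
      + ‖(1 / 2 : ℝ)‖ₑ * eLpNorm (fun o => k o • ((√(f t o) - √(f 0 o)) • h t o)) 1 ν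
      + eLpNorm (fun o => k o • (√(f 0 o) • (h t o - h₀ o))) 1 ν) (𝓝[≠] 0)
      (𝓝 (0 * C + 0 * C + ‖(1 / 2 : ℝ)‖ₑ * 0 + 0)) :=
    (((ENNReal.Tendsto.mul_const hr (Or.inr hC)).add (ENNReal.Tendsto.mul_const hr (Or.inr hC))).add
      (ENNReal.Tendsto.const_mul hX (Or.inr (by simp)))).add hY
  rw [zero_mul, mul_zero, add_zero, add_zero, add_zero] at hT
  rw [tendsto_iff_norm_sub_tendsto_zero, ← tendsto_zero_iff_norm_tendsto_zero,
    tendsto_zero_iff_enorm_tendsto_zero]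
  refine tendsto_of_tendsto_of_tendsto_of_le_of_le' tendsto_const_nhds hT
    (.of_forall fun _ => zero_le) ?_
  have hgint : ∫ o, g o • h₀ o ∂(Q 0) = ∫ o, f 0 o • (g' o • h₀ o) ∂ν := by
    rw [← integral_withDensity_ofReal (hfm 0) (hf0 0), ← hQf 0]
    refine integral_congr_ae ?_
    filter_upwards [hg'] with o ho
    rw [ho]
  have hw2 : MemLp (fun o => √(f 0 o) • h₀ o) 2 ν :=
    memLp_two_of_eLpNorm_le hC ((hsm 0).smul hm₀) hbw
  have i3 : Integrable (fun o => f 0 o • (g' o • h₀ o)) ν := by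
    refine (memLp_one_iff_integrable.1 (hw2.smul hk)).congr (.of_forall fun o => ?_)
    simp only [Pi.smul_apply', hkdef, smul_smul]
    congr 1
    linear_combination g' o * Real.mul_self_sqrt (hf0 0 o)
  filter_upwards [hm, hbu, hbv, self_mem_nhdsWithin] with t hmt hu hv ht
  have ht0 : t ≠ 0 := ht
  have mu : Measurable fun o => √(f t o) • h t o := (hsm t).smul hmt
  have mv : Measurable fun o => √(f 0 o) • h t o := (hsm 0).smul hmt
  have hu2 : MemLp (fun o => √(f t o) • h t o) 2 ν := memLp_two_of_eLpNorm_le hC mu hu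
  have hv2 : MemLp (fun o => √(f 0 o) • h t o) 2 ν := memLp_two_of_eLpNorm_le hC mv hv
  have i1 : Integrable (fun o => f t o • h t o) ν := by
    refine (memLp_one_iff_integrable.1 (hu2.smul (hs t))).congr (.of_forall fun o => ?_)
    simp only [Pi.smul_apply', smul_smul, Real.mul_self_sqrt (hf0 t o)]
  have i2 : Integrable (fun o => f 0 o • h t o) ν := by
    refine (memLp_one_iff_integrable.1 (hv2.smul (hs 0))).congr (.of_forall fun o => ?_)
    simp only [Pi.smul_apply', smul_smul, Real.mul_self_sqrt (hf0 0 o)]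
  rw [hgint, hQf t, hQf 0, integral_withDensity_ofReal (hfm t) (hf0 t),
    integral_withDensity_ofReal (hfm 0) (hf0 0), ← integral_sub i1 i2, ← integral_smul,
    ← integral_sub (f := fun o => t⁻¹ • (f t o • h t o - f 0 o • h t o)) ((i1.sub i2).smul _) i3]
  -- Factor `f t - f 0` as a difference times a sum of roots, and write the difference over `t` as
  -- `r t + k / 2`. The `r t` parts vanish in L¹ by Cauchy–Schwarz; what remains splits into the
  -- change of the density and the change of the function.
  have e : (fun o => t⁻¹ • (f t o • h t o - f 0 o • h t o) - f 0 o • (g' o • h₀ o)) =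
      (((fun o => r t o • (√(f t o) • h t o)) + fun o => r t o • (√(f 0 o) • h t o))
        + (1 / 2 : ℝ) • fun o => k o • ((√(f t o) - √(f 0 o)) • h t o))
        + fun o => k o • (√(f 0 o) • (h t o - h₀ o)) := by
    ext1 o
    have h1 := Real.mul_self_sqrt (hf0 t o)
    have h2 := Real.mul_self_sqrt (hf0 0 o)
    simp only [Pi.add_apply, Pi.smul_apply, hrdef, hkdef]
    set a := √(f t o)
    set b := √(f 0 o)
    rw [← h1, ← h2]
    simp only [smul_smul, smul_sub, ← sub_smul, ← add_smul, sub_mul]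
    rw [add_sub_assoc', ← add_smul]
    congr 2
    · field_simp
      ring
    · ring
  rw [e]
  refine (enorm_integral_le_lintegral_enorm _).trans ?_
  rw [← eLpNorm_one_eq_lintegral_enorm]
  have m1 : Measurable fun o => r t o • (√(f t o) • h t o) := (hrm t).smul mu
  have m2 : Measurable fun o => r t o • (√(f 0 o) • h t o) := (hrm t).smul mv
  have m3 : Measurable fun o => k o • ((√(f t o) - √(f 0 o)) • h t o) :=
    hkm.smul (((hsm t).sub (hsm 0)).smul hmt)
  have m4 : Measurable fun o => k o • (√(f 0 o) • (h t o - h₀ o)) :=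
    hkm.smul ((hsm 0).smul (hmt.sub hm₀))
  refine (eLpNorm_add_le ((m1.add m2).add (m3.const_smul _)).aestronglyMeasurable
    m4.aestronglyMeasurable le_rfl).trans (add_le_add ?_ le_rfl)
  refine (eLpNorm_add_le (m1.add m2).aestronglyMeasurable
    (m3.const_smul _).aestronglyMeasurable le_rfl).trans (add_le_add ?_ ?_)
  · refine (eLpNorm_add_le m1.aestronglyMeasurable m2.aestronglyMeasurable le_rfl).trans
      (add_le_add ?_ ?_)
    · exact (eLpNorm_smul_le (hrm t).aestronglyMeasurable mu.aestronglyMeasurable).trans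
        (by gcongr)
    · exact (eLpNorm_smul_le (hrm t).aestronglyMeasurable mv.aestronglyMeasurable).trans
        (by gcongr)
  · rw [eLpNorm_const_smul]

/-- Along a path that is differentiable in quadratic mean, means of functions bounded in `L²`
converge uniformly. -/
theorem IsQMD.tendsto_integral [CompleteSpace E] {Q : ℝ → Measure O}
    [∀ t, IsProbabilityMeasure (Q t)]
    {g : O → ℝ} (hQ : IsQMD Q g) {h : ℝ → O → E} {C : ENNReal} (hC : C ≠ ⊤)
    (hm : ∀ᶠ t in 𝓝[≠] 0, Measurable (h t))
    (hb : ∀ᶠ t in 𝓝[≠] 0, eLpNorm (h t) 2 (Q t) ≤ C)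
    (hb' : ∀ᶠ t in 𝓝[≠] 0, eLpNorm (h t) 2 (Q 0) ≤ C) :
    Tendsto (fun t => ∫ o, h t o ∂(Q t) - ∫ o, h t o ∂(Q 0)) (𝓝[≠] 0) (𝓝 0) := by
  obtain ⟨ν, f, g', hfm, hf0, hQf, -, -, hs, -, -, hσ⟩ := hQ.exists_density
  have hT : Tendsto (fun t => eLpNorm (fun o => √(f t o) - √(f 0 o)) 2 ν * C
      + eLpNorm (fun o => √(f t o) - √(f 0 o)) 2 ν * C) (𝓝[≠] 0) (𝓝 (0 * C + 0 * C)) :=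
    (ENNReal.Tendsto.mul_const hσ (Or.inr hC)).add (ENNReal.Tendsto.mul_const hσ (Or.inr hC))
  rw [zero_mul, add_zero] at hT
  rw [tendsto_zero_iff_enorm_tendsto_zero]
  refine tendsto_of_tendsto_of_tendsto_of_le_of_le' tendsto_const_nhds hT
    (.of_forall fun _ => zero_le) ?_
  filter_upwards [hm, hb, hb'] with t hmt hbt hbt'
  have hu := hbt
  have hv := hbt'
  rw [hQf t, eLpNorm_withDensity (hfm t) (hf0 t) hmt] at hu
  rw [hQf 0, eLpNorm_withDensity (hfm 0) (hf0 0) hmt] at hv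
  have hsm : ∀ t, Measurable fun o => √(f t o) := fun t => (hfm t).sqrt
  have mu : Measurable fun o => √(f t o) • h t o := (hsm t).smul hmt
  have mv : Measurable fun o => √(f 0 o) • h t o := (hsm 0).smul hmt
  have md : Measurable fun o => √(f t o) - √(f 0 o) := (hsm t).sub (hsm 0)
  have hu2 : MemLp (fun o => √(f t o) • h t o) 2 ν := memLp_two_of_eLpNorm_le hC mu hu
  have hv2 : MemLp (fun o => √(f 0 o) • h t o) 2 ν := memLp_two_of_eLpNorm_le hC mv hv
  have i1 : Integrable (fun o => f t o • h t o) ν := by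
    refine (memLp_one_iff_integrable.1 (hu2.smul (hs t))).congr (.of_forall fun o => ?_)
    simp only [Pi.smul_apply', smul_smul, Real.mul_self_sqrt (hf0 t o)]
  have i2 : Integrable (fun o => f 0 o • h t o) ν := by
    refine (memLp_one_iff_integrable.1 (hv2.smul (hs 0))).congr (.of_forall fun o => ?_)
    simp only [Pi.smul_apply', smul_smul, Real.mul_self_sqrt (hf0 0 o)]
  rw [hQf t, hQf 0, integral_withDensity_ofReal (hfm t) (hf0 t),
    integral_withDensity_ofReal (hfm 0) (hf0 0), ← integral_sub i1 i2]
  have e : (fun o => f t o • h t o - f 0 o • h t o) =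
      (fun o => (√(f t o) - √(f 0 o)) • (√(f t o) • h t o))
        + fun o => (√(f t o) - √(f 0 o)) • (√(f 0 o) • h t o) := by
    ext1 o
    simp only [Pi.add_apply, smul_smul, ← add_smul, ← sub_smul]
    congr 1
    nlinarith [Real.mul_self_sqrt (hf0 t o), Real.mul_self_sqrt (hf0 0 o)]
  rw [e]
  refine (enorm_integral_le_lintegral_enorm _).trans ?_
  rw [← eLpNorm_one_eq_lintegral_enorm]
  refine (eLpNorm_add_le (md.smul mu).aestronglyMeasurable (md.smul mv).aestronglyMeasurable
    le_rfl).trans (add_le_add ?_ ?_)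
  · exact (eLpNorm_smul_le md.aestronglyMeasurable mu.aestronglyMeasurable).trans (by gcongr)
  · exact (eLpNorm_smul_le md.aestronglyMeasurable mv.aestronglyMeasurable).trans (by gcongr)

end QMD


/-! ### The population equation and its local inverse -/

section Equation

variable {O : Type*} [MeasurableSpace O] {P : Measure O} {q : ℕ} {Θ : Set (Vec q)}
  {f : Vec q → O → Vec q} {F : O → ℝ} {L : O → Vec q →L[ℝ] Vec q} {A : Vec q ≃L[ℝ] Vec q}
  {θ₀ : Vec q}

/-- The estimating functions `f θ`, with envelope `F` and derivative `L` at `θ₀`, identify `θ₀`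
in the compact set `Θ`, and the mean derivative `A` is invertible. -/
structure RegularEquation (P : Measure O) (Θ : Set (Vec q)) (f : Vec q → O → Vec q) (F : O → ℝ)
    (L : O → Vec q →L[ℝ] Vec q) (A : Vec q ≃L[ℝ] Vec q) (θ₀ : Vec q) : Prop where
  isCompact : IsCompact Θ
  mem_nhds : Θ ∈ 𝓝 θ₀
  measurable : ∀ θ ∈ Θ, Measurable (f θ)
  measurable_envelope : Measurable F
  integrable_envelope : Integrable F P
  norm_le_envelope : ∀ᵐ w ∂P, ∀ θ ∈ Θ, ‖f θ w‖ ≤ F w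
  continuousOn : ∀ᵐ w ∂P, ContinuousOn (fun θ => f θ w) Θ
  measurable_deriv : Measurable L
  integrable_deriv : Integrable L P
  integral_deriv : ∫ w, L w ∂P = A
  hasLinearization : HasLinearization P f L θ₀
  lintegral_sq_le : ∃ C : NNReal, ∀ θ ∈ Θ, ∫⁻ w, ‖f θ w‖ₑ ^ 2 ∂P ≤ C
  integral_eq_zero_iff : ∀ θ ∈ Θ, ∫ w, f θ w ∂P = 0 ↔ θ = θ₀

namespace RegularEquation

lemma mem (H : RegularEquation P Θ f F L A θ₀) : θ₀ ∈ Θ := mem_of_mem_nhds H.mem_nhds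

lemma integrable (H : RegularEquation P Θ f F L A θ₀) {θ : Vec q} (hθ : θ ∈ Θ) : Integrable (f θ) P :=
  H.integrable_envelope.mono' (H.measurable θ hθ).aestronglyMeasurable
    (H.norm_le_envelope.mono fun _ hw => hw θ hθ)

lemma memLp (H : RegularEquation P Θ f F L A θ₀) {θ : Vec q} (hθ : θ ∈ Θ) : MemLp (f θ) 2 P := by
  obtain ⟨C, hC⟩ := H.lintegral_sq_le
  exact (memLp_two_iff_lintegral (H.measurable θ hθ).aestronglyMeasurable).2
    ((hC θ hθ).trans_lt ENNReal.coe_lt_top)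

lemma hasLocalModulus (H : RegularEquation P Θ f F L A θ₀) : HasLocalModulus P Θ f :=
  hasLocalModulus_of_envelope H.measurable H.continuousOn H.integrable_envelope
    H.norm_le_envelope

lemma continuousOn_integral (H : RegularEquation P Θ f F L A θ₀) : ContinuousOn (fun θ => ∫ w, f θ w ∂P) Θ :=
  H.hasLocalModulus.continuousOn_integral fun _ => H.integrable

end RegularEquation

/-- The linearization compares two arbitrary points near θ₀, which yields strict differentiability,
as the inverse and implicit function theorems require. -/
lemma HasLinearization.hasStrictFDerivAt_integral (h : HasLinearization P f L θ₀)
    (hL : Integrable L P) (hi : ∀ᶠ θ in 𝓝 θ₀, Integrable (f θ) P) :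
    HasStrictFDerivAt (fun θ => ∫ w, f θ w ∂P) (∫ w, L w ∂P) θ₀ := by
  rw [hasStrictFDerivAt_iff_isLittleO, Asymptotics.isLittleO_iff]
  intro ε hε
  obtain ⟨δ, hδ, hb⟩ := h.integral hL hi hε
  filter_upwards [prod_mem_nhds (Metric.ball_mem_nhds θ₀ hδ) (Metric.ball_mem_nhds θ₀ hδ)]
    with z hz
  exact hb z.1 hz.1 z.2 hz.2

lemma RegularEquation.hasStrictFDerivAt (H : RegularEquation P Θ f F L A θ₀) :
    HasStrictFDerivAt (fun θ => ∫ w, f θ w ∂P) (A : Vec q →L[ℝ] Vec q) θ₀ := by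
  rw [← H.integral_deriv]
  exact H.hasLinearization.hasStrictFDerivAt_integral H.integrable_deriv
    (Filter.mem_of_superset H.mem_nhds fun _ => H.integrable)

/-- Away from its unique zero, a continuous function on a compact set is bounded below. -/
lemma exists_pos_le_norm {X G : Type*} [TopologicalSpace X] [NormedAddCommGroup G] {K : Set X}
    (hK : IsCompact K) {u : X → G} (hu : ContinuousOn u K) {x₀ : X}
    (hz : ∀ x ∈ K, u x = 0 → x = x₀) {U : Set X} (hU : U ∈ 𝓝 x₀) :
    ∃ c > 0, ∀ x ∈ K, x ∉ U → c ≤ ‖u x‖ := by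
  have hK' : IsCompact (K \ interior U) := hK.diff isOpen_interior
  rcases (K \ interior U).eq_empty_or_nonempty with h | h
  · exact ⟨1, one_pos, fun x hx hxU =>
      (h.subset ⟨hx, fun hi => hxU (interior_subset hi)⟩ : x ∈ (∅ : Set X)).elim⟩
  · obtain ⟨x, hx, hmin⟩ := hK'.exists_isMinOn h (hu.mono Set.sdiff_subset).norm
    refine ⟨‖u x‖, norm_pos_iff.2 fun h0 => hx.2 ?_, fun y hy hyU =>
      hmin ⟨hy, fun hi => hyU (interior_subset hi)⟩⟩
    rw [hz x hx.1 h0]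
    exact mem_interior_iff_mem_nhds.2 hU

lemma RegularEquation.tendsto_of_tendsto_integral (H : RegularEquation P Θ f F L A θ₀)
    {ι : Type*} {l : Filter ι} {ϑ : ι → Vec q} (hϑ : ∀ᶠ t in l, ϑ t ∈ Θ)
    (h : Tendsto (fun t => ∫ w, f (ϑ t) w ∂P) l (𝓝 0)) : Tendsto ϑ l (𝓝 θ₀) := by
  intro U hU
  obtain ⟨c, hc, hcU⟩ := exists_pos_le_norm H.isCompact H.continuousOn_integral
    (fun θ hθ => (H.integral_eq_zero_iff θ hθ).1) hU
  have : Tendsto (fun t => ‖∫ w, f (ϑ t) w ∂P‖) l (𝓝 0) := by simpa using h.norm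
  change ∀ᶠ t in l, ϑ t ∈ U
  filter_upwards [hϑ, this.eventually_lt_const hc] with t ht htc
  by_contra hn
  exact (hcU _ ht hn).not_gt htc

/-- Near θ₀ the path is the local inverse of the mean map applied to the mean along the path, so the
chain rule gives its derivative. -/
lemma RegularEquation.hasDerivAt_of_comp (H : RegularEquation P Θ f F L A θ₀)
    {ϑ : ℝ → Vec q} {v : Vec q} (h0 : ϑ 0 = θ₀) (hϑ : Tendsto ϑ (𝓝 0) (𝓝 θ₀))
    (h : HasDerivAt (fun t => ∫ w, f (ϑ t) w ∂P) v 0) : HasDerivAt ϑ (A.symm v) 0 := by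
  have h1 := H.hasStrictFDerivAt.to_localInverse.hasFDerivAt
  have h2 : HasDerivAt (fun t => H.hasStrictFDerivAt.localInverse _ _ _ (∫ w, f (ϑ t) w ∂P))
      (A.symm v) 0 := by
    exact HasFDerivAt.comp_hasDerivAt (0 : ℝ) (by simpa only [h0] using h1) h
  refine h2.congr_of_eventuallyEq ?_
  filter_upwards [hϑ.eventually H.hasStrictFDerivAt.eventually_left_inverse] with t ht
  exact ht.symm

end Equation

/-! ### Differentiability of the parameter and its gradient -/

section Gradient

variable {V : Type*} [MeasurableSpace V] {P : Measure (ℝ × V)} {p : ℝ}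
  {Pt : ℝ → Measure (ℝ × V)} {g : (ℝ × V) ⊕ V → ℝ}

lemma map_snd_isProbabilityMeasure {P : Measure (ℝ × V)} [IsProbabilityMeasure P] :
    IsProbabilityMeasure (P.map Prod.snd) :=
  Measure.isProbabilityMeasure_map measurable_snd.aemeasurable

/-- From x² ≤ C follows x ≤ 1 + C, a finite bound that avoids a square root in extended reals. -/
lemma eLpNorm_elim_zero_le {S T E : Type*} [MeasurableSpace S] [MeasurableSpace T]
    [NormedAddCommGroup E] [NormedSpace ℝ E] {P : Measure S} {Q : Measure T}
    (hp : p ∈ Set.Ioo (0 : ℝ) 1) {f : S → E} {C : NNReal} (h : ∫⁻ w, ‖f w‖ₑ ^ 2 ∂P ≤ C) :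
    eLpNorm (Sum.elim f (fun _ => 0) : S ⊕ T → E) 2 (mixLaw p P Q) ≤ (1 + C : NNReal) := by
  set x := eLpNorm (Sum.elim f (fun _ => 0) : S ⊕ T → E) 2 (mixLaw p P Q) with hx
  have h1 : x ^ 2 ≤ C := by
    rw [hx, eLpNorm_two_sq, lintegral_mixLaw]
    simp only [Sum.elim_inl, Sum.elim_inr, enorm_zero, ne_eq, OfNat.ofNat_ne_zero,
      not_false_eq_true, zero_pow, lintegral_zero, mul_zero, add_zero]
    calc _ ≤ 1 * ∫⁻ w, ‖f w‖ₑ ^ 2 ∂P := by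
          gcongr
          exact ENNReal.ofReal_le_one.2 hp.2.le
      _ ≤ C := by rwa [one_mul]
  push_cast
  rcases le_total x 1 with hx1 | hx1
  · exact hx1.trans le_self_add
  · calc x = x * 1 := (mul_one x).symm
      _ ≤ x * x := by gcongr
      _ ≤ C := by rwa [← pow_two]
      _ ≤ 1 + C := le_add_self

/-- The observed-data function that compares `k` of the covariates between the two kinds of
observations; its mean vanishes under every law of the full data. -/
noncomputable def contrast {E : Type*} [NormedAddCommGroup E] [NormedSpace ℝ E] (p : ℝ)
    (k : V → E) : (ℝ × V) ⊕ V → E :=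
  Sum.elim (fun w => -(1 / p) • k w.2) (fun v => (1 / (1 - p)) • k v)

variable {E : Type*} [NormedAddCommGroup E] [NormedSpace ℝ E]

lemma integral_contrast [IsProbabilityMeasure P] (hp : p ∈ Set.Ioo (0 : ℝ) 1) {k : V → E}
    (hk : Integrable k (P.map Prod.snd)) :
    ∫ o, contrast p k o ∂(mixLaw p P (P.map Prod.snd)) = 0 := by
  have hp0 := hp.1.ne'
  have hp1 : 1 - p ≠ 0 := by linarith [hp.2]
  have h1 : Integrable (contrast p k) (mixLaw p P (P.map Prod.snd)) :=
    (integrable_mixLaw_iff hp).2 ⟨(integrable_comp_snd hk).smul _, hk.smul _⟩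
  rw [integral_mixLaw hp h1]
  simp only [contrast, Sum.elim_inl, Sum.elim_inr]
  rw [integral_smul, integral_smul, integral_comp_snd hk, smul_smul, smul_smul, ← add_smul]
  have : p * -(1 / p) + (1 - p) * (1 / (1 - p)) = 0 := by field_simp; ring
  rw [this, zero_smul]

variable [MeasurableSpace E] [BorelSpace E] [SecondCountableTopology E]

lemma measurable_contrast {k : V → E} (hk : Measurable k) : Measurable (contrast p k) := by
  refine measurable_fun_sum (f := contrast p k) ?_ ?_
  · exact Measurable.fun_const_smul (hk.comp measurable_snd) _
  · exact Measurable.fun_const_smul hk _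

variable [CompleteSpace E]

/-- An observed-data score is uncorrelated with bounded contrasts. -/
lemma integral_score_contrast_of_bounded [∀ t, IsProbabilityMeasure (Pt t)]
    (hp : p ∈ Set.Ioo (0 : ℝ) 1)
    (hg : IsQMD (fun t => mixLaw p (Pt t) ((Pt t).map Prod.snd)) g) {k : V → E}
    (hk : Measurable k) {M : ℝ} (hM : ∀ v, ‖k v‖ ≤ M) :
    ∫ o, g o • contrast p k o ∂(mixLaw p (Pt 0) ((Pt 0).map Prod.snd)) = 0 := by
  have i1 : ∀ t, IsProbabilityMeasure ((Pt t).map Prod.snd) := fun t =>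
    map_snd_isProbabilityMeasure
  have i2 : ∀ t, IsProbabilityMeasure (mixLaw p (Pt t) ((Pt t).map Prod.snd)) := fun t =>
    isProbabilityMeasure_mixLaw hp
  set C : ℝ := (1 / p) * M + (1 / (1 - p)) * M
  have hp0 := hp.1
  have hp1 : 0 < 1 - p := by linarith [hp.2]
  have hC : ∀ o, ‖contrast p k o‖ ≤ C := by
    rintro (⟨y, v⟩ | v)
    · have := hM v
      have h0 : 0 ≤ M := (norm_nonneg _).trans this
      rw [contrast, Sum.elim_inl, norm_smul, norm_neg, Real.norm_of_nonneg (by positivity)]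
      have : 0 ≤ (1 / (1 - p)) * M := by positivity
      have : (1 / p) * ‖k v‖ ≤ (1 / p) * M := by gcongr
      simp only [C]
      linarith
    · have := hM v
      have h0 : 0 ≤ M := (norm_nonneg _).trans this
      rw [contrast, Sum.elim_inr, norm_smul, Real.norm_of_nonneg (by positivity)]
      have : 0 ≤ (1 / p) * M := by positivity
      have : (1 / (1 - p)) * ‖k v‖ ≤ (1 / (1 - p)) * M := by gcongr
      simp only [C]
      linarith
  have hb : ∀ t, eLpNorm (contrast p k) 2 (mixLaw p (Pt t) ((Pt t).map Prod.snd))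
      ≤ ENNReal.ofReal C := fun t => by
    refine (eLpNorm_le_of_ae_bound (.of_forall hC)).trans ?_
    simp
  -- A constant family: its mean is zero along the whole path, so the limit of difference quotients,
  -- which is the pairing with the score, is zero.
  have key := hg.tendsto_integral_sub (h := fun _ => contrast p k) (h₀ := contrast p k)
    (C := ENNReal.ofReal C) ENNReal.ofReal_ne_top (.of_forall fun _ => measurable_contrast hk)
    (measurable_contrast hk) (.of_forall hb) (.of_forall fun _ => hb 0) (hb 0)
    (F := fun _ => C) measurable_const (.of_forall fun _ => .of_forall hC) (.of_forall hC)
    (.of_forall fun _ => tendsto_const_nhds)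
  have hki : ∀ t, Integrable k ((Pt t).map Prod.snd) := fun t =>
    (integrable_const M).mono' hk.aestronglyMeasurable (.of_forall hM)
  simp only [integral_contrast hp (hki _), sub_self, smul_zero] at key
  exact tendsto_nhds_unique key tendsto_const_nhds

/-- Square integrability of `k` is assumed only at `t = 0`, so the path argument is run on
truncations and the limit is taken by dominated convergence under the base law. -/
lemma integral_score_contrast [∀ t, IsProbabilityMeasure (Pt t)]
    (hp : p ∈ Set.Ioo (0 : ℝ) 1)
    (hg : IsQMD (fun t => mixLaw p (Pt t) ((Pt t).map Prod.snd)) g) {k : V → E}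
    (hk : Measurable k) (hk2 : MemLp k 2 ((Pt 0).map Prod.snd)) :
    ∫ o, g o • contrast p k o ∂(mixLaw p (Pt 0) ((Pt 0).map Prod.snd)) = 0 := by
  have hg2 : MemLp g 2 (mixLaw p (Pt 0) ((Pt 0).map Prod.snd)) := hg.choose_spec.choose_spec.2.2.2.2.1
  have hc2 : MemLp (contrast p k) 2 (mixLaw p (Pt 0) ((Pt 0).map Prod.snd)) :=
    (memLp_two_mixLaw_iff hp).2
      ⟨(hk2.comp_of_map measurable_snd.aemeasurable).const_smul (-(1 / p)),
        hk2.const_smul (1 / (1 - p))⟩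
  have hi : Integrable (fun o => g o • contrast p k o)
      (mixLaw p (Pt 0) ((Pt 0).map Prod.snd)) := integrable_smul_of_memLp_two hg2 hc2
  have hT : Tendsto (fun M : ℕ => ∫ o, g o • contrast p ({v | ‖k v‖ ≤ M}.indicator k) o
      ∂(mixLaw p (Pt 0) ((Pt 0).map Prod.snd))) atTop
      (𝓝 (∫ o, g o • contrast p k o ∂(mixLaw p (Pt 0) ((Pt 0).map Prod.snd)))) := by
    have hind : ∀ (M : ℕ) v, ‖{v | ‖k v‖ ≤ M}.indicator k v‖ ≤ ‖k v‖ := fun M v =>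
      norm_indicator_le_norm_self _ _
    have hev : ∀ v, ∀ᶠ M : ℕ in atTop, {v | ‖k v‖ ≤ M}.indicator k v = k v := fun v => by
      filter_upwards [eventually_ge_atTop ⌈‖k v‖⌉₊] with M hM
      exact Set.indicator_of_mem (show v ∈ {v | ‖k v‖ ≤ M} from Nat.ceil_le.1 hM) _
    refine tendsto_integral_of_dominated_convergence (fun o => ‖g o • contrast p k o‖) ?_ hi.norm
      ?_ ?_
    · exact fun M => hg2.1.smul (measurable_contrast
        (hk.indicator (measurableSet_le hk.norm measurable_const))).aestronglyMeasurable
    · refine fun M => .of_forall fun o => ?_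
      rw [norm_smul, norm_smul]
      refine mul_le_mul_of_nonneg_left ?_ (norm_nonneg _)
      rcases o with w | v <;> simp only [contrast, Sum.elim_inl, Sum.elim_inr, norm_smul] <;>
        exact mul_le_mul_of_nonneg_left (hind M _) (norm_nonneg _)
    · refine .of_forall fun o => tendsto_const_nhds.congr' ?_
      rcases o with w | v
      · filter_upwards [hev w.2] with M hM
        simp only [contrast, Sum.elim_inl, hM]
      · filter_upwards [hev v] with M hM
        simp only [contrast, Sum.elim_inr, hM]
  refine tendsto_nhds_unique hT (tendsto_const_nhds.congr fun M => ?_)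
  refine (integral_score_contrast_of_bounded hp hg
    (hk.indicator (measurableSet_le hk.norm measurable_const)) (M := M) fun v => ?_).symm
  by_cases hv : ‖k v‖ ≤ M
  · rwa [Set.indicator_of_mem (show v ∈ {v | ‖k v‖ ≤ M} from hv)]
  · rw [Set.indicator_of_notMem (show v ∉ {v | ‖k v‖ ≤ M} from hv), norm_zero]
    positivity

/-- The decomposition behind the gradient formula: the second summand is orthogonal to every score,
so augmentation leaves pairings with scores unchanged. -/
lemma obsLift_eq_add_contrast [IsFiniteMeasure P] (hp : p ∈ Set.Ioo (0 : ℝ) 1) (f : ℝ × V → E)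
    (o : (ℝ × V) ⊕ V) : obsLift p P f o = (1 / p) • Sum.elim f (fun _ => 0) o
      + (1 - p) • contrast p (condAvg P f) o := by
  have hp0 := hp.1.ne'
  have hp1 : 1 - p ≠ 0 := by linarith [hp.2]
  rcases o with w | v
  · simp only [obsLift, Sum.elim_inl, contrast]
    match_scalars <;> field_simp
    ring
  · simp only [obsLift, Sum.elim_inr, contrast, smul_zero, zero_add, smul_smul]
    rw [mul_one_div_cancel hp1, one_smul]

variable {q : ℕ} {Θ : Set (Vec q)}
  {f : Vec q → ℝ × V → Vec q} {F : ℝ × V → ℝ} {L : ℝ × V → Vec q →L[ℝ] Vec q}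
  {A : Vec q ≃L[ℝ] Vec q} {θ₀ : Vec q}

/-- The correlation of a score with an augmented weighted function. -/
lemma integral_score_obsLift [∀ t, IsProbabilityMeasure (Pt t)]
    (hp : p ∈ Set.Ioo (0 : ℝ) 1)
    (hg : IsQMD (fun t => mixLaw p (Pt t) ((Pt t).map Prod.snd)) g) {f : ℝ × V → E}
    (hf : Measurable f) (hf2 : MemLp f 2 (Pt 0)) {T : E ≃L[ℝ] E} :
    ∫ o, g o • -T (obsLift p (Pt 0) f o) ∂(mixLaw p (Pt 0) ((Pt 0).map Prod.snd)) =
      T (-(1 / p) • ∫ o, g o • (Sum.elim f (fun _ => 0) o : E)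
        ∂(mixLaw p (Pt 0) ((Pt 0).map Prod.snd))) := by
  set ν := mixLaw p (Pt 0) ((Pt 0).map Prod.snd) with hν
  have hg2 : MemLp g 2 ν := hg.choose_spec.choose_spec.2.2.2.2.1
  have hc2 := memLp_condAvg hf hf2
  have hcs : MemLp (contrast p (condAvg (Pt 0) f)) 2 ν :=
    (memLp_two_mixLaw_iff hp).2
      ⟨(hc2.comp_of_map measurable_snd.aemeasurable).const_smul (-(1 / p)),
        hc2.const_smul (1 / (1 - p))⟩
  have hes : MemLp (Sum.elim f (fun _ => 0)) 2 ν :=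
    (memLp_two_mixLaw_iff hp).2 ⟨hf2, MemLp.zero⟩
  have hi1 : Integrable (fun o => -(1 / p) • (g o • (Sum.elim f (fun _ => 0) o : E))) ν :=
    (integrable_smul_of_memLp_two hg2 hes).smul (-(1 / p))
  have hi2 : Integrable (fun o => -(1 - p) • (g o • contrast p (condAvg (Pt 0) f) o)) ν :=
    (integrable_smul_of_memLp_two hg2 hcs).smul (-(1 - p))
  have e2 : ∀ o, g o • -T (obsLift p (Pt 0) f o) =
      T (-(1 / p) • (g o • (Sum.elim f (fun _ => 0) o : E))
      + -(1 - p) • (g o • contrast p (condAvg (Pt 0) f) o)) := fun o => by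
    rw [obsLift_eq_add_contrast hp, ← map_neg, ← map_smul]
    congr 1
    module
  simp only [e2]
  rw [ContinuousLinearEquiv.integral_comp_comm, integral_add hi1 hi2, integral_smul, integral_smul,
    integral_score_contrast hp hg (measurable_condAvg hf) hc2, smul_zero, add_zero]


/-- The parameter defined by a regular equation is differentiable along submodels that are
differentiable in quadratic mean, with gradient `-A⁻¹ (obsLift f θ₀)`. -/
theorem RegularEquation.hasDerivAt [IsProbabilityMeasure P] (H : RegularEquation P Θ f F L A θ₀)
    [∀ t, IsProbabilityMeasure (Pt t)] (hp : p ∈ Set.Ioo (0 : ℝ) 1) (h0 : Pt 0 = P)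
    (hg : IsQMD (fun t => mixLaw p (Pt t) ((Pt t).map Prod.snd)) g)
    {C : NNReal} (hC : ∀ᶠ t in 𝓝 (0 : ℝ), ∀ θ ∈ Θ, ∫⁻ w, ‖f θ w‖ₑ ^ 2 ∂(Pt t) ≤ C)
    {ϑ : ℝ → Vec q} (hϑ : ∀ᶠ t in 𝓝 (0 : ℝ), ϑ t ∈ Θ ∧ ∫ w, f (ϑ t) w ∂(Pt t) = 0) :
    HasDerivAt ϑ (∫ o, g o • -A.symm (obsLift p P (f θ₀) o)
      ∂(mixLaw p P (P.map Prod.snd))) 0 := by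
  subst h0
  set ν := mixLaw p (Pt 0) ((Pt 0).map Prod.snd) with hν
  have i1 : ∀ t, IsProbabilityMeasure ((Pt t).map Prod.snd) := fun t =>
    map_snd_isProbabilityMeasure
  have i2 : ∀ t, IsProbabilityMeasure (mixLaw p (Pt t) ((Pt t).map Prod.snd)) := fun t =>
    isProbabilityMeasure_mixLaw hp
  have hp0 := hp.1
  have hϑ0 : ϑ 0 = θ₀ :=
    (H.integral_eq_zero_iff _ hϑ.self_of_nhds.1).1 hϑ.self_of_nhds.2
  have hC0 := hC.self_of_nhds
  have hϑ' := hϑ.filter_mono (nhdsWithin_le_nhds (s := {0}ᶜ))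
  have hC' := hC.filter_mono (nhdsWithin_le_nhds (s := {0}ᶜ))
  -- Extension by zero to unlabeled points makes observed-data means `p` times full-data means, so
  -- the known differentiability of the observed laws can be used.
  set h : ℝ → (ℝ × V) ⊕ V → Vec q := fun t => Sum.elim (f (ϑ t)) (fun _ => 0) with hh
  set h₀ : (ℝ × V) ⊕ V → Vec q := Sum.elim (f θ₀) (fun _ => 0) with hh₀
  have hmeas : ∀ θ ∈ Θ, Measurable (Sum.elim (f θ) (fun _ => 0) : (ℝ × V) ⊕ V → Vec q) :=
    fun θ hθ => (H.measurable θ hθ).sumElim measurable_const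
  have hm : ∀ᶠ t in 𝓝[≠] (0 : ℝ), Measurable (h t) := hϑ'.mono fun t ht => hmeas _ ht.1
  have hb : ∀ᶠ t in 𝓝[≠] (0 : ℝ), eLpNorm (h t) 2 (mixLaw p (Pt t) ((Pt t).map Prod.snd))
      ≤ (1 + C : NNReal) := by
    filter_upwards [hϑ', hC'] with t ht hCt
    exact eLpNorm_elim_zero_le hp (hCt _ ht.1)
  have hb' : ∀ᶠ t in 𝓝[≠] (0 : ℝ), eLpNorm (h t) 2 ν ≤ (1 + C : NNReal) := by
    filter_upwards [hϑ'] with t ht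
    exact eLpNorm_elim_zero_le hp (hC0 _ ht.1)
  have hb₀ : eLpNorm h₀ 2 ν ≤ (1 + C : NNReal) := eLpNorm_elim_zero_le hp (hC0 _ H.mem)
  -- The mean under `Pt t` is zero by definition of `ϑ t`, so changing the law alone recovers the
  -- base mean at `ϑ t`.
  have e1 : ∀ᶠ t in 𝓝[≠] (0 : ℝ), ∫ o, h t o ∂(mixLaw p (Pt t) ((Pt t).map Prod.snd))
      - ∫ o, h t o ∂ν = -p • ∫ w, f (ϑ t) w ∂(Pt 0) := by
    filter_upwards [hϑ', hm, hb, hb'] with t ht hmt hbt hbt'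
    have j1 : Integrable (h t) (mixLaw p (Pt t) ((Pt t).map Prod.snd)) :=
      MemLp.integrable (q := 2) (by norm_num)
        ⟨hmt.aestronglyMeasurable, hbt.trans_lt ENNReal.coe_lt_top⟩
    have j2 : Integrable (h t) ν := MemLp.integrable (q := 2) (by norm_num)
        ⟨hmt.aestronglyMeasurable, hbt'.trans_lt ENNReal.coe_lt_top⟩
    rw [integral_mixLaw hp j1, hν, integral_mixLaw hp j2]
    simp [hh, ht.2]
  have hΨ : Tendsto (fun t => ∫ w, f (ϑ t) w ∂(Pt 0)) (𝓝[≠] 0) (𝓝 0) := by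
    have := (hg.tendsto_integral ENNReal.coe_ne_top hm hb hb').congr' e1
    have := this.const_smul (-(1 / p))
    rw [smul_zero] at this
    refine this.congr fun t => ?_
    rw [smul_smul, neg_mul_neg, one_div_mul_cancel hp0.ne', one_smul]
  have hlim' : Tendsto ϑ (𝓝[≠] 0) (𝓝 θ₀) :=
    H.tendsto_of_tendsto_integral (hϑ'.mono fun t ht => ht.1) hΨ
  have hlim : Tendsto ϑ (𝓝 0) (𝓝 θ₀) := by
    rw [← hϑ0] at hlim' ⊢
    exact continuousAt_iff_punctured_nhds.2 hlim'
  have hder : HasDerivAt (fun t => ∫ w, f (ϑ t) w ∂(Pt 0))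
      (-(1 / p) • ∫ o, g o • h₀ o ∂ν) 0 := by
    rw [hasDerivAt_iff_tendsto_slope_zero]
    have key := hg.tendsto_integral_sub (h := h) (h₀ := h₀) ENNReal.coe_ne_top hm (hmeas _ H.mem)
      hb hb' hb₀ (F := Sum.elim F (fun _ => 0)) (H.measurable_envelope.sumElim measurable_const)
      (by
        filter_upwards [hϑ'] with t ht
        exact (ae_mixLaw_iff hp).2 ⟨H.norm_le_envelope.mono fun w hw => hw _ ht.1,
          .of_forall fun v => by simp [hh]⟩)
      ((ae_mixLaw_iff hp).2 ⟨H.norm_le_envelope.mono fun w hw => hw _ H.mem,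
          .of_forall fun v => by simp [hh₀]⟩)
      ((ae_mixLaw_iff hp).2 ⟨H.continuousOn.mono fun w hw =>
          ((hw.continuousAt H.mem_nhds).tendsto.comp hlim'),
          .of_forall fun v => tendsto_const_nhds⟩)
    have := key.const_smul (-(1 / p))
    refine this.congr' ?_
    filter_upwards [e1] with t ht
    rw [ht, zero_add, hϑ0, (H.integral_eq_zero_iff θ₀ H.mem).2 rfl, sub_zero, smul_comm,
      smul_smul (-(1 / p)), neg_mul_neg, one_div_mul_cancel hp0.ne', one_smul]
  have hfin := H.hasDerivAt_of_comp hϑ0 hlim hder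
  rwa [← integral_score_obsLift hp hg (H.measurable _ H.mem) (H.memLp H.mem)] at hfin

end Gradient


/-! ### Bounded linear tilts of a law -/

section Tilt

variable {O : Type*} [MeasurableSpace O] {ν : Measure O} {s : O → ℝ} {M : ℝ}

/-- The path through `ν` in direction `s`, frozen when it would leave the positive densities. -/
noncomputable def tilt (ν : Measure O) (s : O → ℝ) (M : ℝ) (t : ℝ) : Measure O :=
  ν.withDensity fun o => ENNReal.ofReal (1 + (if |t| * M ≤ 1 / 2 then t else 0) * s o)

lemma abs_tilt_le (hM : ∀ o, |s o| ≤ M) (t : ℝ) (o : O) :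
    |(if |t| * M ≤ 1 / 2 then t else 0) * s o| ≤ 1 / 2 := by
  split_ifs with h
  · rw [abs_mul]
    exact (mul_le_mul_of_nonneg_left (hM o) (abs_nonneg t)).trans h
  · simp

lemma tilt_zero : tilt ν s M 0 = ν := by
  simp [tilt]

lemma eventually_tilt_small (M : ℝ) : ∀ᶠ t : ℝ in 𝓝 0, |t| * M ≤ 1 / 2 := by
  have : Tendsto (fun t : ℝ => |t| * M) (𝓝 0) (𝓝 (|0| * M)) :=
    (continuous_abs.mul continuous_const).continuousAt
  simp only [abs_zero, zero_mul] at this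
  filter_upwards [this.eventually_lt_const (show (0 : ℝ) < 1 / 2 by norm_num)] with t ht
  exact ht.le

lemma tilt_le (hM : ∀ o, |s o| ≤ M) (t : ℝ) : tilt ν s M t ≤ (2 : ENNReal) • ν := by
  rw [← withDensity_const]
  refine withDensity_mono (.of_forall fun o => ?_)
  rw [← ENNReal.ofReal_ofNat 2]
  exact ENNReal.ofReal_le_ofReal (by linarith [(abs_le.1 (abs_tilt_le hM t o)).2])

lemma lintegral_ofReal_one_add [IsProbabilityMeasure ν] (hs : Integrable s ν) {c : ℝ}
    (hc : ∀ o, |c * s o| ≤ 1 / 2) :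
    ∫⁻ o, ENNReal.ofReal (1 + c * s o) ∂ν = ENNReal.ofReal (1 + c * ∫ o, s o ∂ν) := by
  rw [← ofReal_integral_eq_lintegral_ofReal (f := fun o => 1 + c * s o)
      ((integrable_const 1).add (hs.const_mul c))
      (.of_forall fun o => ?_), integral_add (integrable_const 1) (hs.const_mul c),
    integral_const_mul]
  · simp
  · have := (abs_le.1 (hc o)).1
    simp only [Pi.zero_apply]
    linarith

lemma isProbabilityMeasure_tilt [IsProbabilityMeasure ν] (hs : Measurable s)
    (hM : ∀ o, |s o| ≤ M) (h0 : ∫ o, s o ∂ν = 0) (t : ℝ) :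
    IsProbabilityMeasure (tilt ν s M t) := by
  constructor
  have hsi : Integrable s ν := (integrable_const M).mono' hs.aestronglyMeasurable (.of_forall hM)
  rw [tilt, withDensity_apply _ MeasurableSet.univ, setLIntegral_univ,
    lintegral_ofReal_one_add hsi (abs_tilt_le hM t), h0]
  simp

lemma integral_tilt {E : Type*} [NormedAddCommGroup E] [NormedSpace ℝ E] (hs : Measurable s)
    (hM : ∀ o, |s o| ≤ M) {t : ℝ} (ht : |t| * M ≤ 1 / 2) {f : O → E}
    (hf : Integrable f ν) :
    ∫ o, f o ∂(tilt ν s M t) = ∫ o, f o ∂ν + t • ∫ o, s o • f o ∂ν := by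
  have hsf : Integrable (fun o => s o • f o) ν :=
    hf.bdd_smul M hs.aestronglyMeasurable (.of_forall hM)
  have hb := abs_tilt_le hM t
  simp only [if_pos ht] at hb
  simp only [tilt, if_pos ht]
  rw [integral_withDensity_ofReal ((hs.const_mul t).const_add 1)
    (fun o => by linarith [(abs_le.1 (hb o)).1]), ← integral_smul,
    ← integral_add (g := fun o => t • (s o • f o)) hf (hsf.smul t)]
  refine integral_congr_ae (.of_forall fun o => ?_)
  simp only [add_smul, one_smul, mul_smul]

/-- With r = √(1+u), the left side is (r-1)²/2 and the right side is (r-1)²(r+1)²/2. -/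
lemma abs_sqrt_one_add_sub_le {u : ℝ} (hu : |u| ≤ 1 / 2) : |√(1 + u) - 1 - u / 2| ≤ u ^ 2 / 2 := by
  have h1 : 0 ≤ 1 + u := by linarith [(abs_le.1 hu).1]
  have h2 := Real.sq_sqrt h1
  have h3 := Real.sqrt_nonneg (1 + u)
  set r := √(1 + u)
  have h4 : u = r ^ 2 - 1 := by linarith
  rw [abs_le, h4]
  constructor
  · nlinarith [sq_nonneg (r - 1), mul_nonneg (sq_nonneg (r - 1)) h3,
      mul_nonneg (mul_nonneg (sq_nonneg (r - 1)) h3) h3]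
  · nlinarith [sq_nonneg (r - 1), sq_nonneg (r ^ 2 - 1)]

lemma isQMD_tilt [IsProbabilityMeasure ν] (hs : Measurable s) (hM : ∀ o, |s o| ≤ M)
    : IsQMD (tilt ν s M) s := by
  refine ⟨ν, fun t o => 1 + (if |t| * M ≤ 1 / 2 then t else 0) * s o, inferInstance,
    fun t => (hs.const_mul _).const_add 1,
    fun t o => by linarith [(abs_le.1 (abs_tilt_le hM t o)).1], fun t => rfl, ?_, ?_⟩
  · rw [tilt_zero]
    exact MemLp.of_bound hs.aestronglyMeasurable M (.of_forall hM)
  · have hT : Tendsto (fun t : ℝ => ENNReal.ofReal (|t| * (M ^ 2 / 2))) (𝓝[≠] 0) (𝓝 0) := by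
      have : Tendsto (fun t : ℝ => |t| * (M ^ 2 / 2)) (𝓝 0) (𝓝 (|0| * (M ^ 2 / 2))) :=
        (continuous_abs.mul continuous_const).continuousAt
      have h := (ENNReal.continuous_ofReal.tendsto _).comp
        (this.mono_left (nhdsWithin_le_nhds (s := {0}ᶜ)))
      rwa [abs_zero, zero_mul, ENNReal.ofReal_zero] at h
    refine tendsto_of_tendsto_of_tendsto_of_le_of_le' tendsto_const_nhds hT
      (.of_forall fun _ => zero_le) ?_
    filter_upwards [(eventually_tilt_small M).filter_mono nhdsWithin_le_nhds,
      self_mem_nhdsWithin] with t ht ht0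
    refine (eLpNorm_le_of_ae_bound (C := |t| * (M ^ 2 / 2)) (.of_forall fun o => ?_)).trans
      (by simp)
    have hb := abs_tilt_le hM t o
    have ht0' : t ≠ 0 := ht0
    simp only [if_pos ht] at hb
    simp only [if_pos ht, abs_zero, zero_mul, ite_self, add_zero, Real.sqrt_one, mul_one]
    have h1 := abs_sqrt_one_add_sub_le hb
    have e : (√(1 + t * s o) - 1) / t - 1 / 2 * s o = (√(1 + t * s o) - 1 - t * s o / 2) / t := by
      field_simp
    rw [e, Real.norm_eq_abs, abs_div, div_le_iff₀ (abs_pos.2 ht0')]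
    refine h1.trans ?_
    have h2 : s o ^ 2 ≤ M ^ 2 := by rw [← sq_abs]; gcongr; exact hM o
    calc (t * s o) ^ 2 / 2 = |t| * (s o ^ 2 / 2) * |t| := by rw [mul_pow, ← sq_abs t]; ring
      _ ≤ _ := by gcongr

end Tilt

/-! ### Observed-data laws and scores of tilts -/

section ObservedTilt

variable {V : Type*} [MeasurableSpace V] {P : Measure (ℝ × V)} [IsProbabilityMeasure P] {p : ℝ}
  {a : ℝ × V → ℝ} {M : ℝ}

/-- The observed-data score that the full-data score `a` induces. -/
noncomputable def obsScore (P : Measure (ℝ × V)) [IsFiniteMeasure P] (a : ℝ × V → ℝ) :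
    (ℝ × V) ⊕ V → ℝ :=
  Sum.elim a (condAvg P a)

lemma measurable_obsScore (ha : Measurable a) : Measurable (obsScore P a) :=
  ha.sumElim (measurable_condAvg ha)

lemma abs_condAvg_le (hM : ∀ w, |a w| ≤ M) (v : V) : |condAvg P a v| ≤ M := by
  have := norm_integral_le_of_norm_le_const (C := M) (f := fun y => a (y, v))
    (μ := condDistrib (fun w : ℝ × V => w.1) (fun w : ℝ × V => w.2) P v)
    (.of_forall fun y => hM (y, v))
  simpa [condAvg] using this

lemma abs_obsScore_le (hM : ∀ w, |a w| ≤ M) (o : (ℝ × V) ⊕ V) : |obsScore P a o| ≤ M := by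
  rcases o with w | v
  · exact hM w
  · exact abs_condAvg_le hM v

/-- Averaging the density over the outcome replaces `a` by its conditional mean. The bound keeps the
density positive, so `ENNReal.ofReal` commutes with this averaging at every covariate value. -/
lemma map_snd_tilt (ha : Measurable a) (hM : ∀ w, |a w| ≤ M) (t : ℝ) :
    (tilt P a M t).map Prod.snd = tilt (P.map Prod.snd) (condAvg P a) M t := by
  ext B hB
  have hpos := abs_tilt_le hM t
  set c := if |t| * M ≤ 1 / 2 then t else 0 with hc
  have hBm : MeasurableSet (Prod.snd ⁻¹' B : Set (ℝ × V)) := measurable_snd hB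
  rw [Measure.map_apply measurable_snd hB, tilt, tilt, withDensity_apply _ hBm,
    withDensity_apply _ hB, ← lintegral_indicator hBm, ← lintegral_indicator hB, ← hc,
    ← lintegral_condDistrib (P := P) ((by fun_prop : Measurable fun w =>
      ENNReal.ofReal (1 + c * a w)).indicator hBm)]
  refine lintegral_congr fun v => ?_
  by_cases hv : v ∈ B
  · have e : ∀ y : ℝ, (Prod.snd ⁻¹' B : Set (ℝ × V)).indicator
        (fun w => ENNReal.ofReal (1 + c * a w)) (y, v) = ENNReal.ofReal (1 + c * a (y, v)) :=
      fun y => Set.indicator_of_mem (show (y, v) ∈ (Prod.snd ⁻¹' B : Set (ℝ × V)) from hv) _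
    have hai : Integrable (fun y => a (y, v))
        (condDistrib (fun w : ℝ × V => w.1) (fun w : ℝ × V => w.2) P v) :=
      (integrable_const M).mono' (ha.comp measurable_prodMk_right).aestronglyMeasurable
        (.of_forall fun y => hM (y, v))
    rw [Set.indicator_of_mem hv]
    simp only [e]
    exact lintegral_ofReal_one_add hai fun y => hpos (y, v)
  · have e : ∀ y : ℝ, (Prod.snd ⁻¹' B : Set (ℝ × V)).indicator
        (fun w => ENNReal.ofReal (1 + c * a w)) (y, v) = 0 :=
      fun y => Set.indicator_of_notMem (show (y, v) ∉ (Prod.snd ⁻¹' B : Set (ℝ × V)) from hv) _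
    rw [Set.indicator_of_notMem hv]
    simp only [e, lintegral_zero]

lemma mixLaw_withDensity {S T : Type*} [MeasurableSpace S] [MeasurableSpace T] {P : Measure S}
    {Q : Measure T} {h : S ⊕ T → ENNReal} (hh : Measurable h) :
    (mixLaw p P Q).withDensity h = mixLaw p (P.withDensity fun w => h (Sum.inl w))
      (Q.withDensity fun v => h (Sum.inr v)) := by
  ext B hB
  have hi : Measurable (B.indicator (1 : S ⊕ T → ENNReal)) := measurable_one.indicator hB
  rw [← lintegral_indicator_one hB, ← lintegral_indicator_one hB,
    lintegral_withDensity_eq_lintegral_mul _ hh hi, lintegral_mixLaw, lintegral_mixLaw,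
    lintegral_withDensity_eq_lintegral_mul P (f := fun w => h (Sum.inl w))
      (g := fun w => B.indicator 1 (Sum.inl w)) (hh.comp measurable_inl) (hi.comp measurable_inl),
    lintegral_withDensity_eq_lintegral_mul Q (f := fun v => h (Sum.inr v))
      (g := fun v => B.indicator 1 (Sum.inr v)) (hh.comp measurable_inr) (hi.comp measurable_inr)]
  rfl

lemma mixLaw_tilt (ha : Measurable a) (hM : ∀ w, |a w| ≤ M) (t : ℝ) :
    mixLaw p (tilt P a M t) ((tilt P a M t).map Prod.snd) =
      tilt (mixLaw p P (P.map Prod.snd)) (obsScore P a) M t := by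
  rw [map_snd_tilt ha hM]
  refine (mixLaw_withDensity (h := fun o => ENNReal.ofReal
    (1 + (if |t| * M ≤ 1 / 2 then t else 0) * obsScore P a o)) ?_).symm
  exact (((measurable_obsScore ha).const_mul _).const_add 1).ennreal_ofReal

lemma lintegral_obsScore_sq_le (hp : p ∈ Set.Ioo (0 : ℝ) 1) (ha : Measurable a) :
    ∫⁻ o, ‖obsScore P a o‖ₑ ^ 2 ∂(mixLaw p P (P.map Prod.snd)) ≤ ∫⁻ w, ‖a w‖ₑ ^ 2 ∂P := by
  rw [lintegral_mixLaw]
  calc _ ≤ ENNReal.ofReal p * ∫⁻ w, ‖a w‖ₑ ^ 2 ∂P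
        + ENNReal.ofReal (1 - p) * ∫⁻ w, ‖a w‖ₑ ^ 2 ∂P := by
        gcongr
        · exact le_rfl
        · exact lintegral_condAvg_sq_le ha
    _ = _ := by
      rw [← add_mul, ← ENNReal.ofReal_add hp.1.le (by linarith [hp.2])]
      simp

/-- Labeled points keep `a`, unlabeled points see its conditional mean, and neither operation
increases the L² norm. Approximating full-data directions therefore approximates observed scores. -/
lemma eLpNorm_obsScore_le (hp : p ∈ Set.Ioo (0 : ℝ) 1) (ha : Measurable a) :
    eLpNorm (obsScore P a) 2 (mixLaw p P (P.map Prod.snd)) ≤ eLpNorm a 2 P := by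
  have := lintegral_obsScore_sq_le hp (P := P) ha
  rw [← eLpNorm_two_sq, ← eLpNorm_two_sq] at this
  exact (ENNReal.pow_le_pow_left_iff two_ne_zero).1 this

lemma obsScore_sub_ae (hp : p ∈ Set.Ioo (0 : ℝ) 1) {b : ℝ × V → ℝ} (ha : Integrable a P)
    (hb : Integrable b P) : obsScore P (fun w => a w - b w) =ᵐ[mixLaw p P (P.map Prod.snd)]
      fun o => obsScore P a o - obsScore P b o := by
  refine (ae_mixLaw_iff hp).2 ⟨.of_forall fun w => rfl, ?_⟩
  filter_upwards [integrable_condDistrib ha, integrable_condDistrib hb] with v hav hbv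
  exact condAvg_sub hav hbv

end ObservedTilt

/-! ### Solvability of the equation along a tilt -/

section Path

variable {O : Type*} [MeasurableSpace O] {P : Measure O} {q : ℕ} {Θ : Set (Vec q)}
  {f : Vec q → O → Vec q} {F : O → ℝ} {L : O → Vec q →L[ℝ] Vec q} {A : Vec q ≃L[ℝ] Vec q}
  {θ₀ : Vec q} {s : O → ℝ} {M : ℝ}

lemma HasLinearization.bdd_smul (h : HasLinearization P f L θ₀)
    (hM : ∀ o, |s o| ≤ M) (hM0 : 0 ≤ M) :
    HasLinearization P (fun θ o => s o • f θ o) (fun o => s o • L o) θ₀ := by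
  intro ε hε
  obtain ⟨δ, hδ, W, hWm, hWi, hW, hae⟩ := h (ε / (M + 1)) (by positivity)
  refine ⟨δ, hδ, fun o => (M + 1) * W o, hWm.const_mul _, hWi.const_mul _, ?_, ?_⟩
  · rw [integral_const_mul]
    rwa [lt_div_iff₀' (by positivity)] at hW
  · filter_upwards [hae] with o ho θ hθ θ' hθ'
    rw [smul_apply, ← smul_sub, ← smul_sub, mul_assoc, norm_smul]
    have := ho θ hθ θ' hθ'
    have h2 : ‖s o‖ ≤ M + 1 := (hM o).trans (by linarith)
    gcongr

/-- The tilted mean is Ψ + tK. Near θ₀ the implicit function theorem gives exactly one root;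
elsewhere in Θ the norm of Ψ is at least some c > 0, and tK is uniformly smaller than c for small t.
-/
lemma RegularEquation.exists_solution_tilt (H : RegularEquation P Θ f F L A θ₀)
    (hs : Measurable s) (hM : ∀ o, |s o| ≤ M) (hM0 : 0 ≤ M) :
    ∃ ϑ : ℝ → Vec q, ∀ᶠ t in 𝓝 (0 : ℝ), ϑ t ∈ Θ ∧
      ∀ θ ∈ Θ, ∫ o, f θ o ∂(tilt P s M t) = 0 ↔ θ = ϑ t := by
  set Ψ : Vec q → Vec q := fun θ => ∫ o, f θ o ∂P with hΨ
  set K : Vec q → Vec q := fun θ => ∫ o, s o • f θ o ∂P with hK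
  have hsf : ∀ θ ∈ Θ, Integrable (fun o => s o • f θ o) P := fun θ hθ =>
    (H.integrable hθ).bdd_smul M hs.aestronglyMeasurable (.of_forall hM)
  have hKd : HasStrictFDerivAt K (∫ o, s o • L o ∂P) θ₀ :=
    (H.hasLinearization.bdd_smul hM hM0).hasStrictFDerivAt_integral
      (H.integrable_deriv.bdd_smul M hs.aestronglyMeasurable (.of_forall hM))
      (Filter.mem_of_superset H.mem_nhds hsf)
  have hKb : ∀ θ ∈ Θ, ‖K θ‖ ≤ M * ∫ o, F o ∂P := fun θ hθ => by
    rw [← integral_const_mul]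
    refine norm_integral_le_of_norm_le (H.integrable_envelope.const_mul M) ?_
    filter_upwards [H.norm_le_envelope] with o ho
    rw [norm_smul]
    exact mul_le_mul (hM o) (ho θ hθ) (norm_nonneg _) hM0
  set G : ℝ × Vec q → Vec q := fun z => Ψ z.2 + z.1 • K z.2 with hG
  have hGd : HasStrictFDerivAt G ((A : Vec q →L[ℝ] Vec q) ∘L ContinuousLinearMap.snd ℝ ℝ (Vec q)
      + ((0 : ℝ) • ((∫ o, s o • L o ∂P) ∘L ContinuousLinearMap.snd ℝ ℝ (Vec q))
        + (ContinuousLinearMap.fst ℝ ℝ (Vec q)).smulRight (K θ₀))) ((0 : ℝ), θ₀) := by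
    have h1 := HasStrictFDerivAt.comp (f := Prod.snd) ((0 : ℝ), θ₀) H.hasStrictFDerivAt
      hasStrictFDerivAt_snd
    have h2 := HasStrictFDerivAt.comp (f := Prod.snd) ((0 : ℝ), θ₀) hKd hasStrictFDerivAt_snd
    exact h1.add (HasStrictFDerivAt.smul hasStrictFDerivAt_fst h2)
  set G' := ((A : Vec q →L[ℝ] Vec q) ∘L ContinuousLinearMap.snd ℝ ℝ (Vec q)
      + ((0 : ℝ) • ((∫ o, s o • L o ∂P) ∘L ContinuousLinearMap.snd ℝ ℝ (Vec q))
        + (ContinuousLinearMap.fst ℝ ℝ (Vec q)).smulRight (K θ₀))) with hG'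
  -- At `t = 0` the perturbation contributes nothing to the derivative in θ, which is therefore `A`.
  have hinv : (G' ∘L .inr ℝ ℝ (Vec q)).IsInvertible := by
    refine ⟨A, ?_⟩
    ext1 x
    simp [hG']
  have hG0 : G (0, θ₀) = 0 := by simp [hG, hΨ, (H.integral_eq_zero_iff θ₀ H.mem).2 rfl]
  have hev := hGd.eventually_apply_eq_iff_implicitFunctionOfProdDomain hinv
  have hϑ := hGd.tendsto_implicitFunctionOfProdDomain hinv
  set ϑ := hGd.implicitFunctionOfProdDomain hinv
  rw [hG0, nhds_prod_eq, eventually_prod_iff] at hev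
  obtain ⟨p₁, hp₁, p₂, hp₂, hiff⟩ := hev
  obtain ⟨c, hc, hcU⟩ := exists_pos_le_norm H.isCompact H.continuousOn_integral
    (fun θ hθ => (H.integral_eq_zero_iff θ hθ).1) (U := {θ | p₂ θ}) hp₂
  have hsmall : ∀ᶠ t : ℝ in 𝓝 0, |t| * (M * ∫ o, F o ∂P) < c := by
    have : Tendsto (fun t : ℝ => |t| * (M * ∫ o, F o ∂P)) (𝓝 0) (𝓝 (|0| * (M * ∫ o, F o ∂P))) :=
      (continuous_abs.mul continuous_const).continuousAt
    simp only [abs_zero, zero_mul] at this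
    exact this.eventually_lt_const hc
  refine ⟨ϑ, ?_⟩
  filter_upwards [hp₁, hsmall, eventually_tilt_small M, hϑ.eventually hp₂,
    hϑ.eventually H.mem_nhds] with t h1 h2 h3 h4 h5
  refine ⟨h5, fun θ hθ => ?_⟩
  rw [integral_tilt hs hM h3 (H.integrable hθ)]
  by_cases h6 : p₂ θ
  · exact (hiff h1 h6).trans eq_comm
  · constructor
    · intro h7
      exfalso
      have h8 := hcU θ hθ h6
      rw [eq_neg_of_add_eq_zero_left h7, norm_neg, norm_smul] at h8
      have h9 : ‖t‖ * ‖K θ‖ ≤ |t| * (M * ∫ o, F o ∂P) := by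
        rw [Real.norm_eq_abs]
        gcongr
        exact hKb θ hθ
      exact absurd (h8.trans h9) (not_le.2 h2)
    · rintro rfl
      exact absurd h4 h6

end Path


/-! ### The lift as an observed-data score -/

section CondAvgLift

variable {V E G : Type*} [MeasurableSpace V] [NormedAddCommGroup E] [NormedSpace ℝ E]
  [CompleteSpace E] [NormedAddCommGroup G] [NormedSpace ℝ G] [CompleteSpace G]
  {P : Measure (ℝ × V)} [IsProbabilityMeasure P] {p : ℝ}

lemma condAvg_obsLift_inl {f : ℝ × V → E} (hf : Integrable f P) :
    ∀ᵐ v ∂(P.map Prod.snd),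
      condAvg P (fun w => obsLift p P f (Sum.inl w)) v = condAvg P f v := by
  filter_upwards [integrable_condDistrib hf] with v hv
  have h1 : Integrable (fun y => f (y, v) - condAvg P f v)
      (condDistrib (fun w : ℝ × V => w.1) (fun w : ℝ × V => w.2) P v) :=
    hv.sub (integrable_const _)
  calc _ = ∫ y, ((1 / p) • (f (y, v) - condAvg P f v) + condAvg P f v)
        ∂(condDistrib (fun w : ℝ × V => w.1) (fun w : ℝ × V => w.2) P v) := rfl
    _ = (1 / p) • (condAvg P f v - condAvg P f v) + condAvg P f v := by
      rw [integral_add (f := fun y => (1 / p) • (f (y, v) - condAvg P f v)) (h1.smul _)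
        (integrable_const _), integral_smul, integral_sub hv (integrable_const _)]
      simp [condAvg]
    _ = _ := by rw [sub_self, smul_zero, zero_add]

/-- Conditional averaging of the labeled part removes the residual and leaves exactly the unlabeled
part. This consistency between the strata is what makes linear functionals of the lift observed
scores. -/
lemma obsScore_clm_obsLift (hp : p ∈ Set.Ioo (0 : ℝ) 1) {f : ℝ × V → E} (hf : Integrable f P)
    (ℓ : E →L[ℝ] ℝ) : obsScore P (fun w => ℓ (obsLift p P f (Sum.inl w)))
      =ᵐ[mixLaw p P (P.map Prod.snd)] fun o => ℓ (obsLift p P f o) := by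
  have hi := ((integrable_mixLaw_iff hp).1 (integrable_obsLift hp hf)).1
  refine (ae_mixLaw_iff hp).2 ⟨.of_forall fun w => rfl, ?_⟩
  filter_upwards [condAvg_obsLift_inl (p := p) hf, integrable_condDistrib hi] with v hv hiv
  change ∫ y, ℓ (obsLift p P f (Sum.inl (y, v)))
    ∂(condDistrib (fun w : ℝ × V => w.1) (fun w : ℝ × V => w.2) P v) = ℓ (condAvg P f v)
  rw [ℓ.integral_comp_comm hiv, ← hv]
  rfl

end CondAvgLift

/-! ### Tangent space and efficient influence function -/

section Tangent

variable {d q : ℕ} {Z : Type*} [MeasurableSpace Z] {P : Measure (Full d Z)} {p : ℝ}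
  {ψ : ℝ → Vec d → Vec q → Vec q} {Θ : Set (Vec q)} {F : Full d Z → ℝ}
  {L : Full d Z → Vec q →L[ℝ] Vec q} {A : Vec q ≃L[ℝ] Vec q} {θ₀ : Vec q}

lemma obsLaw_eq_mixLaw (p : ℝ) (P : Measure (Full d Z)) :
    obsLaw p P = mixLaw p P (P.map Prod.snd) := by
  rw [obsLaw, mixLaw, Measure.map_map measurable_inr measurable_snd]
  rfl

variable [IsProbabilityMeasure P]

lemma RegularEquation.exists_isRegularSubmodel_tilt
    (H : RegularEquation P Θ (fun θ w => ψ w.1 w.2.1 θ) F L A θ₀) (hp : p ∈ Set.Ioo (0 : ℝ) 1)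
    {a : Full d Z → ℝ} {M : ℝ} (ha : Measurable a) (hM : ∀ w, |a w| ≤ M) (hM0 : 0 ≤ M)
    (h0 : ∫ w, a w ∂P = 0) :
    ∃ ϑ, IsRegularSubmodel ψ P p Θ (tilt P a M) (obsScore P a) ϑ := by
  obtain ⟨ϑ, hϑ⟩ := H.exists_solution_tilt ha hM hM0
  refine ⟨ϑ, isProbabilityMeasure_tilt ha hM h0, tilt_zero, ?_, ?_, hϑ⟩
  · simp only [obsLaw_eq_mixLaw, mixLaw_tilt ha hM]
    have := map_snd_isProbabilityMeasure (P := P)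
    have := isProbabilityMeasure_mixLaw (P := P) (Q := P.map Prod.snd) hp
    exact isQMD_tilt (measurable_obsScore ha) (abs_obsScore_le hM)
  · obtain ⟨C, hC⟩ := H.lintegral_sq_le
    refine ⟨2 * C, .of_forall fun t θ hθ => ?_⟩
    calc _ ≤ ∫⁻ w, ‖ψ w.1 w.2.1 θ‖ₑ ^ 2 ∂((2 : ENNReal) • P) :=
          lintegral_mono' (tilt_le hM t) le_rfl
      _ = 2 * ∫⁻ w, ‖ψ w.1 w.2.1 θ‖ₑ ^ 2 ∂P := lintegral_smul_measure _ _
      _ ≤ _ := by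
        push_cast
        gcongr
        exact hC θ hθ

lemma exists_bounded_centered {O : Type*} [MeasurableSpace O] {ν : Measure O}
    [IsProbabilityMeasure ν] {b : O → ℝ} (hb : MemLp b 2 ν) (h0 : ∫ o, b o ∂ν = 0)
    {ε : ENNReal} (hε : ε ≠ 0) : ∃ (a : O → ℝ) (M : ℝ), Measurable a ∧ 0 ≤ M ∧
      (∀ o, |a o| ≤ M) ∧ ∫ o, a o ∂ν = 0 ∧ eLpNorm (fun o => b o - a o) 2 ν < ε := by
  obtain ⟨g, hg, hg2⟩ := hb.exists_simpleFunc_eLpNorm_sub_lt (by norm_num)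
    (ENNReal.div_ne_zero.2 ⟨hε, (by norm_num : (2 : ENNReal) ≠ ⊤)⟩)
  have hgi := hg2.integrable (by norm_num)
  have hbi := hb.integrable (by norm_num)
  obtain ⟨M, hM⟩ := g.exists_forall_norm_le
  set c := ∫ o, g o ∂ν
  -- As `b` is centered, the mean of `g` is minus the mean of the approximation error, so
  -- recentering costs no more than approximating: ε/2 each.
  have hc : ‖c‖ₑ ≤ eLpNorm (b - ⇑g) 2 ν := by
    have e : c = -∫ o, (b - ⇑g) o ∂ν := by
      rw [integral_sub' hbi hgi, h0, zero_sub, neg_neg]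
    rw [e, enorm_neg]
    refine (enorm_integral_le_lintegral_enorm _).trans ?_
    rw [← eLpNorm_one_eq_lintegral_enorm]
    exact eLpNorm_le_eLpNorm_of_exponent_le (by norm_num) (hb.sub hg2).1
  refine ⟨fun o => g o - c, |M| + |c|, g.measurable.sub_const c, by positivity, fun o => ?_, ?_, ?_⟩
  · exact (abs_sub _ _).trans (add_le_add ((hM o).trans (le_abs_self M)) le_rfl)
  · rw [integral_sub hgi (integrable_const c)]
    simp [c]
  · have e : (fun o => b o - (g o - c)) = (b - ⇑g) + fun _ => c := by
      ext o
      simp only [Pi.add_apply, Pi.sub_apply]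
      ring
    rw [e]
    refine (eLpNorm_add_le (hb.sub hg2).1 aestronglyMeasurable_const (by norm_num)).trans_lt ?_
    have hcn : eLpNorm (fun _ : O => c) 2 ν = ‖c‖ₑ := by
      rw [eLpNorm_const _ (by norm_num) (IsProbabilityMeasure.ne_zero ν)]
      simp
    rw [hcn, ← ENNReal.add_halves ε]
    exact ENNReal.add_lt_add hg (hc.trans_lt hg)

/-- Bounded centered directions give regular submodels and are dense among centered L² functions;
contraction of `obsScore` carries the approximation to the observed data. -/
lemma RegularEquation.mem_tangentSpace
    (H : RegularEquation P Θ (fun θ w => ψ w.1 w.2.1 θ) F L A θ₀) (hp : p ∈ Set.Ioo (0 : ℝ) 1)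
    {b : Full d Z → ℝ} (hbm : Measurable b) (hb : MemLp b 2 P) (h0 : ∫ w, b w ∂P = 0)
    {G : Lp ℝ 2 (obsLaw p P)} (hG : G =ᵐ[obsLaw p P] obsScore P b) :
    G ∈ tangentSpace ψ P p Θ := by
  change G ∈ closure _
  rw [EMetric.mem_closure_iff]
  intro ε hε
  obtain ⟨a, M, ha, hM0, hM, ha0, hab⟩ := exists_bounded_centered hb h0 hε.ne'
  obtain ⟨ϑ, hϑ⟩ := H.exists_isRegularSubmodel_tilt hp ha hM hM0 ha0
  have := map_snd_isProbabilityMeasure (P := P)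
  have hpr := isProbabilityMeasure_mixLaw (P := P) (Q := P.map Prod.snd) hp
  rw [← obsLaw_eq_mixLaw] at hpr
  have hS : MemLp (obsScore P a) 2 (obsLaw p P) :=
    MemLp.of_bound (measurable_obsScore ha).aestronglyMeasurable M
      (.of_forall (abs_obsScore_le hM))
  refine ⟨hS.toLp, Submodule.subset_span ⟨_, _, ϑ, hϑ, hS.coeFn_toLp⟩, ?_⟩
  have hai : Integrable a P :=
    (integrable_const M).mono' ha.aestronglyMeasurable (.of_forall hM)
  rw [Lp.edist_def]
  have e : eLpNorm (⇑G - ⇑hS.toLp) 2 (obsLaw p P) =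
      eLpNorm (obsScore P fun w => b w - a w) 2 (obsLaw p P) := by
    refine eLpNorm_congr_ae ?_
    have h1 := obsScore_sub_ae hp (hb.integrable (by norm_num)) hai
    rw [← obsLaw_eq_mixLaw] at h1
    filter_upwards [hG, hS.coeFn_toLp, h1] with o o1 o2 o3
    rw [Pi.sub_apply, o1, o2, o3]
  rw [e, obsLaw_eq_mixLaw]
  exact (eLpNorm_obsScore_le hp (hbm.sub ha)).trans_lt hab

/-- The efficient influence function of the parameter that a regular equation defines. -/
theorem RegularEquation.isEfficientInfluenceFunction
    (H : RegularEquation P Θ (fun θ w => ψ w.1 w.2.1 θ) F L A θ₀) (hp : p ∈ Set.Ioo (0 : ℝ) 1) :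
    IsEfficientInfluenceFunction ψ P p Θ
      (fun o => -A.symm (obsLift p P (fun w => ψ w.1 w.2.1 θ₀) o)) := by
  have hfm := H.measurable _ H.mem
  have hf2 := H.memLp H.mem
  have hfi := H.integrable H.mem
  have hl2 := memLp_obsLift hp hfm hf2
  have hD2 : MemLp (fun o => -A.symm (obsLift p P (fun w => ψ w.1 w.2.1 θ₀) o)) 2
      (mixLaw p P (P.map Prod.snd)) :=
    (ContinuousLinearMap.comp_memLp' (A.symm : Vec q →L[ℝ] Vec q) hl2).neg
  refine ⟨?_, fun Pt g ϑ hs => ?_, fun i => ?_⟩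
  · rwa [obsLaw_eq_mixLaw]
  · have := hs.isProb
    obtain ⟨C, hC⟩ := hs.moment
    have hq := hs.qmd
    simp only [obsLaw_eq_mixLaw] at hq ⊢
    refine H.hasDerivAt hp hs.base hq hC ?_
    filter_upwards [hs.param] with t ht
    exact ⟨ht.1, (ht.2 _ ht.1).2 rfl⟩
  · set ℓ : Vec q →L[ℝ] ℝ :=
      -((EuclideanSpace.proj i : Vec q →L[ℝ] ℝ) ∘L (A.symm : Vec q →L[ℝ] Vec q)) with hℓ
    have hℓD : ∀ o, ℓ (obsLift p P (fun w => ψ w.1 w.2.1 θ₀) o) =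
        (-A.symm (obsLift p P (fun w => ψ w.1 w.2.1 θ₀) o)) i := fun o => by simp [hℓ]
    have hae := obsScore_clm_obsLift hp hfi ℓ
    simp only [← hℓD]
    have hl : MemLp (fun o => ℓ (obsLift p P (fun w => ψ w.1 w.2.1 θ₀) o)) 2 (obsLaw p P) := by
      rw [obsLaw_eq_mixLaw]
      exact ContinuousLinearMap.comp_memLp' ℓ hl2
    refine ⟨hl.toLp, ?_, hl.coeFn_toLp⟩
    have hlin := (memLp_two_mixLaw_iff hp).1 hl2
    refine H.mem_tangentSpace hp
      (b := fun w => ℓ (obsLift p P (fun w => ψ w.1 w.2.1 θ₀) (Sum.inl w)))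
      (ℓ.continuous.measurable.comp ((measurable_obsLift hfm).comp measurable_inl))
      (ContinuousLinearMap.comp_memLp' ℓ hlin.1) ?_ ?_
    · rw [ℓ.integral_comp_comm (hlin.1.integrable (by norm_num)), integral_obsLift_inl hfi,
        (H.integral_eq_zero_iff θ₀ H.mem).2 rfl, map_zero]
    · rw [← obsLaw_eq_mixLaw] at hae
      exact hl.coeFn_toLp.trans hae.symm

end Tangent


/-! ### Limit law of the estimator, and the envelope of ψ -/

section Estimator

variable {V Ω : Type*} [MeasurableSpace V] [MeasurableSpace Ω] {μ : Measure Ω}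
  [IsProbabilityMeasure μ] {P : Measure (ℝ × V)} [IsProbabilityMeasure P] {p : ℝ} {q : ℕ}
  {Θ : Set (Vec q)} {f : Vec q → ℝ × V → Vec q} {F : ℝ × V → ℝ}
  {L : ℝ × V → Vec q →L[ℝ] Vec q} {A : Vec q ≃L[ℝ] Vec q} {θ₀ : Vec q} {n N : ℕ → ℕ}
  {x : ℕ → Ω → ℝ × V} {y : ℕ → Ω → V} {θhat : ℕ → Ω → Vec q}

/-- Asymptotic normality of the solution of the augmented weighted estimating equation. -/
theorem RegularEquation.tendstoInDistribution (H : RegularEquation P Θ f F L A θ₀)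
    (T : TwoSample μ p P (P.map Prod.snd) n N x y)
    (hmeas : ∀ k, AEMeasurable (θhat k) μ)
    (hsol : WithHighProb μ (fun k ω => θhat k ω ∈ Θ ∧
      pooledMean (fun o => A.symm (obsLift p P (f (θhat k ω)) o)) (n k) (N k)
        (fun i => x i ω) (fun i => y i ω) = 0)) :
    TendstoInDistribution (fun k ω => √((n k : ℝ) + N k) • (θhat k ω - θ₀)) atTop id (fun _ => μ)
      (multivariateGaussian 0 (secondMoment (mixLaw p P (P.map Prod.snd))
        fun o => -A.symm (obsLift p P (f θ₀) o))) := by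
  have hp := T.hp
  have hAm : Measurable A.symm := A.symm.continuous.measurable
  set Φ : Vec q → (ℝ × V) ⊕ V → Vec q := fun θ o => A.symm (obsLift p P (f θ) o) with hΦ
  have hΦi : ∀ θ ∈ Θ, Integrable (Φ θ) (mixLaw p P (P.map Prod.snd)) := fun θ hθ =>
    (A.symm : Vec q →L[ℝ] Vec q).integrable_comp (integrable_obsLift hp (H.integrable hθ))
  have hcons : ∀ ε > 0, WithHighProb μ (fun k ω => dist (θhat k ω) θ₀ < ε) := fun ε hε => by
    refine T.consistency H.isCompact (Φ := Φ)
      (fun θ hθ => hAm.comp (measurable_obsLift (H.measurable θ hθ))) hΦi (fun θ hθ h0 => ?_)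
      ((H.hasLocalModulus.obsLift hp H.integrable_envelope H.measurable
        H.norm_le_envelope).clm_comp A.symm) hsol hε
    rw [ContinuousLinearEquiv.integral_comp_comm, integral_obsLift hp (H.integrable hθ)] at h0
    exact (H.integral_eq_zero_iff θ hθ).1 (by simpa using h0)
  have hLi := integrable_obsLift hp H.integrable_deriv
  have hexp : ∀ ε > 0, WithHighProb μ (fun k ω => ‖(θhat k ω - θ₀) + pooledMean (Φ θ₀) (n k) (N k)
      (fun i => x i ω) (fun i => y i ω)‖ ≤ ε * ‖θhat k ω - θ₀‖) := fun ε hε => by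
    -- Composing with the inverse of `A` normalizes the mean derivative to the identity.
    set C := ContinuousLinearMap.compL ℝ (Vec q) (Vec q) (Vec q) (A.symm : Vec q →L[ℝ] Vec q)
    refine T.linear_expansion (Φ := Φ) (L := fun o => C (obsLift p P L o))
      (C.continuous.measurable.comp (measurable_obsLift H.measurable_deriv))
      (C.integrable_comp hLi) ?_ ((H.hasLinearization.obsLift hp H.integrable_envelope
        H.measurable H.norm_le_envelope H.mem_nhds H.integrable_deriv).clm_comp A.symm)
      (hsol.mono fun k ω h => h.2) hcons hε
    rw [C.integral_comp_comm hLi, integral_obsLift hp H.integrable_deriv, H.integral_deriv]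
    ext1 v
    simp [C]
  have hfm := H.measurable _ H.mem
  have hl2 := memLp_obsLift hp hfm (H.memLp H.mem)
  have hl1 := (integrable_mixLaw_iff hp).1 (integrable_obsLift hp (H.integrable H.mem))
  have h0 := (H.integral_eq_zero_iff θ₀ H.mem).2 rfl
  refine asymptotic_linearity hexp (T.tendstoInDistribution_pooledMean
    (hAm.comp (measurable_obsLift hfm)).neg
    (ContinuousLinearMap.comp_memLp' (A.symm : Vec q →L[ℝ] Vec q) hl2).neg ?_ ?_) hmeas
  · rw [integral_neg, ContinuousLinearEquiv.integral_comp_comm,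
      integral_obsLift_inl (H.integrable H.mem), h0, map_zero, neg_zero]
  · rw [integral_neg, ContinuousLinearEquiv.integral_comp_comm]
    change -A.symm (∫ v, condAvg P (f θ₀) v ∂(P.map Prod.snd)) = 0
    rw [integral_condAvg (H.integrable H.mem), h0, map_zero, neg_zero]

/-- An integrable envelope of the augmented weighted functions yields one of the original
functions. -/
lemma exists_envelope (hp : p ∈ Set.Ioo (0 : ℝ) 1) (hm : ∀ θ ∈ Θ, Measurable (f θ))
    (hc : ∀ᵐ w ∂P, ContinuousOn (fun θ => f θ w) Θ)
    (hsup : ∫⁻ o, ⨆ θ ∈ Θ, ‖A.symm (obsLift p P (f θ) o)‖ₑ ∂(mixLaw p P (P.map Prod.snd)) < ⊤) :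
    ∃ F : ℝ × V → ℝ, Measurable F ∧ Integrable F P ∧ ∀ᵐ w ∂P, ∀ θ ∈ Θ, ‖f θ w‖ ≤ F w := by
  obtain ⟨D, hDΘ, hD, hΘD⟩ :=
    (TopologicalSpace.IsSeparable.of_separableSpace Θ).exists_countable_dense_subset
  set G : (ℝ × V) ⊕ V → ENNReal := fun o => ⨆ θ ∈ D, ‖A.symm (obsLift p P (f θ) o)‖ₑ with hG
  have hGm : Measurable G := .biSup D hD fun θ hθ =>
    (A.symm.continuous.measurable.comp (measurable_obsLift (hm θ (hDΘ hθ)))).enorm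
  have hGl : ∫⁻ o, G o ∂(mixLaw p P (P.map Prod.snd)) < ⊤ :=
    (lintegral_mono fun o => biSup_mono hDΘ).trans_lt hsup
  set W : ℝ × V → ENNReal := fun w => ‖(A : Vec q →L[ℝ] Vec q)‖ₑ *
    (ENNReal.ofReal p * G (Sum.inl w) + ENNReal.ofReal (1 - p) * G (Sum.inr w.2)) with hW
  have hG1 : Measurable fun w => G (Sum.inl w) := hGm.comp measurable_inl
  have hG2 : Measurable fun v => G (Sum.inr v) := hGm.comp measurable_inr
  have hG3 : Measurable fun w : ℝ × V => G (Sum.inr w.2) := hG2.comp measurable_snd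
  have hWm : Measurable W := ((hG1.const_mul _).add (hG3.const_mul _)).const_mul _
  have hWl : ∫⁻ w, W w ∂P < ⊤ := by
    rw [hW, lintegral_const_mul (f := fun w => ENNReal.ofReal p * G (Sum.inl w)
      + ENNReal.ofReal (1 - p) * G (Sum.inr w.2)) _ ((hG1.const_mul _).add (hG3.const_mul _)),
      lintegral_add_left (hG1.const_mul _), lintegral_const_mul _ hG1, lintegral_const_mul _ hG3,
      ← lintegral_map hG2 measurable_snd, ← lintegral_mixLaw]
    exact ENNReal.mul_lt_top enorm_lt_top hGl
  have hfW : ∀ w, ∀ θ ∈ D, ‖f θ w‖ₑ ≤ W w := fun w θ hθ => by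
    -- The p-weighted average of the labeled and unlabeled values at the same covariates cancels the
    -- conditional mean, so a bound on φ bounds ψ.
    have e : f θ w = (A : Vec q →L[ℝ] Vec q) (p • A.symm (obsLift p P (f θ) (Sum.inl w))
        + (1 - p) • A.symm (obsLift p P (f θ) (Sum.inr w.2))) := by
      rw [← map_smul, ← map_smul, ← map_add]
      simp only [obsLift, ContinuousLinearEquiv.coe_coe, ContinuousLinearEquiv.apply_symm_apply]
      rw [smul_add, smul_smul, mul_one_div_cancel hp.1.ne']
      module
    have hle : ∀ o, ‖A.symm (obsLift p P (f θ) o)‖ₑ ≤ G o := fun o =>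
      le_iSup₂ (f := fun θ (_ : θ ∈ D) => ‖A.symm (obsLift p P (f θ) o)‖ₑ) θ hθ
    conv_lhs => rw [e]
    refine (ContinuousLinearMap.le_opENorm _ _).trans (mul_le_mul_right ?_ _)
    refine (enorm_add_le _ _).trans (add_le_add ?_ ?_)
    · rw [enorm_smul, Real.enorm_of_nonneg hp.1.le]
      exact mul_le_mul_right (hle _) _
    · rw [enorm_smul, Real.enorm_of_nonneg (by linarith [hp.2])]
      exact mul_le_mul_right (hle _) _
  refine ⟨fun w => (W w).toReal, hWm.ennreal_toReal,
    integrable_toReal_of_lintegral_ne_top hWm.aemeasurable hWl.ne, ?_⟩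
  filter_upwards [hc, ae_lt_top hWm hWl.ne] with w hw hwt θ hθ
  have := mem_closure_iff_nhdsWithin_neBot.1 (hΘD hθ)
  refine le_of_tendsto ((hw θ hθ).mono hDΘ).norm ?_
  filter_upwards [self_mem_nhdsWithin] with z hz
  have h1 := ENNReal.toReal_mono hwt.ne (hfW w z hz)
  rwa [toReal_enorm] at h1

end Estimator

/-! ### Rescaling Gaussian limits -/

section Gaussian

variable {q : ℕ}

lemma map_smul_multivariateGaussian {S : Matrix (Fin q) (Fin q) ℝ} (hS : S.PosSemidef) {c : ℝ}
    (hc : 0 ≤ c) :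
    (multivariateGaussian (0 : Vec q) S).map (fun z => √c • z) =
      multivariateGaussian 0 (c • S) := by
  have : IsProbabilityMeasure ((multivariateGaussian (0 : Vec q) S).map fun z => √c • z) :=
    Measure.isProbabilityMeasure_map (by fun_prop)
  refine Measure.ext_of_charFun ?_
  ext t
  rw [charFun_map_smul, charFun_multivariateGaussian hS, charFun_multivariateGaussian (hS.smul hc)]
  congr 1
  have h : √c * √c = c := Real.mul_self_sqrt hc
  simp only [inner_zero_right, WithLp.ofLp_smul, Matrix.mulVec_smul, dotProduct_smul,
    smul_dotProduct, Matrix.smul_mulVec, smul_eq_mul, ← mul_assoc, h]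

lemma tendstoInDistribution_sqrt_smul {Ω : Type*} [MeasurableSpace Ω] {μ : Measure Ω}
    [IsProbabilityMeasure μ] {X : ℕ → Ω → Vec q} {S : Matrix (Fin q) (Fin q) ℝ}
    (hS : S.PosSemidef) {c : ℝ} (hc : 0 ≤ c) {s : ℕ → ℝ} (hs : Tendsto s atTop (𝓝 c))
    (h : TendstoInDistribution X atTop id (fun _ => μ) (multivariateGaussian 0 S)) :
    TendstoInDistribution (fun k ω => √(s k) • X k ω) atTop id (fun _ => μ)
      (multivariateGaussian 0 (c • S)) := by
  have hY : TendstoInMeasure μ (fun k (_ : Ω) => √(s k)) atTop (fun _ => √c) :=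
    tendstoInMeasure_of_tendsto_ae (fun _ => aestronglyMeasurable_const)
      (.of_forall fun _ => (Real.continuous_sqrt.tendsto c).comp hs)
  have key := h.continuous_comp_prodMk_of_tendstoInMeasure_const
    (g := fun z : Vec q × ℝ => z.2 • z.1) (by fun_prop) hY (fun _ => aemeasurable_const)
  refine ⟨key.forall_aemeasurable, aemeasurable_id, ?_⟩
  convert key.tendsto using 2
  refine congrArg 𝓝 (Subtype.ext ?_)
  change (multivariateGaussian 0 (c • S)).map id = (multivariateGaussian 0 S).map fun z => √c • z
  rw [map_smul_multivariateGaussian hS hc, Measure.map_id]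

end Gaussian

/-! ### Identification with φ and A -/

section Setting

variable {d q : ℕ} {Z : Type*} [MeasurableSpace Z] {P : Measure (Full d Z)}
  {ψ : ℝ → Vec d → Vec q → Vec q} {θ₀ : Vec q} {p : ℝ}

lemma eif_eq_obsLift [IsFiniteMeasure P] (θ : Vec q) : eif ψ P p θ₀ θ = fun o =>
    Matrix.toEuclideanCLM (𝕜 := ℝ) (jacobian ψ P θ₀)⁻¹
      (obsLift p P (fun w => ψ w.1 w.2.1 θ) o) := by
  funext o
  rcases o with ⟨y, v⟩ | v
  · simp only [eif, obsLift, map_add, map_smul]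
    rfl
  · rfl

/-- The invertible linear map of a nonsingular matrix. -/
noncomputable def matrixEquiv (J : Matrix (Fin q) (Fin q) ℝ) (hJ : J.det ≠ 0) :
    Vec q ≃L[ℝ] Vec q :=
  ContinuousLinearEquiv.equivOfInverse (Matrix.toEuclideanCLM (𝕜 := ℝ) J)
    (Matrix.toEuclideanCLM (𝕜 := ℝ) J⁻¹)
    (fun v => by
      rw [← mul_apply_eq_comp, ← map_mul, Matrix.nonsing_inv_mul J hJ.isUnit, map_one,
        one_apply_eq_self])
    (fun v => by
      rw [← mul_apply_eq_comp, ← map_mul, Matrix.mul_nonsing_inv J hJ.isUnit, map_one,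
        one_apply_eq_self])

lemma integral_eq_matrixEquiv {L : Full d Z → Vec q →L[ℝ] Vec q} (hL : Integrable L P)
    (hJ : (jacobian ψ P θ₀).det ≠ 0)
    (hae : ∀ᵐ w ∂P, fderiv ℝ (fun θ => ψ w.1 w.2.1 θ) θ₀ = L w) :
    ∫ w, L w ∂P = (matrixEquiv (jacobian ψ P θ₀) hJ : Vec q →L[ℝ] Vec q) := by
  have hcol : ∀ j, (∫ w, L w ∂P) (EuclideanSpace.single j 1) =
      Matrix.toEuclideanCLM (𝕜 := ℝ) (jacobian ψ P θ₀) (EuclideanSpace.single j 1) := fun j => by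
    ext i
    have h1 : (∫ w, L w ∂P) (EuclideanSpace.single j 1) i =
        ∫ w, L w (EuclideanSpace.single j 1) i ∂P := by
      rw [ContinuousLinearMap.integral_apply hL]
      exact ((EuclideanSpace.proj i : Vec q →L[ℝ] ℝ).integral_comp_comm
        (hL.apply_continuousLinearMap _)).symm
    rw [h1]
    have h2 : (Matrix.toEuclideanCLM (𝕜 := ℝ) (jacobian ψ P θ₀) (EuclideanSpace.single j 1)) i =
        jacobian ψ P θ₀ i j := by
      simp [Matrix.ofLp_toEuclideanCLM]
    rw [h2, jacobian, Matrix.of_apply]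
    refine integral_congr_ae ?_
    filter_upwards [hae] with w hw
    rw [hw]
  ext1 v
  rw [← (EuclideanSpace.basisFun (Fin q) ℝ).sum_repr v]
  simp only [map_sum, map_smul, EuclideanSpace.basisFun_apply, hcol]
  rfl

/-- Implicit differentiation produces −φ(θ₀) as influence function; the sign disappears in the
covariance. -/
lemma secondMoment_neg {O : Type*} [MeasurableSpace O] {ν : Measure O} {D : O → Vec q} :
    secondMoment ν (fun o => -D o) = secondMoment ν D := by
  ext i j
  simp [secondMoment]

end Setting

/-! ### Assembling the assumptions -/

section Corollary

variable {d q : ℕ} {Z : Type*} [MeasurableSpace Z] {P : Measure (Full d Z)}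
  [IsProbabilityMeasure P] {ψ : ℝ → Vec d → Vec q → Vec q} {Θ B : Set (Vec q)} {θ₀ : Vec q} {p : ℝ}

lemma eif_eq_matrixEquiv (hA : (jacobian ψ P θ₀).det ≠ 0) (θ : Vec q) :
    eif ψ P p θ₀ θ = fun o => (matrixEquiv _ hA).symm
      (obsLift p P (fun w => ψ w.1 w.2.1 θ) o) :=
  eif_eq_obsLift θ

lemma exists_regularEquation
    (hψ_meas : ∀ θ ∈ Θ, Measurable (fun w : ℝ × Vec d => ψ w.1 w.2 θ))
    (hΘ : IsCompact Θ) (hθ₀ : IsUniqueSolution ψ P Θ θ₀)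
    (hC3 : (⨆ θ ∈ Θ, ∫⁻ w, ‖ψ w.1 w.2.1 θ‖ₑ ^ 2 ∂P) < ⊤)
    (hcont : ∀ᵐ w ∂P, ContinuousOn (fun θ => ψ w.1 w.2.1 θ) Θ)
    (hB : IsOpen B) (hθ₀B : θ₀ ∈ B) (hBΘ : B ⊆ Θ)
    (hdiff : ∀ᵐ w ∂P, ContDiffOn ℝ 1 (fun θ => ψ w.1 w.2.1 θ) B)
    (hderiv : (∫⁻ w, ⨆ θ ∈ B, ‖fderiv ℝ (fun θ' => ψ w.1 w.2.1 θ') θ‖ₑ ∂P) < ⊤)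
    (hA : (jacobian ψ P θ₀).det ≠ 0) (hp : p ∈ Set.Ioo (0 : ℝ) 1)
    (hsup : (∫⁻ o, ⨆ θ ∈ Θ, ‖eif ψ P p θ₀ θ o‖ₑ ∂(obsLaw p P)) < ⊤) :
    ∃ F L, RegularEquation P Θ (fun θ w => ψ w.1 w.2.1 θ) F L (matrixEquiv _ hA) θ₀ := by
  have hΘ₀ : Θ ∈ 𝓝 θ₀ := mem_of_superset (hB.mem_nhds hθ₀B) hBΘ
  have hm : ∀ θ ∈ Θ, Measurable fun w : Full d Z => ψ w.1 w.2.1 θ := fun θ hθ =>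
    (hψ_meas θ hθ).comp (measurable_fst.prodMk (measurable_fst.comp measurable_snd))
  obtain ⟨L, hLm, hLi, hLae, hlin⟩ := exists_hasLinearization (ν := P)
    (f := fun θ w => ψ w.1 w.2.1 θ) hB hθ₀B (fun θ hθ => hm θ (hBΘ hθ)) hdiff hderiv
  simp only [eif_eq_matrixEquiv hA, obsLaw_eq_mixLaw] at hsup
  obtain ⟨F, hFm, hFi, hfF⟩ := exists_envelope (V := Vec d × Z) (P := P) (A := matrixEquiv _ hA)
    (f := fun θ (w : Full d Z) => ψ w.1 w.2.1 θ) hp hm hcont hsup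
  exact ⟨F, L,
    { isCompact := hΘ
      mem_nhds := hΘ₀
      measurable := hm
      measurable_envelope := hFm
      integrable_envelope := hFi
      norm_le_envelope := hfF
      continuousOn := hcont
      measurable_deriv := hLm
      integrable_deriv := hLi
      integral_deriv := integral_eq_matrixEquiv hLi hA hLae
      hasLinearization := hlin
      lintegral_sq_le := ⟨(⨆ θ ∈ Θ, ∫⁻ w, ‖ψ w.1 w.2.1 θ‖ₑ ^ 2 ∂P).toNNReal, fun θ hθ => by
        rw [ENNReal.coe_toNNReal hC3.ne]
        exact le_iSup₂ (f := fun θ (_ : θ ∈ Θ) => ∫⁻ w, ‖ψ w.1 w.2.1 θ‖ₑ ^ 2 ∂P) θ hθ⟩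
      integral_eq_zero_iff := hθ₀.2 }⟩

lemma secondMoment_eif (hA : (jacobian ψ P θ₀).det ≠ 0) :
    secondMoment (obsLaw p P) (eif ψ P p θ₀ θ₀) = secondMoment (mixLaw p P (P.map Prod.snd))
      fun o => -(matrixEquiv _ hA).symm (obsLift p P (fun w => ψ w.1 w.2.1 θ₀) o) := by
  rw [secondMoment_neg, eif_eq_matrixEquiv hA, obsLaw_eq_mixLaw]

lemma sqrt_mul_sqrt_fraction (n N : ℕ) : √((n : ℝ) / (n + N)) * √((n : ℝ) + N) = √(n : ℝ) := by
  rw [← Real.sqrt_mul (by positivity)]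
  -- For an empty sample the quotient is zero by convention, and so are both sides.
  rcases eq_or_ne ((n : ℝ) + N) 0 with h | h
  · have : (n : ℝ) = 0 :=
      le_antisymm (by linarith [N.cast_nonneg (α := ℝ)]) (Nat.cast_nonneg _)
    rw [this, zero_div, zero_mul]
  · rw [div_mul_cancel₀ _ h]

end Corollary

end PostPred

theorem corollary3 {d q : ℕ} {Z : Type*} [MeasurableSpace Z]
    {Ω : Type*} [MeasurableSpace Ω] (μ : Measure Ω) [IsProbabilityMeasure μ]
    -- the estimating function, the law of `(Y, X, Z)`, and the parameter
    (ψ : ℝ → Vec d → Vec q → Vec q) (P : Measure (Full d Z)) [IsProbabilityMeasure P]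
    (Θ : Set (Vec q)) (θ₀ : Vec q)
    (hψ_meas : ∀ θ ∈ Θ, Measurable (fun w : ℝ × Vec d => ψ w.1 w.2 θ))
    -- (C1)
    (hΘ : IsCompact Θ) (hθ₀ : IsUniqueSolution ψ P Θ θ₀)
    -- (C3)
    (hC3 : (⨆ θ ∈ Θ, ∫⁻ w, ‖ψ w.1 w.2.1 θ‖ₑ ^ 2 ∂P) < ⊤)
    -- continuity of the estimating function
    (hcont : ∀ᵐ w ∂P, ContinuousOn (fun θ => ψ w.1 w.2.1 θ) Θ)
    -- smoothness near `θ₀` and nonsingularity of the derivative matrix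
    (B : Set (Vec q)) (hB : IsOpen B) (hθ₀B : θ₀ ∈ B) (hBΘ : B ⊆ Θ)
    (hdiff : ∀ᵐ w ∂P, ContDiffOn ℝ 1 (fun θ => ψ w.1 w.2.1 θ) B)
    (hderiv : (∫⁻ w, ⨆ θ ∈ B, ‖fderiv ℝ (fun θ' => ψ w.1 w.2.1 θ') θ‖ₑ ∂P) < ⊤)
    (hA : (jacobian ψ P θ₀).det ≠ 0)
    -- the labeling probability and the sample sizes
    (p : ℝ) (hp : p ∈ Set.Ioo (0 : ℝ) 1) (n N : ℕ → ℕ)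
    (hn : Tendsto n atTop atTop) (hN : Tendsto N atTop atTop)
    (hp_lim : Tendsto (fun k => (n k : ℝ) / ((n k : ℝ) + N k)) atTop (𝓝 p))
    -- i.i.d. labeled and unlabeled data, independent of each other
    (lab : ℕ → Ω → Full d Z) (unl : ℕ → Ω → Vec d × Z)
    (hlab : ∀ i, HasLaw (lab i) P μ) (hunl : ∀ i, HasLaw (unl i) (P.map Prod.snd) μ)
    (hlab_ind : iIndepFun lab μ) (hunl_ind : iIndepFun unl μ)
    (hind : IndepFun (fun ω i => lab i ω) (fun ω i => unl i ω) μ)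
    -- integrability of `sup_θ φ`
    (hsup : (∫⁻ o, ⨆ θ ∈ Θ, ‖eif ψ P p θ₀ θ o‖ₑ ∂(obsLaw p P)) < ⊤)
    -- with probability tending to one, the empirical equation has exactly one solution, and the
    -- estimator is that solution
    (θhat : ℕ → Ω → Vec q) (hθhat_meas : ∀ k, AEMeasurable (θhat k) μ)
    (hθhat : Tendsto (fun k => μ {ω | ¬ (θhat k ω ∈ Θ ∧ ∀ θ ∈ Θ,
        (empiricalEIF ψ P p θ₀ (n k) (N k) (fun i => lab i ω) (fun i => unl i ω) θ = 0
          ↔ θ = θhat k ω))}) atTop (𝓝 0)) :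
    -- asymptotic normality
    TendstoInDistribution (fun k ω => √(n k : ℝ) • (θhat k ω - θ₀)) atTop id (fun _ => μ)
      (multivariateGaussian 0 (p • secondMoment (obsLaw p P) (eif ψ P p θ₀ θ₀)))
    -- efficiency: with the scaling by the full sample size, the asymptotic covariance matrix is
    -- the semiparametric efficiency bound
    ∧ ∃ V : Matrix (Fin q) (Fin q) ℝ, IsEfficiencyBound ψ P p Θ V ∧
        V = secondMoment (obsLaw p P) (eif ψ P p θ₀ θ₀) ∧
        TendstoInDistribution (fun k ω => √((n k : ℝ) + N k) • (θhat k ω - θ₀)) atTop id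
          (fun _ => μ) (multivariateGaussian 0 V) := by
  obtain ⟨F, L, H⟩ := exists_regularEquation hψ_meas hΘ hθ₀ hC3 hcont hB hθ₀B hBΘ hdiff hderiv hA
    hp hsup
  have T : TwoSample μ p P (P.map Prod.snd) n N lab unl :=
    ⟨hp, hn, hN, hp_lim, hlab, hunl, hlab_ind, hunl_ind, hind⟩
  have hlim := H.tendstoInDistribution T hθhat_meas (WithHighProb.mono hθhat fun k ω h => ⟨h.1, by
    have h1 := (h.2 _ h.1).2 rfl
    simp only [empiricalEIF, eif_eq_matrixEquiv hA] at h1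
    exact h1⟩)
  have hE := H.isEfficientInfluenceFunction hp
  have hps := posSemidef_secondMoment hE.memLp
  rw [obsLaw_eq_mixLaw, ← secondMoment_eif hA] at hps
  rw [← secondMoment_eif hA] at hlim
  refine ⟨?_, _, ⟨_, hE, ?_⟩, rfl, hlim⟩
  -- The factor √(n/(n+N)) changes the scaling from √(n+N) to √n and multiplies the covariance by
  -- its squared limit `p`.
  · have key := tendstoInDistribution_sqrt_smul hps hp.1.le hp_lim hlim
    simpa only [smul_smul, sqrt_mul_sqrt_fraction] using key
  · rw [secondMoment_eif hA, obsLaw_eq_mixLaw]
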